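/- Let $R$ be a discrete valuation ring with uniformizer $t$ and residue field $K=R/(t)$, and let $S^1=\mathbb R/2\pi\mathbb Z$. **The category $\mathcal C_\pi$.** Its indecomposable objects are the ordered pairs $(x_0,x_1)$ of distinct points of $S^1$, labelled by real numbers $x_0<x_1<x_0+2\pi$ up to simultaneous translation by $2\pi\mathbb Z$. For $X=(x_0,x_1)$, $Y=(y_0,y_1)$ the space $\mathcal C_\pi(X,Y)$ is $K\,b_+^{XY}$ if the coordinates can be chosen with $x_0\le y_0<x_1\le y_1<x_0+2\pi$, it is $K\,b_-^{XY}$ if they can be chosen with $x_0\le y_1<x_1\le y_0+2\pi<x_0+2\pi$, and $0$ otherwise; $b_{\varepsilon'}^{YZ}b_{\varepsilon}^{XY}=b_{\varepsilon\varepsilon'}^{XZ}$ if the latter exists, and $0$ otherwise. $\mathcal C_\pi$ is the category of formal finite direct sums of these objects, with matrices as morphisms; matrix entries are recorded as scalars in $K$ with respect to the basic morphisms $b_\varepsilon$. The shift is $\Sigma(x_0,x_1)=(x_1,x_0+2\pi)$. **Triangles.** A representation of $S^1$ over $R$ consists of $R$-modules $V[x]$ ($[x]\in S^1$) and functorial maps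 $V[x]\to V[x-\alpha]$ ($\alpha\ge 0$) such that rotation by $2\pi n$ is multiplication by $t^n$; $P_{[x]}$ is the projective representation freely generated by an element $e_x$ at $x$, and $e_x^\alpha$ is the image of $e_x$ at $x-\alpha$. $\mathcal F_\pi$ is the Frobenius category of pairs $(V,d)$, where $V$ is a finitely generated projective representation and $d$ is an endomorphism of $V$ with $d^2=t$, with the sequences that are exact as sequences of representations as exact sequences. For $x\le y\le x+2\pi$, $E(x,y)=P_{[x]}\oplus P_{[y]}$ with $d(e_x)=e_y^{y-x}$, $d(e_y)=e_x^{x+2\pi-y}$. The stable category of $\mathcal F_\pi$ is identified with $\mathcal C_\pi$ by $(x,y)\leftrightarrow E(x,y)$, where $b_+$ corresponds to the basic diagonal map ($e_{x_0}\mapsto e_{y_0}^{y_0-x_0}$, $e_{x_1}\mapsto e_{y_1}^{y_1-x_1}$) and $b_-$ to the basic counter-diagonal map ($e_{x_0}\mapsto e_{y_1}^{y_1-x_0}$, $e_{x_1}\mapsto e_{y_0}^{y_0+2\pi-x_1}$). For $E(x,y)$ one chooses the exact sequence $$E(x,y)\xrightarrow{\binom{1}{-1}}E(y,y)\oplus E(x,x+2\pi)\xrightarrow{(1,1)}E(y,x+2\pi)=\Sigma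 E(x,y)$$ of multiples of basic diagonal maps, and for direct sums the direct sum of these sequences. The distinguished triangles $X\to Y\to Z\to\Sigma X$ starting with $\underline f:X\to Y$ are those obtained, up to isomorphism of the third object in the stable category, by lifting $\underline f$ to $\mathcal F_\pi$ and taking the pushout $Y\to C\to\Sigma X$ of the chosen sequence of $X$ along the lift. **Statement.** Let $a<b<c<x<y<z<a+2\pi$ be real numbers, $X=(a,x)$ and $Y=Y_1\oplus Y_2=(b,z)\oplus(c,y)$, and let $\underline f=(f_1,f_2):X\to Y$ be a morphism in $\mathcal C_\pi$ both of whose components are nonzero. 1. For every object $Z$ of $\mathcal C_\pi$, there are morphisms $\underline g:Y\to Z$, $\underline h:Z\to\Sigma X$ such that $X\xrightarrow{\underline f}Y\xrightarrow{\underline g}Z\xrightarrow{\underline h}\Sigma X$ is a distinguished triangle if and only if $Z\cong(b,a+2\pi)\oplus(c,z)\oplus(x,y)$. 2. Let $Z=Z_1\oplus Z_2\oplus Z_3=(b,a+2\pi)\oplus(c,z)\oplus(x,y)$, and let $\underline g=(g_{ji}):Y\to Z$ and $\underline h=(h_j):Z\to\Sigma X$ be morphisms, where $g_{ji}$ is the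 scalar of the component $Y_i\to Z_j$ and $h_j$ that of $Z_j\to\Sigma X$. Then $X\xrightarrow{\underline f}Y\xrightarrow{\underline g}Z\xrightarrow{\underline h}\Sigma X$ is a distinguished triangle if and only if $$h_1g_{11}f_1=-1,\quad h_2g_{21}f_1=1,\quad h_2g_{22}f_2=-1,\quad h_3g_{32}f_2=1,\quad g_{12}=0,\quad g_{31}=0.$$ -/

import Mathlib

open CategoryTheory CategoryTheory.Limits

universe u

noncomputable section

/-- The circle `S¹ = ℝ / 2πℤ`. -/
abbrev Circ : Type := AddCircle (2 * Real.pi)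

instance fact_two_pi_pos : Fact ((0 : ℝ) < 2 * Real.pi) := ⟨Real.two_pi_pos⟩

/-- Two real numbers have the same class in `S¹` iff they differ by a multiple of `2π`. -/
theorem Circ.coe_eq_coe {x y : ℝ} (h : (x : Circ) = (y : Circ)) :
    ∃ n : ℤ, x = y + n * (2 * Real.pi) := by
  obtain ⟨n, hn⟩ := (AddCircle.coe_eq_zero_iff (2 * Real.pi)).1
    (show ((x - y : ℝ) : Circ) = 0 by rw [AddCircle.coe_sub, h, sub_self])
  exact ⟨n, by rw [zsmul_eq_mul] at hn; linarith⟩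

theorem Circ.coe_add_int (x : ℝ) (n : ℤ) : ((x + n * (2 * Real.pi) : ℝ) : Circ) = x := by
  rw [AddCircle.coe_add, ← zsmul_eq_mul, AddCircle.coe_zsmul, AddCircle.coe_period, smul_zero,
    add_zero]

theorem Circ.coe_add_two_pi (x : ℝ) : ((x + 2 * Real.pi : ℝ) : Circ) = x := by
  simp

theorem Circ.eq_of_close {x y : ℝ} (h : (x : Circ) = (y : Circ)) (h1 : x < y + 2 * Real.pi)
    (h2 : y < x + 2 * Real.pi) : x = y := by
  obtain ⟨n, hn⟩ := Circ.coe_eq_coe h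
  have hp := Real.two_pi_pos
  have h3 : (n : ℝ) < 1 := by
    by_contra hc
    nlinarith [mul_le_mul_of_nonneg_right (not_lt.1 hc) hp.le]
  have h4 : (-1 : ℝ) < n := by
    by_contra hc
    nlinarith [mul_le_mul_of_nonneg_right (not_lt.1 hc) hp.le]
  have h5 : n < 1 := by exact_mod_cast h3
  have h6 : -1 < n := by exact_mod_cast h4
  have : n = 0 := by omega
  subst this
  simpa using hn

/-! ### The continuous cluster category `C_π` -/

/-- The indecomposable objects `(x, y)` of `C_π` (over `K`): ordered pairs of distinct points
of the circle. -/
structure IndC (K : Type*) where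
  fst : Circ
  snd : Circ
  ne : fst ≠ snd

namespace IndC

section
variable {K : Type*}

/-- The object `(x, y)` given by real numbers `x < y < x + 2π`. -/
def mk' (x y : ℝ) (h : x < y) (h' : y < x + 2 * Real.pi) : IndC K where
  fst := x
  snd := y
  ne e := h.ne (Circ.eq_of_close e (by linarith [Real.two_pi_pos]) h')

/-- `Σ (x, y) = (y, x)`. -/
def swap (X : IndC K) : IndC K := ⟨X.snd, X.fst, X.ne.symm⟩

@[simp] theorem swap_swap (X : IndC K) : X.swap.swap = X := rfl

/-- The coordinates of `X = (x₀, x₁)` and `Y = (y₀, y₁)` can be chosen such that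
`x₀ ≤ y₀ < x₁ ≤ y₁ < x₀ + 2π`. -/
def Linked (X Y : IndC K) : Prop :=
  ∃ x₀ x₁ y₀ y₁ : ℝ, (x₀ : Circ) = X.fst ∧ (x₁ : Circ) = X.snd ∧ (y₀ : Circ) = Y.fst ∧
    (y₁ : Circ) = Y.snd ∧ x₀ ≤ y₀ ∧ y₀ < x₁ ∧ x₁ ≤ y₁ ∧ y₁ < x₀ + 2 * Real.pi

/-- The coordinates of `X = (x₀, x₁)` and `Y = (y₀, y₁)` can be chosen such that
`x₀ ≤ y₁ < x₁ ≤ y₀ + 2π < x₀ + 2π`. -/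
def CounterLinked (X Y : IndC K) : Prop :=
  ∃ x₀ x₁ y₀ y₁ : ℝ, (x₀ : Circ) = X.fst ∧ (x₁ : Circ) = X.snd ∧ (y₀ : Circ) = Y.fst ∧
    (y₁ : Circ) = Y.snd ∧ x₀ ≤ y₁ ∧ y₁ < x₁ ∧ x₁ ≤ y₀ + 2 * Real.pi ∧
    y₀ + 2 * Real.pi < x₀ + 2 * Real.pi

theorem counterLinked_iff {X Y : IndC K} : CounterLinked X Y ↔ Linked X Y.swap := by
  constructor
  · rintro ⟨x₀, x₁, y₀, y₁, a, b, c, d, h⟩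
    exact ⟨x₀, x₁, y₁, y₀ + 2 * Real.pi, a, b, d, (Circ.coe_add_two_pi _).trans c, h⟩
  · rintro ⟨x₀, x₁, y₁, y₀, a, b, c, d, h1, h2, h3, h4⟩
    refine ⟨x₀, x₁, y₀ - 2 * Real.pi, y₁, a, b, ?_, c, h1, h2, by linarith, by linarith⟩
    rw [← Circ.coe_add_two_pi, sub_add_cancel]; exact d

theorem Linked.refl (X : IndC K) : Linked X X := by
  obtain ⟨x, hx⟩ : ∃ x : ℝ, (x : Circ) = X.fst := ⟨_, AddCircle.coe_equivIco (a := 0)⟩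
  have hy := AddCircle.coe_equivIco (p := 2 * Real.pi) (a := x) (y := X.snd)
  obtain ⟨h1, h2⟩ := (AddCircle.equivIco (2 * Real.pi) x X.snd).2
  set y : ℝ := (AddCircle.equivIco (2 * Real.pi) x X.snd : ℝ)
  have : x < y := lt_of_le_of_ne h1 fun e => X.ne (by rw [← hx, ← hy, e])
  exact ⟨x, y, x, y, hx, hy, hx, hy, le_rfl, this, le_rfl, h2⟩

theorem Linked.swap {X Y : IndC K} (h : Linked X Y) : Linked X.swap Y.swap := by
  obtain ⟨x₀, x₁, y₀, y₁, a, b, c, d, h1, h2, h3, h4⟩ := h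
  exact ⟨x₁, x₀ + 2 * Real.pi, y₁, y₀ + 2 * Real.pi, b, (Circ.coe_add_two_pi _).trans a, d,
    (Circ.coe_add_two_pi _).trans c, h3, h4, by linarith, by linarith⟩

theorem linked_swap_iff {X Y : IndC K} : Linked X.swap Y.swap ↔ Linked X Y :=
  ⟨fun h => by simpa using h.swap, Linked.swap⟩

/-- Once lifts of `X` are fixed, lifts of `Y` can be adapted to them. -/
theorem Linked.exists_lift {X Y : IndC K} (h : Linked X Y) {x₀ x₁ : ℝ}
    (h₀ : (x₀ : Circ) = X.fst) (h₁ : (x₁ : Circ) = X.snd) (hl : x₀ < x₁)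
    (hl' : x₁ < x₀ + 2 * Real.pi) : ∃ y₀ y₁ : ℝ, (y₀ : Circ) = Y.fst ∧ (y₁ : Circ) = Y.snd ∧
      x₀ ≤ y₀ ∧ y₀ < x₁ ∧ x₁ ≤ y₁ ∧ y₁ < x₀ + 2 * Real.pi := by
  obtain ⟨u₀, u₁, v₀, v₁, a, b, c, d, h1, h2, h3, h4⟩ := h
  obtain ⟨n, hn⟩ := Circ.coe_eq_coe (h₀.trans a.symm)
  have e : u₁ + n * (2 * Real.pi) = x₁ :=
    Circ.eq_of_close ((Circ.coe_add_int _ _).trans (b.trans h₁.symm)) (by linarith) (by linarith)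
  exact ⟨v₀ + n * (2 * Real.pi), v₁ + n * (2 * Real.pi), (Circ.coe_add_int _ _).trans c,
    (Circ.coe_add_int _ _).trans d, by linarith, by linarith, by linarith, by linarith⟩

theorem not_linked_and_counter {X Y : IndC K} (h : Linked X Y) (h' : Linked X Y.swap) : False := by
  obtain ⟨x₀, x₁, y₀, y₁, a, b, c, d, h1, h2, h3, h4⟩ := h
  obtain ⟨v₀, v₁, c', d', k1, k2, k3, k4⟩ :=
    h'.exists_lift a b (by linarith) (by linarith)
  have : y₀ = v₁ := Circ.eq_of_close (c.trans d'.symm) (by linarith) (by linarith)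
  linarith

/-- Along adapted lifts, being linked is decided by inequalities. -/
theorem linked_iff_of_lift {X Z : IndC K} {x₀ x₁ z₀ z₁ : ℝ}
    (a : (x₀ : Circ) = X.fst) (b : (x₁ : Circ) = X.snd)
    (c : (z₀ : Circ) = Z.fst) (d : (z₁ : Circ) = Z.snd) (hl : x₀ < x₁)
    (hl' : x₁ < x₀ + 2 * Real.pi) (h1 : x₀ ≤ z₀) (h2 : z₀ < x₀ + 2 * Real.pi) (h3 : x₁ ≤ z₁)
    (h4 : z₁ < x₁ + 2 * Real.pi) : Linked X Z ↔ z₀ < x₁ ∧ z₁ < x₀ + 2 * Real.pi := by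
  constructor
  · intro h
    obtain ⟨v₀, v₁, c', d', k1, k2, k3, k4⟩ := h.exists_lift a b hl hl'
    have e : z₀ = v₀ := Circ.eq_of_close (c.trans c'.symm) (by linarith) (by linarith)
    have e' : z₁ = v₁ := Circ.eq_of_close (d.trans d'.symm) (by linarith) (by linarith)
    exact ⟨by linarith, by linarith⟩
  · rintro ⟨k1, k2⟩
    exact ⟨x₀, x₁, z₀, z₁, a, b, c, d, h1, k1, h3, k2⟩

theorem linked_assoc {X Y Z W : IndC K} (h1 : Linked X Y) (h2 : Linked Y Z) (h3 : Linked Z W)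
    (h4 : Linked X W) : Linked X Z ↔ Linked Y W := by
  obtain ⟨x₀, x₁, y₀, y₁, a, b, c, d, k1, k2, k3, k4⟩ := h1
  obtain ⟨z₀, z₁, e, f, l1, l2, l3, l4⟩ := h2.exists_lift c d (by linarith) (by linarith)
  obtain ⟨w₀, w₁, g, i, m1, m2, m3, m4⟩ := h3.exists_lift e f (by linarith) (by linarith)
  rw [linked_iff_of_lift a b e f (by linarith) (by linarith) (by linarith) (by linarith)
    (by linarith) (by linarith), linked_iff_of_lift c d g i (by linarith) (by linarith)
    (by linarith) (by linarith) (by linarith) (by linarith)]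
  constructor
  · rintro ⟨n1, n2⟩
    rw [linked_iff_of_lift a b g i (by linarith) (by linarith) (by linarith) (by linarith)
      (by linarith) (by linarith)] at h4
    exact ⟨by linarith, by linarith⟩
  · rintro ⟨n1, n2⟩
    rw [linked_iff_of_lift a b g i (by linarith) (by linarith) (by linarith) (by linarith)
      (by linarith) (by linarith)] at h4
    exact ⟨by linarith, by linarith⟩

open Classical in
/-- The sign `ε` of the basic morphism `b_ε^{XY}`, and `0` if `C_π(X, Y) = 0`. -/
def sgn (X Y : IndC K) : SignType :=
  if Linked X Y then 1 else if CounterLinked X Y then -1 else 0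

/-- Reversing the orientation of an object when the sign is negative. -/
def orient (s : SignType) (X : IndC K) : IndC K := if s = -1 then X.swap else X

theorem sgn_eq_iff {s : SignType} (hs : s ≠ 0) {X Y : IndC K} :
    sgn X Y = s ↔ Linked X (Y.orient s) := by
  have hx := @not_linked_and_counter K X Y
  unfold sgn
  rw [counterLinked_iff]
  rcases s with _ | _ | _
  · exact absurd rfl hs
  · by_cases h : Linked X Y <;> by_cases h' : Linked X Y.swap <;> simp_all [orient]
  · by_cases h : Linked X Y <;> by_cases h' : Linked X Y.swap <;> simp_all [orient]

theorem linked_orient_iff {s s' : SignType} (hs : s ≠ 0) (hs' : s' ≠ 0) {X Y : IndC K} :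
    Linked (X.orient s) (Y.orient (s * s')) ↔ Linked X (Y.orient s') := by
  rcases s with _ | _ | _
  · exact absurd rfl hs
  · rcases s' with _ | _ | _
    · exact absurd rfl hs'
    · exact linked_swap_iff (X := X) (Y := Y.swap)
    · simpa [orient] using linked_swap_iff (X := X) (Y := Y)
  · simp [orient]

theorem sgn_self (X : IndC K) : sgn X X = 1 := by
  simp [sgn, Linked.refl]

/-- The combinatorial content of associativity of the composition. -/
theorem sgn_assoc {X Y Z W : IndC K} (h1 : sgn X Y ≠ 0) (h2 : sgn Y Z ≠ 0) (h3 : sgn Z W ≠ 0)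
    (h4 : sgn X Y * sgn Y Z * sgn Z W = sgn X W) :
    sgn X Y * sgn Y Z = sgn X Z ↔ sgn Y Z * sgn Z W = sgn Y W := by
  have a := (sgn_eq_iff h1).1 rfl
  have b := (sgn_eq_iff h2).1 rfl
  have c := (sgn_eq_iff h3).1 rfl
  have h12 : sgn X Y * sgn Y Z ≠ 0 := mul_ne_zero h1 h2
  have h23 : sgn Y Z * sgn Z W ≠ 0 := mul_ne_zero h2 h3
  have h123 : sgn X Y * sgn Y Z * sgn Z W ≠ 0 := mul_ne_zero h12 h3
  have d := (sgn_eq_iff h123).1 h4.symm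
  rw [eq_comm, sgn_eq_iff h12, eq_comm, sgn_eq_iff h23, ← linked_orient_iff h1 h23, ← mul_assoc]
  exact linked_assoc a ((linked_orient_iff h1 h2).2 b) ((linked_orient_iff h12 h3).2 c) d

end

variable {K : Type*} [Field K]

/-- Morphisms `X ⟶ Y` between indecomposables: multiples `r b_ε^{XY}` of the basic morphism,
recorded by the scalar `r`, which has to vanish if there is no basic morphism. -/
@[ext]
structure Hom (X Y : IndC K) where
  coeff : K
  zero : sgn X Y = 0 → coeff = 0

/-- `r b_ε^{XY}` followed by `s b_{ε'}^{YZ}` is `r s b_{εε'}^{XZ}` if this exists, and `0`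
otherwise. -/
def comp {X Y Z : IndC K} (f : Hom X Y) (g : Hom Y Z) : Hom X Z where
  coeff := if sgn X Y * sgn Y Z = sgn X Z then f.coeff * g.coeff else 0
  zero h := by
    split_ifs with h'
    · rw [h, mul_eq_zero] at h'
      rcases h' with h' | h'
      · rw [f.zero h', zero_mul]
      · rw [g.zero h', mul_zero]
    · rfl

instance : Category (IndC K) where
  Hom := Hom
  id X := ⟨1, fun h => by simp [sgn_self] at h⟩
  comp := comp
  id_comp f := Hom.ext (by simp [comp, sgn_self])
  comp_id f := Hom.ext (by simp [comp, sgn_self])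
  assoc {X Y Z W} f g h := Hom.ext <| by
    simp only [comp]
    by_cases h1 : sgn X Y = 0
    · simp [f.zero h1]
    by_cases h2 : sgn Y Z = 0
    · simp [g.zero h2]
    by_cases h3 : sgn Z W = 0
    · simp [h.zero h3]
    by_cases h4 : sgn X Y * sgn Y Z * sgn Z W = sgn X W
    · have key := sgn_assoc h1 h2 h3 h4
      by_cases h5 : sgn X Y * sgn Y Z = sgn X Z
      · have h6 := key.1 h5
        rw [if_pos h5, if_pos h6, ← h5, ← h6, if_pos h4, if_pos (by rw [← mul_assoc, h4]),
          mul_assoc]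
      · have h6 := fun e => h5 (key.2 e)
        rw [if_neg h5, if_neg h6]
        simp
    · have e1 : (if sgn X Z * sgn Z W = sgn X W then
          (if sgn X Y * sgn Y Z = sgn X Z then f.coeff * g.coeff else 0) * h.coeff else 0) = 0 := by
        split_ifs with k1 k2
        · exact absurd (k2 ▸ k1) h4
        all_goals simp
      have e2 : (if sgn X Y * sgn Y W = sgn X W then
          f.coeff * (if sgn Y Z * sgn Z W = sgn Y W then g.coeff * h.coeff else 0) else 0) = 0 := by
        split_ifs with k1 k2
        · rw [← k2, ← mul_assoc] at k1
          exact absurd k1 h4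
        all_goals simp
      rw [e1, e2]

theorem hom_ext {X Y : IndC K} {f g : X ⟶ Y} (h : f.coeff = g.coeff) : f = g := Hom.ext h

instance (X Y : IndC K) : Zero (X ⟶ Y) := ⟨⟨0, fun _ => rfl⟩⟩
instance (X Y : IndC K) : Add (X ⟶ Y) :=
  ⟨fun f g => ⟨f.coeff + g.coeff, fun h => by rw [f.zero h, g.zero h, add_zero]⟩⟩
instance (X Y : IndC K) : Neg (X ⟶ Y) := ⟨fun f => ⟨-f.coeff, fun h => by rw [f.zero h, neg_zero]⟩⟩
instance (X Y : IndC K) : Sub (X ⟶ Y) :=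
  ⟨fun f g => ⟨f.coeff - g.coeff, fun h => by rw [f.zero h, g.zero h, sub_zero]⟩⟩
instance (X Y : IndC K) : SMul ℕ (X ⟶ Y) :=
  ⟨fun n f => ⟨n • f.coeff, fun h => by rw [f.zero h, smul_zero]⟩⟩
instance (X Y : IndC K) : SMul ℤ (X ⟶ Y) :=
  ⟨fun n f => ⟨n • f.coeff, fun h => by rw [f.zero h, smul_zero]⟩⟩

instance (X Y : IndC K) : AddCommGroup (X ⟶ Y) :=
  Function.Injective.addCommGroup (fun f : X ⟶ Y => f.coeff) (fun _ _ h => hom_ext h) rfl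
    (fun _ _ => rfl) (fun _ => rfl) (fun _ _ => rfl) (fun _ _ => rfl) (fun _ _ => rfl)

instance : Preadditive (IndC K) where
  add_comp X Y Z f f' g := hom_ext <| by
    change (if _ then _ else _) = (if _ then _ else _) + (if _ then _ else _)
    split_ifs
    · exact add_mul _ _ _
    · simp
  comp_add X Y Z f g g' := hom_ext <| by
    change (if _ then _ else _) = (if _ then _ else _) + (if _ then _ else _)
    split_ifs
    · exact mul_add _ _ _
    · simp

end IndC

/-- The continuous cluster category `C_π` over the field `K`: formal finite direct sums of
indecomposables, with matrices as morphisms. The entry `f i j` of a morphism goes from the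
`i`-th summand of the source to the `j`-th summand of the target. -/
abbrev CPi (K : Type*) [Field K] := Mat_ (IndC K)

namespace CPi
variable {K : Type*} [Field K]

/-- The formal direct sum of a finite list of indecomposable objects. -/
def sum {n : ℕ} (X : Fin n → IndC K) : CPi K := ⟨Fin n, X⟩

/-- The shift on objects, `Σ (x, y) = (y, x)` on each summand. -/
abbrev shift (X : CPi K) : CPi K := ⟨X.ι, fun i => (X.X i).swap⟩

end CPi

/-! ### Representations of the circle -/

/-- The circle as a category: a morphism `x ⟶ y` is a rotation by a real angle `α ≥ 0` with
`y = x - α`. -/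
structure RotCirc where
  pt : Circ

/-- A rotation from `x` to `y = x - α`. -/
@[ext]
structure RotCirc.Hom (x y : RotCirc) where
  angle : ℝ
  nonneg : 0 ≤ angle
  eq : x.pt - (angle : Circ) = y.pt

instance : Category RotCirc where
  Hom x y := RotCirc.Hom x y
  id x := ⟨0, le_rfl, by simp⟩
  comp f g := ⟨f.angle + g.angle, add_nonneg f.nonneg g.nonneg, by
    rw [AddCircle.coe_add, ← sub_sub, f.eq, g.eq]⟩
  id_comp f := RotCirc.Hom.ext (zero_add _)
  comp_id f := RotCirc.Hom.ext (add_zero _)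
  assoc f g h := RotCirc.Hom.ext (add_assoc _ _ _)

@[simp] theorem RotCirc.comp_angle {x y z : RotCirc} (f : x ⟶ y) (g : y ⟶ z) :
    (f ≫ g).angle = f.angle + g.angle := rfl

@[simp] theorem RotCirc.id_angle (x : RotCirc) : (𝟙 x : x ⟶ x).angle = 0 := rfl

theorem RotCirc.hom_ext {x y : RotCirc} {f g : x ⟶ y} (h : f.angle = g.angle) : f = g :=
  RotCirc.Hom.ext h

theorem RotCirc.coe_angle {x y : RotCirc} (f : x ⟶ y) : (f.angle : Circ) = x.pt - y.pt := by
  rw [← f.eq]; abel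

/-- The full rotation by `2πn` at `x`. -/
def RotCirc.loop (x : RotCirc) (n : ℕ) : x ⟶ x where
  angle := n * (2 * Real.pi)
  nonneg := by positivity
  eq := by
    have := Circ.coe_add_int 0 n
    simp only [zero_add, Int.cast_natCast] at this
    rw [this]; simp

/-- The unique real number `α` in `[0, 2π)` with `z = x - α`. -/
def dep (x z : Circ) : ℝ := (AddCircle.equivIco (2 * Real.pi) 0 (x - z) : ℝ)

theorem dep_nonneg (x z : Circ) : 0 ≤ dep x z := (AddCircle.equivIco (2 * Real.pi) 0 (x - z)).2.1

theorem dep_lt (x z : Circ) : dep x z < 2 * Real.pi := by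
  have := (AddCircle.equivIco (2 * Real.pi) 0 (x - z)).2.2
  exact this.trans_eq (zero_add _)

theorem coe_dep (x z : Circ) : (dep x z : Circ) = x - z := AddCircle.coe_equivIco

theorem dep_eq {x z : Circ} {c : ℝ} (hc : 0 ≤ c) (hc' : c < 2 * Real.pi)
    (h : (c : Circ) = x - z) : dep x z = c :=
  Circ.eq_of_close ((coe_dep x z).trans h.symm) (by linarith [dep_lt x z])
    (by linarith [dep_nonneg x z])

@[simp] theorem dep_self (x : Circ) : dep x x = 0 := dep_eq le_rfl Real.two_pi_pos (by simp)

/-- The shortest rotation from `x` to `z`. -/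
def RotCirc.short (x z : RotCirc) : x ⟶ z where
  angle := dep x.pt z.pt
  nonneg := dep_nonneg _ _
  eq := by rw [coe_dep]; abel

/-- The number of full turns in an angle `c ≥ 0`. -/
def turns (c : ℝ) : ℕ := ⌊c / (2 * Real.pi)⌋₊

theorem eq_dep_add_turns {x z : Circ} {c : ℝ} (hc : 0 ≤ c) (h : (c : Circ) = x - z) :
    c = dep x z + turns c * (2 * Real.pi) := by
  have hp := Real.two_pi_pos
  have h1 : (turns c : ℝ) ≤ c / (2 * Real.pi) := Nat.floor_le (by positivity)
  have h2 : c / (2 * Real.pi) < turns c + 1 := Nat.lt_floor_add_one _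
  rw [le_div_iff₀ hp] at h1
  rw [div_lt_iff₀ hp] at h2
  have := Circ.eq_of_close (x := c) (y := dep x z + turns c * (2 * Real.pi)) ?_
    (by have := dep_nonneg x z; linarith) (by have := dep_lt x z; linarith)
  · exact this
  · have e := Circ.coe_add_int (dep x z) (turns c)
    simp only [Int.cast_natCast] at e
    rw [e, coe_dep, h]

theorem turns_unique {x z : Circ} {c : ℝ} (hc : 0 ≤ c) (h : (c : Circ) = x - z) {n : ℕ}
    (hn : c = dep x z + n * (2 * Real.pi)) : turns c = n := by
  have := eq_dep_add_turns hc h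
  have hp := Real.two_pi_pos
  have : (turns c : ℝ) * (2 * Real.pi) = n * (2 * Real.pi) := by linarith
  exact_mod_cast mul_right_cancel₀ hp.ne' this

theorem dep_add_angle (x : Circ) {z z' : RotCirc} (β : z ⟶ z') :
    dep x z.pt + β.angle = dep x z'.pt + turns (dep x z.pt + β.angle) * (2 * Real.pi) :=
  eq_dep_add_turns (add_nonneg (dep_nonneg _ _) β.nonneg) (by
    rw [AddCircle.coe_add, coe_dep, RotCirc.coe_angle]; abel)

theorem turns_dep_add_angle (x : Circ) {z z' : RotCirc} (β : z ⟶ z') {n : ℕ}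
    (h : dep x z.pt + β.angle = dep x z'.pt + n * (2 * Real.pi)) :
    turns (dep x z.pt + β.angle) = n :=
  turns_unique (add_nonneg (dep_nonneg _ _) β.nonneg) (by
    rw [AddCircle.coe_add, coe_dep, RotCirc.coe_angle]; abel) h

section Rep

variable {R : Type u} [CommRing R] (t : R)

/-- A functor `V` from the circle to `R`-modules is a representation of `S¹` over `R` if the
rotation by `2πn` acts as multiplication by `tⁿ`. -/
def IsCircRep (V : RotCirc ⥤ ModuleCat.{u} R) : Prop :=
  ∀ (x : RotCirc) (n : ℕ), V.map (x.loop n) = t ^ n • 𝟙 (V.obj x)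

/-- A morphism of representations that is surjective at every point of the circle. -/
def IsPointwiseSurj {V W : RotCirc ⥤ ModuleCat.{u} R} (f : V ⟶ W) : Prop :=
  ∀ x, Function.Surjective (f.app x)

/-- Projectivity in the category of representations of `S¹` over `R`. -/
def IsRepProjective (P : RotCirc ⥤ ModuleCat.{u} R) : Prop :=
  ∀ ⦃V W : RotCirc ⥤ ModuleCat.{u} R⦄, IsCircRep t V → IsCircRep t W →
    ∀ (p : V ⟶ W), IsPointwiseSurj p → ∀ f : P ⟶ W, ∃ g : P ⟶ V, g ≫ p = f

/-- The representation `P_[x]`. The module at `x - α`, `0 ≤ α < 2π`, is free on the generator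
`e_x^α`, and the rotation by `β` sends `e_x^α` to `e_x^(α+β)`, where `e_x^(γ+2πn) = tⁿ e_x^γ`. -/
def projRep (x : Circ) : RotCirc ⥤ ModuleCat.{u} R where
  obj _ := ModuleCat.of R R
  map {z _} β := ModuleCat.ofHom (t ^ turns (dep x z.pt + β.angle) • LinearMap.id)
  map_id z := by
    rw [turns_dep_add_angle x (𝟙 z) (n := 0) (by simp)]; ext; simp
  map_comp {z z' z''} β β' := by
    have h1 := dep_add_angle x β
    have h2 := dep_add_angle x β'
    rw [turns_dep_add_angle x (β ≫ β')
      (n := turns (dep x z.pt + β.angle) + turns (dep x z'.pt + β'.angle))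
      (by push_cast; simp only [RotCirc.comp_angle]; linarith), pow_add]
    ext
    simp [mul_comm]

theorem isCircRep_projRep (x : Circ) : IsCircRep t (projRep t x) := by
  intro z n
  change ModuleCat.ofHom (t ^ turns (dep x z.pt + (z.loop n).angle) • LinearMap.id) = _
  rw [turns_dep_add_angle x (z.loop n) (n := n) rfl]
  rfl

/-- `V` is a quotient of a finite direct sum of representations `P_[x_i]`, that is, there is a
finite jointly surjective family of morphisms `P_[x_i] ⟶ V`. -/
def IsRepFG (V : RotCirc ⥤ ModuleCat.{u} R) : Prop :=
  ∃ (ι : Type) (_ : Fintype ι) (x : ι → Circ) (φ : ∀ i, projRep t (x i) ⟶ V),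
    ∀ (z : RotCirc) (v : V.obj z), ∃ r : ∀ i, (projRep t (x i)).obj z, ∑ i, (φ i).app z (r i) = v

/-- The finitely generated projective representations of `S¹` over `R`. -/
def IsFGProjRep : ObjectProperty (RotCirc ⥤ ModuleCat.{u} R) :=
  fun V => IsCircRep t V ∧ IsRepFG t V ∧ IsRepProjective t V

/-- The morphism `P_[x] ⟶ V` sending `e_x` to `v`. -/
def projRepHom {V : RotCirc ⥤ ModuleCat.{u} R} (hV : IsCircRep t V) (x : RotCirc) (v : V.obj x) :
    projRep t x.pt ⟶ V where
  app z := ModuleCat.ofHom (LinearMap.toSpanSingleton R (V.obj z) (V.map (x.short z) v))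
  naturality z z' β := by
    have h2 : x.short z ≫ β = x.short z' ≫ z'.loop (turns (dep x.pt z.pt + β.angle)) :=
      RotCirc.hom_ext (dep_add_angle x.pt β)
    have h3 := congrArg (fun k => V.map k v) h2
    simp only [Functor.map_comp, hV z'] at h3
    ext
    simp [projRep] at h3 ⊢
    exact h3.symm

theorem isFGProjRep_projRep (x : Circ) : IsFGProjRep t (projRep t x) := by
  refine ⟨isCircRep_projRep t x, ⟨Unit, inferInstance, fun _ => x, fun _ => 𝟙 _, fun z v =>
    ⟨fun _ => v, by simp⟩⟩, ?_⟩
  intro V W hV hW p hp f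
  let e : (projRep t x).obj ⟨x⟩ := (1 : R)
  obtain ⟨v, hv⟩ := hp ⟨x⟩ (f.app ⟨x⟩ e)
  refine ⟨projRepHom t hV ⟨x⟩ v, ?_⟩
  ext z
  have key : (projRep t x).map (RotCirc.short ⟨x⟩ z) e = (1 : R) := by
    change t ^ turns (dep x x + (RotCirc.short ⟨x⟩ z).angle) • (1 : R) = 1
    rw [turns_dep_add_angle x (z := ⟨x⟩) (RotCirc.short ⟨x⟩ z) (n := 0)
      (by simp [RotCirc.short])]
    simp
  have n1 := NatTrans.naturality_apply p (RotCirc.short ⟨x⟩ z) v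
  have n2 := NatTrans.naturality_apply f (RotCirc.short ⟨x⟩ z) e
  rw [key] at n2
  rw [hv, ← n2] at n1
  change p.app z ((1 : R) • V.map (RotCirc.short ⟨x⟩ z) v) = f.app z (1 : R)
  rw [one_smul]
  exact n1

/-- The morphism `P_[x] ⟶ P_[y]` sending `e_x` to `e_y^α`, where `α ≥ 0` and `y = x + α`. -/
def starRep {x y : Circ} (α : ℝ) (h : 0 ≤ α) (hxy : x + (α : Circ) = y) :
    projRep t x ⟶ projRep t y where
  app z := ModuleCat.ofHom (t ^ turns (dep x z.pt + α) • LinearMap.id)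
  naturality z z' β := by
    have a (w : RotCirc) : dep x w.pt + α = dep y w.pt + turns (dep x w.pt + α) * (2 * Real.pi) :=
      eq_dep_add_turns (add_nonneg (dep_nonneg _ _) h)
        (by rw [AddCircle.coe_add, coe_dep, ← hxy]; abel)
    have h1 := dep_add_angle x β
    have h2 := dep_add_angle y β
    have h3 := a z
    have h4 := a z'
    have e : ((turns (dep x z.pt + β.angle) + turns (dep x z'.pt + α) : ℕ) : ℝ) *
        (2 * Real.pi) = ((turns (dep x z.pt + α) + turns (dep y z.pt + β.angle) : ℕ) : ℝ) *
        (2 * Real.pi) := by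
      push_cast; linarith
    have e' : turns (dep x z.pt + β.angle) + turns (dep x z'.pt + α) =
        turns (dep x z.pt + α) + turns (dep y z.pt + β.angle) := by
      exact_mod_cast mul_right_cancel₀ Real.two_pi_pos.ne' e
    ext
    change t ^ turns (dep x z'.pt + α) * (t ^ turns (dep x z.pt + β.angle) * 1) =
      t ^ turns (dep y z.pt + β.angle) * (t ^ turns (dep x z.pt + α) * 1)
    rw [mul_one, mul_one, ← pow_add, ← pow_add, add_comm, e', add_comm]

/-- The category `P_{S¹}` of finitely generated projective representations of `S¹` over `R`. -/
abbrev PS1 := (IsFGProjRep t).FullSubcategory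

/-- `P_[x]` as an object of `P_{S¹}`. -/
def PS1.P (x : Circ) : PS1 t := ⟨projRep t x, isFGProjRep_projRep t x⟩

/-- The morphism `P_[x] ⟶ P_[y]` sending `e_x` to `e_y^α`, where `α ≥ 0` and `y = x + α`. -/
def PS1.star {x y : Circ} (α : ℝ) (h : 0 ≤ α) (hxy : x + (α : Circ) = y) :
    PS1.P t x ⟶ PS1.P t y :=
  ObjectProperty.homMk (starRep t α h hxy)

theorem starRep_comp {x y z : Circ} {α β : ℝ} (hα : 0 ≤ α) (hβ : 0 ≤ β)
    (hxy : x + (α : Circ) = y) (hyz : y + (β : Circ) = z) (hxz : x + ((α + β : ℝ) : Circ) = z) :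
    starRep t α hα hxy ≫ starRep t β hβ hyz = starRep t (α + β) (add_nonneg hα hβ) hxz := by
  ext w
  have h1 := eq_dep_add_turns (x := y) (z := w.pt) (c := dep x w.pt + α)
    (add_nonneg (dep_nonneg _ _) hα) (by rw [AddCircle.coe_add, coe_dep, ← hxy]; abel)
  have h2 := eq_dep_add_turns (x := z) (z := w.pt) (c := dep y w.pt + β)
    (add_nonneg (dep_nonneg _ _) hβ) (by rw [AddCircle.coe_add, coe_dep, ← hyz]; abel)
  have h3 : turns (dep x w.pt + (α + β)) = turns (dep x w.pt + α) + turns (dep y w.pt + β) :=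
    turns_unique (x := z) (z := w.pt) (add_nonneg (dep_nonneg _ _) (add_nonneg hα hβ))
      (by rw [AddCircle.coe_add, coe_dep, ← hxz]; abel) (by push_cast; linarith)
  change t ^ turns (dep y w.pt + β) * (t ^ turns (dep x w.pt + α) * 1) =
    t ^ turns (dep x w.pt + (α + β)) * 1
  rw [h3, pow_add]; ring

theorem starRep_two_pi (x : Circ) (h : x + ((2 * Real.pi : ℝ) : Circ) = x) :
    starRep t (2 * Real.pi) Real.two_pi_pos.le h = t • 𝟙 (projRep t x) := by
  ext w
  have h3 : turns (dep x w.pt + 2 * Real.pi) = 1 :=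
    turns_unique (x := x) (z := w.pt) (add_nonneg (dep_nonneg _ _) Real.two_pi_pos.le)
      (by rw [AddCircle.coe_add, coe_dep, AddCircle.coe_period, add_zero]) (by simp)
  change t ^ turns (dep x w.pt + 2 * Real.pi) * 1 = t * 1
  rw [h3, pow_one]

theorem PS1.star_comp {x y z : Circ} {α β : ℝ} (hα : 0 ≤ α) (hβ : 0 ≤ β)
    (hxy : x + (α : Circ) = y) (hyz : y + (β : Circ) = z) (hxz : x + ((α + β : ℝ) : Circ) = z) :
    PS1.star t α hα hxy ≫ PS1.star t β hβ hyz = PS1.star t (α + β) (add_nonneg hα hβ) hxz :=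
  ObjectProperty.hom_ext _ (starRep_comp t hα hβ hxy hyz hxz)

theorem PS1.star_square {x y y' z : Circ} {α β α' β' : ℝ} (hα : 0 ≤ α) (hβ : 0 ≤ β)
    (hα' : 0 ≤ α') (hβ' : 0 ≤ β') (hxy : x + (α : Circ) = y) (hyz : y + (β : Circ) = z)
    (hxy' : x + (α' : Circ) = y') (hyz' : y' + (β' : Circ) = z) (e : α + β = α' + β') :
    PS1.star t α hα hxy ≫ PS1.star t β hβ hyz = PS1.star t α' hα' hxy' ≫ PS1.star t β' hβ' hyz' := by
  have h : x + ((α + β : ℝ) : Circ) = z := by rw [AddCircle.coe_add, ← add_assoc, hxy, hyz]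
  rw [PS1.star_comp t hα hβ hxy hyz h, PS1.star_comp t hα' hβ' hxy' hyz' (e ▸ h)]
  congr 1

theorem PS1.star_two_pi {x : Circ} {α : ℝ} (hα : 0 ≤ α) (h : x + (α : Circ) = x)
    (e : α = 2 * Real.pi) : PS1.star t α hα h = t • 𝟙 (PS1.P t x) := by
  subst e
  exact ObjectProperty.hom_ext _ (starRep_two_pi t x h)

theorem PS1.star_loop {x y : Circ} {α β : ℝ} (hα : 0 ≤ α) (hβ : 0 ≤ β) (hxy : x + (α : Circ) = y)
    (hyx : y + (β : Circ) = x) (e : α + β = 2 * Real.pi) :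
    PS1.star t α hα hxy ≫ PS1.star t β hβ hyx = t • 𝟙 (PS1.P t x) := by
  have h : x + ((α + β : ℝ) : Circ) = x := by rw [e, AddCircle.coe_period, add_zero]
  rw [PS1.star_comp t hα hβ hxy hyx h, PS1.star_two_pi t _ h e]

/-- Finite direct sums of finitely generated projective representations are such. -/
theorem isFGProjRep_of_total {J : Type} [Fintype J] {F : J → RotCirc ⥤ ModuleCat.{u} R}
    (hF : ∀ j, IsFGProjRep t (F j)) {B : RotCirc ⥤ ModuleCat.{u} R} (i : ∀ j, F j ⟶ B)
    (p : ∀ j, B ⟶ F j) (tot : ∑ j, p j ≫ i j = 𝟙 B) : IsFGProjRep t B := by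
  have tot' (z : RotCirc) (v : B.obj z) : ∑ j, (i j).app z ((p j).app z v) = v := by
    have := congrArg (fun k : B ⟶ B => k.app z v) tot
    simpa [NatTrans.app_sum] using this
  refine ⟨?_, ?_, ?_⟩
  · intro x n
    have h1 : B.map (x.loop n) = ∑ j, (p j).app x ≫ (F j).map (x.loop n) ≫ (i j).app x := by
      have := congrArg (fun k : B ⟶ B => k.app x ≫ B.map (x.loop n)) tot
      simp only [NatTrans.id_app, Category.id_comp] at this
      rw [← this, NatTrans.app_sum, Preadditive.sum_comp]
      simp
    have h2 := congrArg (fun k : B ⟶ B => k.app x) tot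
    simp only [NatTrans.app_sum, NatTrans.comp_app, NatTrans.id_app] at h2
    rw [h1, ← h2, Finset.smul_sum]
    refine Finset.sum_congr rfl fun j _ => ?_
    rw [(hF j).1 x n]
    simp
  · choose I hI x φ hφ using fun j => (hF j).2.1
    refine ⟨Σ j, I j, inferInstance, fun k => x k.1 k.2, fun k => φ k.1 k.2 ≫ i k.1,
      fun z v => ?_⟩
    choose r hr using fun j => hφ j z ((p j).app z v)
    refine ⟨fun k => r k.1 k.2, ?_⟩
    rw [Fintype.sum_sigma]
    conv_rhs => rw [← tot' z v]
    refine Finset.sum_congr rfl fun j _ => ?_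
    rw [← hr j, map_sum]
    rfl
  · intro V W hV hW q hq f
    choose g hg using fun j => (hF j).2.2 hV hW q hq (i j ≫ f)
    refine ⟨∑ j, p j ≫ g j, ?_⟩
    simp only [Preadditive.sum_comp, Category.assoc, hg]
    simp only [← Category.assoc, ← Preadditive.sum_comp]
    rw [tot, Category.id_comp]

instance : HasFiniteBiproducts (PS1 t) := by
  have : HasFiniteBiproducts (RotCirc ⥤ ModuleCat.{u} R) :=
    HasFiniteBiproducts.of_hasFiniteProducts
  refine ⟨fun n => ⟨fun F => ?_⟩⟩
  let G : Fin n → RotCirc ⥤ ModuleCat.{u} R := fun j => (F j).obj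
  let B : PS1 t := ⟨⨁ G, isFGProjRep_of_total t (fun j => (F j).property) (biproduct.ι G)
    (biproduct.π G) biproduct.total⟩
  let p (j : Fin n) : B ⟶ F j := ObjectProperty.homMk (biproduct.π G j)
  let i (j : Fin n) : F j ⟶ B := ObjectProperty.homMk (biproduct.ι G j)
  refine hasBiproduct_of_total { pt := B, π := p, ι := i, ι_π := fun j j' => ?_ } ?_
  · split_ifs with h
    · subst h
      exact ObjectProperty.hom_ext _ (biproduct.ι_π_self G j)
    · exact ObjectProperty.hom_ext _ (biproduct.ι_π_ne G h)
  · apply ObjectProperty.hom_ext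
    change (IsFGProjRep t).ι.map (∑ j, p j ≫ i j) = 𝟙 (⨁ G)
    rw [Functor.map_sum]
    exact biproduct.total

instance : HasBinaryBiproducts (PS1 t) := hasBinaryBiproducts_of_finite_biproducts _

end Rep

/-! ### The Frobenius category `F_π` -/

section Frobenius

variable {R : Type u} [CommRing R] (t : R)

/-- Objects of `F_π`: pairs `(V, d)` with `V` in `P_{S¹}` and `d` an endomorphism of `V` whose
square is multiplication by `t`. -/
structure FPi where
  V : PS1 t
  d : V ⟶ V
  sq : d ≫ d = t • 𝟙 V

namespace FPi

variable {t}

/-- Morphisms of `F_π`: morphisms in `P_{S¹}` commuting with `d`. -/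
@[ext]
structure Hom (X Y : FPi t) where
  f : X.V ⟶ Y.V
  comm : X.d ≫ f = f ≫ Y.d

instance : Category (FPi t) where
  Hom := Hom
  id X := ⟨𝟙 _, by simp⟩
  comp f g := ⟨f.f ≫ g.f, by rw [← Category.assoc, f.comm, Category.assoc, g.comm, Category.assoc]⟩
  id_comp f := Hom.ext (Category.id_comp _)
  comp_id f := Hom.ext (Category.comp_id _)
  assoc f g h := Hom.ext (Category.assoc _ _ _)

@[ext]
theorem hom_ext {X Y : FPi t} {f g : X ⟶ Y} (h : f.f = g.f) : f = g := Hom.ext h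

instance (X Y : FPi t) : Zero (X ⟶ Y) := ⟨⟨0, by simp⟩⟩
instance (X Y : FPi t) : Add (X ⟶ Y) :=
  ⟨fun f g => ⟨f.f + g.f, by rw [Preadditive.comp_add, Preadditive.add_comp, f.comm, g.comm]⟩⟩
instance (X Y : FPi t) : Neg (X ⟶ Y) :=
  ⟨fun f => ⟨-f.f, by rw [Preadditive.comp_neg, Preadditive.neg_comp, f.comm]⟩⟩
instance (X Y : FPi t) : Sub (X ⟶ Y) :=
  ⟨fun f g => ⟨f.f - g.f, by rw [Preadditive.comp_sub, Preadditive.sub_comp, f.comm, g.comm]⟩⟩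
instance (X Y : FPi t) : SMul ℕ (X ⟶ Y) :=
  ⟨fun n f => ⟨n • f.f, by rw [Preadditive.comp_nsmul, Preadditive.nsmul_comp, f.comm]⟩⟩
instance (X Y : FPi t) : SMul ℤ (X ⟶ Y) :=
  ⟨fun n f => ⟨n • f.f, by rw [Preadditive.comp_zsmul, Preadditive.zsmul_comp, f.comm]⟩⟩

instance (X Y : FPi t) : AddCommGroup (X ⟶ Y) :=
  Function.Injective.addCommGroup (fun f : X ⟶ Y => f.f) (fun _ _ h => hom_ext h) rfl
    (fun _ _ => rfl) (fun _ => rfl) (fun _ _ => rfl) (fun _ _ => rfl) (fun _ _ => rfl)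

instance : Preadditive (FPi t) where
  add_comp _ _ _ _ _ _ := hom_ext (Preadditive.add_comp _ _ _ _ _ _)
  comp_add _ _ _ _ _ _ := hom_ext (Preadditive.comp_add _ _ _ _ _ _)

/-- The functor forgetting `d`. -/
def forget : FPi t ⥤ PS1 t where
  obj X := X.V
  map f := f.f

instance : (forget (t := t)).Additive where
  map_add := rfl

instance : HasFiniteBiproducts (FPi t) := by
  refine ⟨fun n => ⟨fun F => ?_⟩⟩
  let G : Fin n → PS1 t := fun j => (F j).V
  let B : FPi t := ⟨⨁ G, biproduct.map fun j => (F j).d, by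
    ext1 j
    rw [Category.assoc, biproduct.map_π, biproduct.map_π_assoc, (F j).sq, Linear.comp_smul,
      Category.comp_id, Linear.smul_comp, Category.id_comp]⟩
  let p (j : Fin n) : B ⟶ F j := ⟨biproduct.π G j, biproduct.map_π (fun j => (F j).d) j⟩
  let i (j : Fin n) : F j ⟶ B := ⟨biproduct.ι G j, (biproduct.ι_map (fun j => (F j).d) j).symm⟩
  refine hasBiproduct_of_total { pt := B, π := p, ι := i, ι_π := fun j j' => ?_ } ?_
  · split_ifs with h
    · subst h
      exact hom_ext (biproduct.ι_π_self G j)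
    · exact hom_ext (biproduct.ι_π_ne G h)
  · apply hom_ext
    change forget.map (∑ j, p j ≫ i j) = 𝟙 (⨁ G)
    rw [Functor.map_sum]
    exact biproduct.total

/-- Exact sequences of `F_π`: sequences `A ⟶ B ⟶ C` such that `0 → A → B → C → 0` is an exact
sequence of representations of `S¹`. -/
def IsExactSeq {A B C : FPi t} (f : A ⟶ B) (g : B ⟶ C) : Prop :=
  ∀ x : RotCirc, Function.Injective (f.f.hom.app x) ∧
    Function.Exact (f.f.hom.app x) (g.f.hom.app x) ∧ Function.Surjective (g.f.hom.app x)

/-- Projective-injective objects with respect to the exact sequences of `F_π`. -/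
def IsProjInj (Q : FPi t) : Prop :=
  ∀ ⦃A B C : FPi t⦄ (f : A ⟶ B) (g : B ⟶ C), IsExactSeq f g →
    (∀ q : Q ⟶ C, ∃ q' : Q ⟶ B, q' ≫ g = q) ∧ (∀ q : A ⟶ Q, ∃ q' : B ⟶ Q, f ≫ q' = q)

variable (t) in
/-- Two morphisms of `F_π` are stably equal if their difference factors through a
projective-injective object. -/
def stableRel : HomRel (FPi t) :=
  fun X Y f g => ∃ (Q : FPi t) (_ : IsProjInj Q) (p : X ⟶ Q) (q : Q ⟶ Y), f - g = p ≫ q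

variable (t) in
/-- The stable category of `F_π`. -/
abbrev Stable := CategoryTheory.Quotient (stableRel t)

variable (t) in
/-- The projection of `F_π` to its stable category. -/
abbrev stab : FPi t ⥤ Stable t := CategoryTheory.Quotient.functor (stableRel t)

end FPi

/-- An arc on the circle: a starting point `[x]` and a length `y - x`, where `x ≤ y ≤ x + 2π`.
It is the class of the pair `(x, y)` modulo simultaneous translation by `2πn`. -/
structure Arc where
  start : Circ
  len : ℝ
  nonneg : 0 ≤ len
  le : len ≤ 2 * Real.pi

/-- The end point `[y]` of an arc. -/
def Arc.finish (A : Arc) : Circ := A.start + (A.len : Circ)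

theorem Arc.start_add (A : Arc) : A.start + (A.len : Circ) = A.finish := rfl

theorem Arc.finish_add (A : Arc) : A.finish + ((2 * Real.pi - A.len : ℝ) : Circ) = A.start := by
  rw [Arc.finish, AddCircle.coe_sub, AddCircle.coe_period]; abel

namespace FPi

/-- The object `E(x, y)`: `P_[x] ⊕ P_[y]`, where `d` has the components
`α_* : P_[x] ⟶ P_[y]`, `α = y - x`, and `β_* : P_[y] ⟶ P_[x]`, `β = x + 2π - y`. -/
def E (A : Arc) : FPi t where
  V := PS1.P t A.start ⊞ PS1.P t A.finish
  d := biprod.desc (PS1.star t A.len A.nonneg A.start_add ≫ biprod.inr)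
    (PS1.star t (2 * Real.pi - A.len) (by linarith [A.le]) A.finish_add ≫ biprod.inl)
  sq := by
    apply biprod.hom_ext'
    · rw [biprod.inl_desc_assoc, Category.assoc, biprod.inr_desc, ← Category.assoc,
        PS1.star_loop t _ _ _ _ (by ring)]
      simp
    · rw [biprod.inr_desc_assoc, Category.assoc, biprod.inl_desc, ← Category.assoc,
        PS1.star_loop t _ _ _ _ (by ring)]
      simp

/-- `r` times the basic diagonal morphism `E(x₀, x₁) ⟶ E(y₀, y₁)`, where `x₀ ≤ y₀`, `x₁ ≤ y₁`
and `y₀ - x₀ = u`: it sends `e_{x₀}` to `r e_{y₀}^(y₀-x₀)` and `e_{x₁}` to `r e_{y₁}^(y₁-x₁)`. -/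
def diag (r : R) {A B : Arc} (u : ℝ) (hu : 0 ≤ u) (h : A.start + (u : Circ) = B.start)
    (hv : A.len ≤ u + B.len) : E t A ⟶ E t B where
  f := biprod.map (r • PS1.star t u hu h)
    (r • PS1.star t (u + B.len - A.len) (by linarith) (by
      rw [Arc.finish, Arc.finish, ← h, AddCircle.coe_sub, AddCircle.coe_add]; abel))
  comm := by
    dsimp only [E]
    apply biprod.hom_ext'
    · rw [biprod.inl_desc_assoc, Category.assoc, biprod.inr_map, biprod.inl_map_assoc,
        biprod.inl_desc, Linear.smul_comp, Linear.comp_smul, Linear.smul_comp,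
        ← Category.assoc, ← Category.assoc]
      congr 2
      exact PS1.star_square t _ _ _ _ _ _ _ _ (by ring)
    · rw [biprod.inr_desc_assoc, Category.assoc, biprod.inl_map, biprod.inr_map_assoc,
        biprod.inr_desc, Linear.smul_comp, Linear.comp_smul, Linear.smul_comp,
        ← Category.assoc, ← Category.assoc]
      congr 2
      exact PS1.star_square t _ _ _ _ _ _ _ _ (by ring)

/-- `r` times the basic counter-diagonal morphism `E(x₀, x₁) ⟶ E(y₀, y₁)`, where `x₀ ≤ y₁`,
`x₁ ≤ y₀ + 2π` and `y₁ - x₀ = u`: it sends `e_{x₀}` to `r e_{y₁}^(y₁-x₀)` and `e_{x₁}` to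
`r e_{y₀}^(y₀+2π-x₁)`. -/
def counterDiag (r : R) {A B : Arc} (u : ℝ) (hu : 0 ≤ u) (h : A.start + (u : Circ) = B.finish)
    (hv : A.len + B.len ≤ u + 2 * Real.pi) : E t A ⟶ E t B where
  f := biprod.desc ((r • PS1.star t u hu h) ≫ biprod.inr)
    ((r • PS1.star t (u - B.len + 2 * Real.pi - A.len) (by linarith) (by
      have : A.start = B.start + (B.len : Circ) - (u : Circ) := by
        rw [eq_sub_iff_add_eq, h, Arc.finish]
      rw [Arc.finish, this]
      simp only [AddCircle.coe_add, AddCircle.coe_sub, AddCircle.coe_period]; abel)) ≫ biprod.inl)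
  comm := by
    dsimp only [E]
    apply biprod.hom_ext'
    · rw [biprod.inl_desc_assoc, Category.assoc, biprod.inr_desc, biprod.inl_desc_assoc,
        Category.assoc, biprod.inr_desc, Linear.smul_comp, Linear.smul_comp, Linear.comp_smul,
        ← Category.assoc, ← Category.assoc]
      congr 2
      exact PS1.star_square t _ _ _ _ _ _ _ _ (by ring)
    · rw [biprod.inr_desc_assoc, Category.assoc, biprod.inl_desc, biprod.inr_desc_assoc,
        Category.assoc, biprod.inl_desc, Linear.smul_comp, Linear.smul_comp, Linear.comp_smul,
        ← Category.assoc, ← Category.assoc]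
      congr 2
      exact PS1.star_square t _ _ _ _ _ _ _ _ (by ring)

end FPi

/-! ### The equivalence of `C_π` with the stable category of `F_π` -/

/-- The arc from `x` to `y` for `X = (x, y)`. -/
def IndC.arc {K : Type*} (X : IndC K) : Arc where
  start := X.fst
  len := dep X.snd X.fst
  nonneg := dep_nonneg _ _
  le := (dep_lt _ _).le

theorem IndC.arc_finish {K : Type*} (X : IndC K) : X.arc.finish = X.snd := by
  rw [Arc.finish, arc, coe_dep]; abel

theorem IndC.arc_len_add {K : Type*} (X : IndC K) :
    X.arc.len + X.swap.arc.len = 2 * Real.pi := by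
  obtain ⟨x₀, x₁, _, _, a, b, _, _, h1, h2, h3, h4⟩ := Linked.refl X
  have e1 : X.arc.len = x₁ - x₀ :=
    dep_eq (by linarith) (by linarith) (by rw [AddCircle.coe_sub, a, b])
  have e2 : X.swap.arc.len = x₀ + 2 * Real.pi - x₁ :=
    dep_eq (by linarith) (by linarith)
      (by rw [AddCircle.coe_sub, Circ.coe_add_two_pi, a, b]; rfl)
  rw [e1, e2]; ring

theorem IndC.Linked.arc_len_le {K : Type*} {X Y : IndC K} (h : Linked X Y) :
    X.arc.len ≤ dep Y.fst X.fst + Y.arc.len := by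
  obtain ⟨x₀, x₁, y₀, y₁, a, b, c, d, h1, h2, h3, h4⟩ := h
  have e1 : X.arc.len = x₁ - x₀ :=
    dep_eq (by linarith) (by linarith) (by rw [AddCircle.coe_sub, a, b])
  have e2 : Y.arc.len = y₁ - y₀ :=
    dep_eq (by linarith) (by linarith) (by rw [AddCircle.coe_sub, c, d])
  have e3 : dep Y.fst X.fst = y₀ - x₀ :=
    dep_eq (by linarith) (by linarith) (by rw [AddCircle.coe_sub, c, a])
  linarith

theorem IndC.CounterLinked.arc_len_le {K : Type*} {X Y : IndC K} (h : CounterLinked X Y) :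
    X.arc.len + Y.arc.len ≤ dep Y.snd X.fst + 2 * Real.pi := by
  obtain ⟨x₀, x₁, y₀, y₁, a, b, c, d, h1, h2, h3, h4⟩ := h
  have e1 : X.arc.len = x₁ - x₀ :=
    dep_eq (by linarith) (by linarith) (by rw [AddCircle.coe_sub, a, b])
  have e2 : Y.arc.len = y₁ - y₀ :=
    dep_eq (by linarith) (by linarith) (by rw [AddCircle.coe_sub, c, d])
  have e3 : dep Y.snd X.fst = y₁ - x₀ :=
    dep_eq (by linarith) (by linarith) (by rw [AddCircle.coe_sub, d, a])
  linarith

open Classical in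
/-- `r` times the basic morphism `E(X) ⟶ E(Y)` in `F_π` which corresponds to `b_ε^{XY}`: diagonal
for `ε = +`, counter-diagonal for `ε = -`, and zero if there is no basic morphism `X ⟶ Y`. -/
def FPi.basic {K : Type*} (r : R) (X Y : IndC K) : E t X.arc ⟶ E t Y.arc :=
  if h : IndC.Linked X Y then
    diag t r (dep Y.fst X.fst) (dep_nonneg _ _) (by rw [coe_dep]; simp [IndC.arc]) h.arc_len_le
  else if h : IndC.CounterLinked X Y then
    counterDiag t r (dep Y.snd X.fst) (dep_nonneg _ _)
      (by rw [coe_dep, IndC.arc_finish]; simp [IndC.arc]) h.arc_len_le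
  else 0

section Chosen

variable {K : Type*} (X : IndC K)

/-- The degenerate arc `(y, y)` for `X = (x, y)`. -/
def IndC.finishArc : Arc := ⟨X.snd, 0, le_rfl, Real.two_pi_pos.le⟩

/-- The full arc `(x, x + 2π)` for `X = (x, y)`. -/
def IndC.fullArc : Arc := ⟨X.fst, 2 * Real.pi, Real.two_pi_pos.le, le_rfl⟩

instance : HasBinaryBiproducts (FPi t) := hasBinaryBiproducts_of_finite_biproducts _

/-- The projective-injective object `E(y, y) ⊕ E(x, x + 2π)`. -/
def FPi.hull : FPi t := E t X.finishArc ⊞ E t X.fullArc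

/-- The first map `(1, -1) : E(x, y) ⟶ E(y, y) ⊕ E(x, x + 2π)` of the chosen exact sequence. -/
def FPi.hullIn : E t X.arc ⟶ hull t X :=
  biprod.lift
    (diag t 1 X.arc.len X.arc.nonneg X.arc_finish (by simp [IndC.finishArc]))
    (diag t (-1) 0 le_rfl (by simp [IndC.arc, IndC.fullArc])
      (by simpa [IndC.fullArc] using X.arc.le))

/-- The second map `(1, 1) : E(y, y) ⊕ E(x, x + 2π) ⟶ E(y, x + 2π)` of the chosen exact
sequence. -/
def FPi.hullOut : hull t X ⟶ E t X.swap.arc :=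
  biprod.desc
    (diag t 1 0 le_rfl (by simp [IndC.arc, IndC.finishArc, IndC.swap])
      (by simpa [IndC.finishArc] using X.swap.arc.nonneg))
    (diag t 1 X.arc.len X.arc.nonneg X.arc_finish
      (by simpa [IndC.fullArc] using X.arc_len_add.ge))

end Chosen

end Frobenius

section Triangles

variable {R : Type u} [CommRing R] [IsLocalRing R] (t : R)

/-- The residue field `K = R / 𝔪`. -/
local notation "𝕂" => IsLocalRing.ResidueField

namespace FPi

/-- The object of `F_π` corresponding to an object of `C_π`: the direct sum of the `E(x, y)`. -/
def ofCPi (X : CPi (𝕂 R)) : FPi t := ⨁ fun i => E t (X.X i).arc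

/-- A morphism `f'` of `F_π` represents (is a lifting of) the morphism `f` of `C_π` if, for all
`i, j`, its `(i, j)` component is stably equal to `r` times the basic morphism for some
`r ∈ R` whose residue class is the `(i, j)` entry of `f`. -/
def Represents {X Y : CPi (𝕂 R)} (f' : ofCPi t X ⟶ ofCPi t Y) (f : X ⟶ Y) : Prop :=
  ∀ i j, ∃ r : R, IsLocalRing.residue R r = (f i j).coeff ∧
    (stab t).map (biproduct.ι (fun i => E t (X.X i).arc) i ≫ f' ≫
      biproduct.π (fun j => E t (Y.X j).arc) j) = (stab t).map (basic t r (X.X i) (Y.X j))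

/-- The middle term of the chosen exact sequence of an object of `C_π`. -/
def sumHull (X : CPi (𝕂 R)) : FPi t := ⨁ fun i => hull t (X.X i)

/-- The first map of the chosen exact sequence, a direct sum of the maps `(1, -1)`. -/
def sumHullIn (X : CPi (𝕂 R)) : ofCPi t X ⟶ sumHull t X :=
  biproduct.map fun i => hullIn t (X.X i)

/-- The second map of the chosen exact sequence, a direct sum of the maps `(1, 1)`. -/
def sumHullOut (X : CPi (𝕂 R)) : sumHull t X ⟶ ofCPi t X.shift :=
  biproduct.map fun i => hullOut t (X.X i)

end FPi

open FPi in
/-- Distinguished triangles `X ⟶ Y ⟶ Z ⟶ ΣX` of `C_π`, starting with `f : X ⟶ Y`. One lifts `f`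
to a morphism `f'` of `F_π` and takes a pushout of the chosen exact sequence of `X`,
```
  X --> Q --> ΣX
  |f'   |u     ‖
  v     v      ‖
  Y --> C --> ΣX
     m     q
```
The triangle is distinguished if, in the stable category of `F_π`, it is isomorphic over `f`
to the one given by `m` and `q` for such a diagram. -/
def IsDistinguished {X Y Z : CPi (𝕂 R)} (f : X ⟶ Y) (g : Y ⟶ Z) (h : Z ⟶ X.shift) : Prop :=
  ∃ (f' : ofCPi t X ⟶ ofCPi t Y) (g' : ofCPi t Y ⟶ ofCPi t Z)
    (h' : ofCPi t Z ⟶ ofCPi t X.shift),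
    Represents t f' f ∧ Represents t g' g ∧ Represents t h' h ∧
    ∃ (C : FPi t) (m : ofCPi t Y ⟶ C) (u : sumHull t X ⟶ C) (q : C ⟶ ofCPi t X.shift)
      (φ : (stab t).obj (ofCPi t Z) ≅ (stab t).obj C),
      IsPushout (sumHullIn t X) f' u m ∧ u ≫ q = sumHullOut t X ∧ m ≫ q = 0 ∧
      (stab t).map g' ≫ φ.hom = (stab t).map m ∧ φ.hom ≫ (stab t).map q = (stab t).map h'

end Triangles

end

/-! The stable category becomes computable once stable equality is recognized as null-homotopy: two
morphisms of `F_π` are stably equal iff their difference has the form `sd + ds` (`stableRel_iff`).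
The reason is that the free objects `V ⊕ V` are projective-injective with null-homotopic identity,
and every projective-injective object is a direct summand of one of them.

With this criterion the identification of `C_π` with the stable category is proved by hand. A
morphism `E(X) ⟶ E(Y)` is a diagonal plus a counter-diagonal map. Either part is null-homotopic
unless the corresponding basic morphism of `C_π` exists, and `r` times an existing basic map is
null-homotopic only if `t ∣ r`. As multiples of `t` are null-homotopic, a morphism modulo homotopy
is a matrix of residue classes (`exists_represents`, `Represents.unique`), and composites follow the
rule of `C_π` (`null_basic_comp_sub`).

Two liftings of `f` differ by a null-homotopic map, which extends over the chosen hull of `X`; hence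
the pushouts along them agree. If one pushout is known explicitly, the distinguished triangles
starting with `f` are therefore exactly those isomorphic to it, with the identity on `Y` and on `ΣX`
(`isDistinguished_iff`).

The pushout is found by elimination. The components of `f` have nonzero residue, so they lift to
units `r₁`, `r₂` of the local ring `R`, with inverses `s₁`, `s₂`. The hull and `Y` together have
eight generators. The two relations coming from `X` eliminate the generator at `a` and one of the
two at `x`, and the six survivors, at `b`, `c`, `x`, `y`, `z` and `a + 2π`, can be paired as `(b, a
+ 2π)`, `(c, z)`, `(x, y)`. In this basis `Y ⟶ Z` has the rows `(-s₁, s₁, 0)` and `(0, -s₂, s₂)`,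
while `Z ⟶ ΣX` has all entries `1` (`exists_standard_pushout`); the square commutes because the
terms at `(c, z)` cancel.

The three arcs of `Z` are strictly nested, so there are no nonzero morphisms between different
summands, and an automorphism of `Z` is an invertible diagonal matrix. Such matrices act on the
pairs `(g, h)`; the products `h_j g_{ji} f_i` are invariant, and together with the two vanishing
entries they single out the orbit of the standard triangle. -/

/-- Composing an equation `f ≫ g = h` with a further morphism. -/
theorem CategoryTheory.assoc_of {C : Type*} [Category C] {X Y Z W : C} {f : X ⟶ Y} {g : Y ⟶ Z}
    {h : X ⟶ Z} (e : f ≫ g = h) (k : Z ⟶ W) : f ≫ g ≫ k = h ≫ k := by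
  rw [← e, Category.assoc]

/-! ### Null-homotopies, free objects and the stable relation -/

namespace FPi

section Stable

variable {R : Type u} [CommRing R] {t : R}

@[simp] theorem id_f (X : FPi t) : (𝟙 X : X ⟶ X).f = 𝟙 X.V := rfl
@[simp] theorem comp_f {X Y Z : FPi t} (f : X ⟶ Y) (g : Y ⟶ Z) : (f ≫ g).f = f.f ≫ g.f := rfl
@[simp] theorem add_f {X Y : FPi t} (f g : X ⟶ Y) : (f + g).f = f.f + g.f := rfl
@[simp] theorem neg_f {X Y : FPi t} (f : X ⟶ Y) : (-f).f = -f.f := rfl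
@[simp] theorem zero_f (X Y : FPi t) : (0 : X ⟶ Y).f = 0 := rfl

theorem sum_f {X Y : FPi t} {ι : Type*} (s : Finset ι) (f : ι → (X ⟶ Y)) :
    (∑ i ∈ s, f i).f = ∑ i ∈ s, (f i).f :=
  forget.map_sum _ _

/-- A morphism of `F_π` is null-homotopic if it has the form `sd + ds`. -/
def Null {X Y : FPi t} (f : X ⟶ Y) : Prop := ∃ s : X.V ⟶ Y.V, f.f = s ≫ Y.d + X.d ≫ s

theorem Null.zero (X Y : FPi t) : Null (0 : X ⟶ Y) := ⟨0, by simp⟩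

theorem Null.add {X Y : FPi t} {f g : X ⟶ Y} : Null f → Null g → Null (f + g) := by
  rintro ⟨s, hs⟩ ⟨s', hs'⟩
  refine ⟨s + s', ?_⟩
  rw [add_f, hs, hs', Preadditive.add_comp, Preadditive.comp_add]
  abel

theorem Null.neg {X Y : FPi t} {f : X ⟶ Y} : Null f → Null (-f) := by
  rintro ⟨s, hs⟩
  refine ⟨-s, ?_⟩
  rw [neg_f, hs, Preadditive.neg_comp, Preadditive.comp_neg]
  abel

theorem Null.sub {X Y : FPi t} {f g : X ⟶ Y} (hf : Null f) (hg : Null g) : Null (f - g) := by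
  rw [sub_eq_add_neg]; exact hf.add hg.neg

theorem Null.sum {X Y : FPi t} {ι : Type*} (s : Finset ι) {f : ι → (X ⟶ Y)}
    (h : ∀ i ∈ s, Null (f i)) : Null (∑ i ∈ s, f i) :=
  Finset.sum_induction _ _ (fun _ _ => Null.add) (Null.zero X Y) h

theorem Null.comp_right {X Y Z : FPi t} {f : X ⟶ Y} (hf : Null f) (g : Y ⟶ Z) :
    Null (f ≫ g) := by
  obtain ⟨s, hs⟩ := hf
  refine ⟨s ≫ g.f, ?_⟩
  rw [comp_f, hs, Preadditive.add_comp, Category.assoc, Category.assoc, Category.assoc, g.comm]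

theorem Null.comp_left {X Y Z : FPi t} (f : X ⟶ Y) {g : Y ⟶ Z} (hg : Null g) :
    Null (f ≫ g) := by
  obtain ⟨s, hs⟩ := hg
  refine ⟨f.f ≫ s, ?_⟩
  rw [comp_f, hs, Preadditive.comp_add, Category.assoc, ← Category.assoc X.d, f.comm,
    Category.assoc]

/-- The free object on `V`: two copies of `V`, where `d` sends the first one identically to the
second one. -/
noncomputable def free (V : PS1 t) : FPi t where
  V := V ⊞ V
  d := biprod.desc biprod.inr (t • biprod.inl)
  sq := by
    apply biprod.hom_ext' <;> simp

namespace free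

variable (V : PS1 t)

/-- The inclusion of the first copy of `V`. -/
noncomputable def i₀ : V ⟶ (free V).V := (biprod.inl : V ⟶ V ⊞ V)
/-- The inclusion of the second copy of `V`. -/
noncomputable def i₁ : V ⟶ (free V).V := (biprod.inr : V ⟶ V ⊞ V)
/-- The projection to the first copy of `V`. -/
noncomputable def p₀ : (free V).V ⟶ V := (biprod.fst : V ⊞ V ⟶ V)
/-- The projection to the second copy of `V`. -/
noncomputable def p₁ : (free V).V ⟶ V := (biprod.snd : V ⊞ V ⟶ V)

@[simp] theorem i₀_p₀ : i₀ V ≫ p₀ V = 𝟙 V := biprod.inl_fst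
@[simp] theorem i₀_p₀_assoc {W : PS1 t} (k : V ⟶ W) :
    i₀ V ≫ p₀ V ≫ k = k := by
  simp [assoc_of (i₀_p₀ V)]
@[simp] theorem i₀_p₁ : i₀ V ≫ p₁ V = 0 := biprod.inl_snd
@[simp] theorem i₀_p₁_assoc {W : PS1 t} (k : V ⟶ W) :
    i₀ V ≫ p₁ V ≫ k = 0 := by
  simp [assoc_of (i₀_p₁ V)]
@[simp] theorem i₁_p₀ : i₁ V ≫ p₀ V = 0 := biprod.inr_fst
@[simp] theorem i₁_p₀_assoc {W : PS1 t} (k : V ⟶ W) :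
    i₁ V ≫ p₀ V ≫ k = 0 := by
  simp [assoc_of (i₁_p₀ V)]
@[simp] theorem i₁_p₁ : i₁ V ≫ p₁ V = 𝟙 V := biprod.inr_snd
@[simp] theorem i₁_p₁_assoc {W : PS1 t} (k : V ⟶ W) :
    i₁ V ≫ p₁ V ≫ k = k := by
  simp [assoc_of (i₁_p₁ V)]
@[simp] theorem i₀_d : i₀ V ≫ (free V).d = i₁ V := biprod.inl_desc _ _
@[simp] theorem i₀_d_assoc {W : PS1 t} (k : (free V).V ⟶ W) :
    i₀ V ≫ (free V).d ≫ k = i₁ V ≫ k := by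
  simp [assoc_of (i₀_d V)]
@[simp] theorem i₁_d : i₁ V ≫ (free V).d = t • i₀ V := biprod.inr_desc _ _
@[simp] theorem i₁_d_assoc {W : PS1 t} (k : (free V).V ⟶ W) :
    i₁ V ≫ (free V).d ≫ k = (t • i₀ V) ≫ k := by
  simp [assoc_of (i₁_d V)]

variable {V}

theorem hom_ext' {W : PS1 t} {f g : (free V).V ⟶ W} (h₀ : i₀ V ≫ f = i₀ V ≫ g)
    (h₁ : i₁ V ≫ f = i₁ V ≫ g) : f = g := biprod.hom_ext' (f := f) (g := g) h₀ h₁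

theorem hom_ext {W : PS1 t} {f g : W ⟶ (free V).V} (h₀ : f ≫ p₀ V = g ≫ p₀ V)
    (h₁ : f ≫ p₁ V = g ≫ p₁ V) : f = g := biprod.hom_ext (f := f) (g := g) h₀ h₁

variable (V)

@[simp] theorem d_p₀ : (free V).d ≫ p₀ V = t • p₁ V := by
  apply hom_ext' <;> simp
@[simp] theorem d_p₀_assoc {W : PS1 t} (k : V ⟶ W) :
    (free V).d ≫ p₀ V ≫ k = (t • p₁ V) ≫ k := by
  simp [assoc_of (d_p₀ V)]
@[simp] theorem d_p₁ : (free V).d ≫ p₁ V = p₀ V := by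
  apply hom_ext' <;> simp
@[simp] theorem d_p₁_assoc {W : PS1 t} (k : V ⟶ W) :
    (free V).d ≫ p₁ V ≫ k = p₀ V ≫ k := by
  simp [assoc_of (d_p₁ V)]

variable {V}

/-- The morphism from the free object on `V` given by a morphism `V ⟶ X`. -/
noncomputable def desc {X : FPi t} (k : V ⟶ X.V) : free V ⟶ X where
  f := p₀ V ≫ k + p₁ V ≫ k ≫ X.d
  comm := by apply hom_ext' <;> simp [X.sq]

/-- The morphism to the free object on `V` given by a morphism `X ⟶ V`. -/
noncomputable def lift {X : FPi t} (k : X.V ⟶ V) : X ⟶ free V where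
  f := (X.d ≫ k) ≫ i₀ V + k ≫ i₁ V
  comm := by
    apply hom_ext
    · simp [← Category.assoc X.d X.d, X.sq]
    · simp

@[simp] theorem i₀_desc {X : FPi t} (k : V ⟶ X.V) : i₀ V ≫ (desc k).f = k := by
  simp [desc]
@[simp] theorem i₀_desc_assoc {X : FPi t} (k : V ⟶ X.V) {W : PS1 t} (l : X.V ⟶ W) :
    i₀ V ≫ (desc k).f ≫ l = k ≫ l := assoc_of (i₀_desc k) l
@[simp] theorem i₁_desc {X : FPi t} (k : V ⟶ X.V) : i₁ V ≫ (desc k).f = k ≫ X.d := by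
  simp [desc]
@[simp] theorem i₁_desc_assoc {X : FPi t} (k : V ⟶ X.V) {W : PS1 t} (l : X.V ⟶ W) :
    i₁ V ≫ (desc k).f ≫ l = k ≫ X.d ≫ l := by
  rw [assoc_of (i₁_desc k) l, Category.assoc]
@[simp] theorem lift_p₀ {X : FPi t} (k : X.V ⟶ V) : (lift k).f ≫ p₀ V = X.d ≫ k := by
  simp [lift]
@[simp] theorem lift_p₁ {X : FPi t} (k : X.V ⟶ V) : (lift k).f ≫ p₁ V = k := by
  simp [lift]
@[simp] theorem lift_p₁_assoc {X : FPi t} (k : X.V ⟶ V) {W : PS1 t} (l : V ⟶ W) :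
    (lift k).f ≫ p₁ V ≫ l = k ≫ l := assoc_of (lift_p₁ k) l

end free

/-- As a representation `C` is projective, so the underlying sequence splits. The retraction need
not commute with `d`. -/
theorem IsExactSeq.exists_retraction {A B C : FPi t} {f : A ⟶ B} {g : B ⟶ C}
    (h : IsExactSeq f g) : ∃ ρ : B.V ⟶ A.V, f.f ≫ ρ = 𝟙 A.V := by
  obtain ⟨σ, hσ⟩ := C.V.property.2.2 B.V.property.1 C.V.property.1 g.f.hom (fun x => (h x).2.2)
    (𝟙 C.V.obj)
  have hσ' (x : RotCirc) (c : C.V.obj.obj x) : g.f.hom.app x (σ.app x c) = c :=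
    congrArg (fun k : C.V.obj ⟶ C.V.obj => k.app x c) hσ
  have key (x : RotCirc) (b : B.V.obj.obj x) :
      ∃ a, f.f.hom.app x a = b - σ.app x (g.f.hom.app x b) :=
    (h x).2.1 _ |>.1 (by rw [map_sub, hσ', sub_self])
  -- Linearity, naturality and the retraction property of `r` are all tested after the injective map
  -- `f`.
  choose r hr using key
  refine ⟨ObjectProperty.homMk
    { app := fun x => ModuleCat.ofHom
        { toFun := r x
          map_add' := fun b b' => (h x).1 (by simp only [map_add, hr]; abel)
          map_smul' := fun k b => (h x).1 (by
            simp only [map_smul, hr, smul_sub, RingHom.id_apply]) }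
      naturality := fun x y k => ?_ }, ?_⟩
  · ext b
    apply (h y).1
    change f.f.hom.app y (r y (B.V.obj.map k b)) = f.f.hom.app y (A.V.obj.map k (r x b))
    rw [hr, NatTrans.naturality_apply, NatTrans.naturality_apply, NatTrans.naturality_apply, hr,
      map_sub]
  · apply ObjectProperty.hom_ext
    ext x a
    apply (h x).1
    change f.f.hom.app x (r x (f.f.hom.app x a)) = f.f.hom.app x a
    rw [hr, ((h x).2.1 _).2 ⟨a, rfl⟩, map_zero, sub_zero]

/-- Morphisms from `free V` to `X` correspond to morphisms `V ⟶ X.V`, and morphisms from `X` to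
`free V` to morphisms `X.V ⟶ V`. Lifting thus reduces to the projectivity of `V`, and extension to
the splitting of the underlying sequence. -/
theorem isProjInj_free (V : PS1 t) : IsProjInj (free V) := by
  intro A B C f g h
  constructor
  · intro q
    obtain ⟨k, hk⟩ := V.property.2.2 B.V.property.1 C.V.property.1 g.f.hom (fun x => (h x).2.2)
      (free.i₀ V ≫ q.f).hom
    let k' : V ⟶ B.V := ObjectProperty.homMk k
    have hk' : k' ≫ g.f = free.i₀ V ≫ q.f := ObjectProperty.hom_ext _ hk
    refine ⟨free.desc k', hom_ext (free.hom_ext' ?_ ?_)⟩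
    · simp [hk']
    · simp only [comp_f, free.i₁_desc_assoc]
      rw [g.comm, assoc_of hk', Category.assoc, ← q.comm, free.i₀_d_assoc]
  · intro q
    obtain ⟨ρ, hρ⟩ := h.exists_retraction
    refine ⟨free.lift (ρ ≫ q.f ≫ free.p₁ V), hom_ext (free.hom_ext ?_ ?_)⟩
    · simp only [comp_f, Category.assoc, free.lift_p₀]
      rw [← Category.assoc f.f, ← f.comm, Category.assoc, assoc_of hρ, Category.id_comp,
        ← Category.assoc, q.comm, Category.assoc, free.d_p₁]
    · simp [assoc_of hρ]

/-- The canonical map from the free object on `Q.V` to `Q` is the second map of an exact sequence,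
so it splits when `Q` is projective. The homotopy contracting the free object is then transported to
its summand `Q`. -/
theorem Null.of_isProjInj {Q : FPi t} (hQ : IsProjInj Q) : Null (𝟙 Q) := by
  -- The kernel of `π` is `Q.V` with the opposite sign of `d`: the composite of `j` and `π` is the
  -- differential of `Q'` plus that of `Q`.
  let Q' : FPi t := ⟨Q.V, -Q.d, by simp [Q.sq]⟩
  let π : free Q.V ⟶ Q := free.desc (𝟙 _)
  let j : Q' ⟶ free Q.V := free.lift (𝟙 Q.V)
  have h1 : j.f ≫ free.p₁ Q.V = 𝟙 Q.V := free.lift_p₁ _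
  have h0 : j.f ≫ free.p₀ Q.V = -Q.d := (free.lift_p₀ _).trans (Category.comp_id _)
  have h2 : free.i₀ Q.V ≫ π.f = 𝟙 Q.V := by simp [π]
  have h2' : free.i₁ Q.V ≫ π.f = Q.d := by simp [π]
  have h3 : j.f ≫ π.f = 0 := by
    have : π.f = free.p₀ Q.V + free.p₁ Q.V ≫ Q.d := by apply free.hom_ext' <;> simp [h2, h2']
    rw [this, Preadditive.comp_add, h0, assoc_of h1, Category.id_comp,
      neg_add_cancel]
  have h4 : free.p₁ Q.V ≫ j.f + π.f ≫ free.i₀ Q.V = 𝟙 (free Q.V).V := by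
    apply free.hom_ext'
    · simp [assoc_of h2]
    · rw [Preadditive.comp_add, free.i₁_p₁_assoc, assoc_of h2']
      apply free.hom_ext <;> simp [h0, h1]
  have hex : IsExactSeq j π := by
    intro x
    have e1 (v) : (free.p₁ Q.V).hom.app x (j.f.hom.app x v) = v :=
      congrArg (fun k : Q.V ⟶ Q.V => k.hom.app x v) h1
    have e2 (v) : π.f.hom.app x ((free.i₀ Q.V).hom.app x v) = v :=
      congrArg (fun k : Q.V ⟶ Q.V => k.hom.app x v) h2
    have e3 (v) : π.f.hom.app x (j.f.hom.app x v) = 0 :=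
      congrArg (fun k : Q'.V ⟶ Q.V => k.hom.app x v) h3
    have e4 (v) : j.f.hom.app x ((free.p₁ Q.V).hom.app x v) +
        (free.i₀ Q.V).hom.app x (π.f.hom.app x v) = v :=
      congrArg (fun k : (free Q.V).V ⟶ (free Q.V).V => k.hom.app x v) h4
    refine ⟨Function.LeftInverse.injective e1, fun v => ⟨fun hv => ?_, ?_⟩,
      Function.RightInverse.surjective e2⟩
    · refine ⟨(free.p₁ Q.V).hom.app x v, ?_⟩
      have := e4 v
      rwa [hv, map_zero, add_zero] at this
    · rintro ⟨w, rfl⟩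
      exact e3 w
  obtain ⟨q, hq⟩ := (hQ j π hex).1 (𝟙 Q)
  -- The contracting homotopy sends the second copy of `V` identically to the first and kills the
  -- first.
  have hf : Null (𝟙 (free Q.V)) := by
    refine ⟨free.p₁ Q.V ≫ free.i₀ Q.V, ?_⟩
    apply free.hom_ext' <;> simp
  rw [← hq, ← Category.id_comp π]
  exact (hf.comp_right π).comp_left q

/-- Null-homotopic maps form an ideal containing the identities of projective-injective objects.
Conversely, a homotopy `s` gives a factorization through the free object on `Y.V`, by `free.lift s`
and `free.desc (𝟙 _)`. -/
theorem stableRel_iff {X Y : FPi t} {f g : X ⟶ Y} : stableRel t f g ↔ Null (f - g) := by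
  constructor
  · rintro ⟨Q, hQ, p, q, e⟩
    rw [e, ← Category.id_comp q]
    exact ((Null.of_isProjInj hQ).comp_right q).comp_left p
  · rintro ⟨s, hs⟩
    refine ⟨free Y.V, isProjInj_free _, free.lift s, free.desc (𝟙 _), hom_ext ?_⟩
    rw [hs, comp_f]
    simp [free.desc, add_comm]

/-- Makes equality in the quotient category the relation itself, not the closure generated by it. -/
instance : Congruence (stableRel t) where
  equivalence :=
    { refl := fun f => stableRel_iff.2 (by rw [sub_self]; exact Null.zero _ _)
      symm := fun h => stableRel_iff.2 (by rw [← neg_sub]; exact (stableRel_iff.1 h).neg)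
      trans := fun h h' => stableRel_iff.2 (by
        rw [← sub_add_sub_cancel]; exact (stableRel_iff.1 h).add (stableRel_iff.1 h')) }
  comp_left f _ _ h := stableRel_iff.2 (by
    rw [← Preadditive.comp_sub]; exact (stableRel_iff.1 h).comp_left f)
  comp_right g h := stableRel_iff.2 (by
    rw [← Preadditive.sub_comp]; exact (stableRel_iff.1 h).comp_right g)

theorem stab_map_eq_iff {X Y : FPi t} {f g : X ⟶ Y} :
    (stab t).map f = (stab t).map g ↔ Null (f - g) :=
  (CategoryTheory.Quotient.functor_map_eq_iff _ _ _).trans stableRel_iff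

end Stable

end FPi

/-! ### Morphisms between the projectives `P_[x]` -/

section Star

variable {R : Type u} [CommRing R] {t : R}

namespace PS1

theorem star_congr {x y : Circ} {α β : ℝ} (e : α = β) {hα : 0 ≤ α} {hβ : 0 ≤ β}
    {h : x + (α : Circ) = y} {h' : x + (β : Circ) = y} : star t α hα h = star t β hβ h' := by
  subst e; rfl

theorem star_trans {x y z : Circ} {α β : ℝ} (hα : 0 ≤ α) (hβ : 0 ≤ β)
    (hxy : x + (α : Circ) = y) (hyz : y + (β : Circ) = z) :
    star t α hα hxy ≫ star t β hβ hyz = star t (α + β) (add_nonneg hα hβ)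
      (by rw [AddCircle.coe_add, ← add_assoc, hxy, hyz]) :=
  star_comp t hα hβ hxy hyz _

theorem star_trans_assoc {x y z : Circ} {α β : ℝ} (hα : 0 ≤ α) (hβ : 0 ≤ β)
    (hxy : x + (α : Circ) = y) (hyz : y + (β : Circ) = z) {W : PS1 t} (k : P t z ⟶ W) :
    star t α hα hxy ≫ star t β hβ hyz ≫ k = star t (α + β) (add_nonneg hα hβ)
      (by rw [AddCircle.coe_add, ← add_assoc, hxy, hyz]) ≫ k :=
  assoc_of (star_trans hα hβ hxy hyz) k

theorem star_zero {x : Circ} {α : ℝ} (e : α = 0) (hα : 0 ≤ α) (h : x + (α : Circ) = x) :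
    star t α hα h = 𝟙 (P t x) := by
  subst e
  apply ObjectProperty.hom_ext
  ext w
  have h3 : turns (dep x w.pt + 0) = 0 :=
    turns_unique (x := x) (z := w.pt) (add_nonneg (dep_nonneg _ _) le_rfl)
      (by rw [add_zero, coe_dep]) (by simp)
  change t ^ turns (dep x w.pt + 0) * 1 = 1
  rw [h3, pow_zero, mul_one]

/-- By naturality a morphism is determined by the image of `e_x`, which lies in the free module of
rank one of `P_[y]` at `x`. The bound on `α` is essential: only for `α < 2π` is `e_y^α` a generator
of this module and not a multiple of `t`. -/
theorem exists_eq_smul_star {x y : Circ} (k : P t x ⟶ P t y) {α : ℝ} (hα : 0 ≤ α)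
    (hα' : α < 2 * Real.pi) (h : x + (α : Circ) = y) : ∃ r : R, k = r • star t α hα h := by
  have hd : dep y x = α := dep_eq hα hα' (by rw [← h]; abel)
  refine ⟨k.hom.app ⟨x⟩ (1 : R), ?_⟩
  apply ObjectProperty.hom_ext
  ext z
  have n := NatTrans.naturality_apply k.hom (RotCirc.short ⟨x⟩ z) (1 : R)
  have e1 : (P t x).obj.map (RotCirc.short ⟨x⟩ z) (1 : R) = (1 : R) := by
    change t ^ turns (dep x x + (RotCirc.short ⟨x⟩ z).angle) • (1 : R) = 1
    rw [turns_dep_add_angle x (z := ⟨x⟩) (RotCirc.short ⟨x⟩ z) (n := 0)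
      (by simp [RotCirc.short])]
    simp
  rw [e1] at n
  change k.hom.app z (1 : R) = (show R from k.hom.app ⟨x⟩ (1 : R)) * (t ^ turns (dep x z.pt + α) * 1)
  rw [n]
  change t ^ turns (dep y x + dep x z.pt) * _ = _
  rw [hd, add_comm α, mul_one, mul_comm]
  rfl

/-- At each point a rotation is multiplication by a power of `t`, which is injective over a domain.
-/
theorem smul_star_eq_zero [IsDomain R] (ht : t ≠ 0) {x y : Circ} {α : ℝ} {hα : 0 ≤ α}
    {h : x + (α : Circ) = y} {r : R} (e : r • star t α hα h = 0) : r = 0 := by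
  have : r * (t ^ turns (dep x x + α) * 1) = 0 :=
    congrArg (fun k : P t x ⟶ P t y => k.hom.app ⟨x⟩ (1 : R)) e
  rw [mul_one] at this
  exact (mul_eq_zero.1 this).resolve_right (pow_ne_zero _ ht)

theorem smul_star_inj [IsDomain R] (ht : t ≠ 0) {x y : Circ} {α : ℝ} {hα : 0 ≤ α}
    {h : x + (α : Circ) = y} {r s : R} (e : r • star t α hα h = s • star t α hα h) : r = s := by
  rw [← sub_eq_zero, ← sub_smul] at e
  exact sub_eq_zero.1 (smul_star_eq_zero ht e)

theorem star_cancel_right [IsDomain R] (ht : t ≠ 0) {x y z : Circ} {k l : P t x ⟶ P t y} {α : ℝ}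
    {hα : 0 ≤ α} {h : y + (α : Circ) = z} (e : k ≫ star t α hα h = l ≫ star t α hα h) : k = l := by
  obtain ⟨r, hr⟩ := exists_eq_smul_star (k - l) (dep_nonneg y x) (dep_lt y x)
    (by rw [coe_dep]; abel)
  rw [← sub_eq_zero, ← Preadditive.sub_comp, hr, Linear.smul_comp, star_trans] at e
  rw [← sub_eq_zero, hr, smul_star_eq_zero ht e, zero_smul]

theorem star_cancel_left [IsDomain R] (ht : t ≠ 0) {x y z : Circ} {k l : P t y ⟶ P t z} {α : ℝ}
    {hα : 0 ≤ α} {h : x + (α : Circ) = y} (e : star t α hα h ≫ k = star t α hα h ≫ l) : k = l := by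
  obtain ⟨r, hr⟩ := exists_eq_smul_star (k - l) (dep_nonneg z y) (dep_lt z y)
    (by rw [coe_dep]; abel)
  rw [← sub_eq_zero, ← Preadditive.comp_sub, hr, Linear.comp_smul, star_trans] at e
  rw [← sub_eq_zero, hr, smul_star_eq_zero ht e, zero_smul]

end PS1

end Star

/-! ### Components of `E(x, y)` and composition of diagonal and counter-diagonal maps -/

namespace FPi

open PS1

section Components

variable {R : Type u} [CommRing R] (t : R)

namespace E

/-- The inclusion `P_[x] ⟶ E(x, y)`. -/
noncomputable def i₀ (A : Arc) : P t A.start ⟶ (E t A).V :=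
  (biprod.inl : P t A.start ⟶ P t A.start ⊞ P t A.finish)
/-- The inclusion `P_[y] ⟶ E(x, y)`. -/
noncomputable def i₁ (A : Arc) : P t A.finish ⟶ (E t A).V :=
  (biprod.inr : P t A.finish ⟶ P t A.start ⊞ P t A.finish)
/-- The projection `E(x, y) ⟶ P_[x]`. -/
noncomputable def p₀ (A : Arc) : (E t A).V ⟶ P t A.start :=
  (biprod.fst : P t A.start ⊞ P t A.finish ⟶ P t A.start)
/-- The projection `E(x, y) ⟶ P_[y]`. -/
noncomputable def p₁ (A : Arc) : (E t A).V ⟶ P t A.finish :=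
  (biprod.snd : P t A.start ⊞ P t A.finish ⟶ P t A.finish)

variable {t}
variable {A B : Arc}

@[simp] theorem i₀_p₀ : i₀ t A ≫ p₀ t A = 𝟙 _ := biprod.inl_fst
@[simp] theorem i₀_p₁ : i₀ t A ≫ p₁ t A = 0 := biprod.inl_snd
@[simp] theorem i₁_p₀ : i₁ t A ≫ p₀ t A = 0 := biprod.inr_fst
@[simp] theorem i₁_p₁ : i₁ t A ≫ p₁ t A = 𝟙 _ := biprod.inr_snd
@[simp] theorem i₀_p₀_assoc {W : PS1 t} (k : P t A.start ⟶ W) : i₀ t A ≫ p₀ t A ≫ k = k :=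
  (assoc_of i₀_p₀ k).trans (Category.id_comp k)
@[simp] theorem i₀_p₁_assoc {W : PS1 t} (k : P t A.finish ⟶ W) : i₀ t A ≫ p₁ t A ≫ k = 0 :=
  (assoc_of i₀_p₁ k).trans zero_comp
@[simp] theorem i₁_p₀_assoc {W : PS1 t} (k : P t A.start ⟶ W) : i₁ t A ≫ p₀ t A ≫ k = 0 :=
  (assoc_of i₁_p₀ k).trans zero_comp
@[simp] theorem i₁_p₁_assoc {W : PS1 t} (k : P t A.finish ⟶ W) : i₁ t A ≫ p₁ t A ≫ k = k :=
  (assoc_of i₁_p₁ k).trans (Category.id_comp k)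

theorem total : p₀ t A ≫ i₀ t A + p₁ t A ≫ i₁ t A = 𝟙 (E t A).V :=
  biprod.total (X := P t A.start) (Y := P t A.finish)

theorem hom_ext' {W : PS1 t} {f g : (E t A).V ⟶ W} (h₀ : i₀ t A ≫ f = i₀ t A ≫ g)
    (h₁ : i₁ t A ≫ f = i₁ t A ≫ g) : f = g := biprod.hom_ext' (f := f) (g := g) h₀ h₁

@[simp] theorem i₀_d : i₀ t A ≫ (E t A).d = star t A.len A.nonneg A.start_add ≫ i₁ t A :=
  biprod.inl_desc _ _

@[simp] theorem i₁_d : i₁ t A ≫ (E t A).d =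
    star t (2 * Real.pi - A.len) (by linarith [A.le]) A.finish_add ≫ i₀ t A :=
  biprod.inr_desc _ _

@[simp] theorem d_p₀ : (E t A).d ≫ p₀ t A =
    p₁ t A ≫ star t (2 * Real.pi - A.len) (by linarith [A.le]) A.finish_add := by
  apply hom_ext'
  · rw [← Category.assoc, i₀_d]; simp
  · rw [← Category.assoc, i₁_d]; simp

@[simp] theorem d_p₁ : (E t A).d ≫ p₁ t A = p₀ t A ≫ star t A.len A.nonneg A.start_add := by
  apply hom_ext'
  · rw [← Category.assoc, i₀_d]; simp
  · rw [← Category.assoc, i₁_d]; simp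

end E

open E

variable {t} {A B C : Arc}

theorem diag_finish {u : ℝ} (h : A.start + (u : Circ) = B.start) :
    A.finish + ((u + B.len - A.len : ℝ) : Circ) = B.finish := by
  rw [Arc.finish, Arc.finish, ← h, AddCircle.coe_sub, AddCircle.coe_add]; abel

theorem counterDiag_finish {u : ℝ} (h : A.start + (u : Circ) = B.finish) :
    A.finish + ((u - B.len + 2 * Real.pi - A.len : ℝ) : Circ) = B.start := by
  have : A.start = B.start + (B.len : Circ) - (u : Circ) := by
    rw [eq_sub_iff_add_eq, h, Arc.finish]
  rw [Arc.finish, this]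
  simp only [AddCircle.coe_add, AddCircle.coe_sub, AddCircle.coe_period]; abel

section
variable (r : R) {u : ℝ} (hu : 0 ≤ u) (h : A.start + (u : Circ) = B.start)
  (hv : A.len ≤ u + B.len)

@[simp] theorem i₀_diag : i₀ t A ≫ (diag t r u hu h hv).f = r • star t u hu h ≫ i₀ t B :=
  (biprod.inl_map _ _).trans (Linear.smul_comp _ _ _ _ _ _)

@[simp] theorem i₁_diag : i₁ t A ≫ (diag t r u hu h hv).f =
    r • star t (u + B.len - A.len) (by linarith) (diag_finish h) ≫ i₁ t B :=
  (biprod.inr_map _ _).trans (Linear.smul_comp _ _ _ _ _ _)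

end

section
variable (r : R) {u : ℝ} (hu : 0 ≤ u) (h : A.start + (u : Circ) = B.finish)
  (hv : A.len + B.len ≤ u + 2 * Real.pi)

@[simp] theorem i₀_counterDiag :
    i₀ t A ≫ (counterDiag t r u hu h hv).f = r • star t u hu h ≫ i₁ t B :=
  (biprod.inl_desc _ _).trans (Linear.smul_comp _ _ _ _ _ _)

@[simp] theorem i₁_counterDiag : i₁ t A ≫ (counterDiag t r u hu h hv).f =
    r • star t (u - B.len + 2 * Real.pi - A.len) (by linarith) (counterDiag_finish h) ≫ i₀ t B :=
  (biprod.inr_desc _ _).trans (Linear.smul_comp _ _ _ _ _ _)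

end

theorem diag_congr (r : R) {u u' : ℝ} (e : u = u') {hu : 0 ≤ u} {h : A.start + (u : Circ) = B.start}
    {hv : A.len ≤ u + B.len} {hu' : 0 ≤ u'} {h' : A.start + (u' : Circ) = B.start}
    {hv' : A.len ≤ u' + B.len} : diag t r u hu h hv = diag t r u' hu' h' hv' := by
  subst e; rfl

theorem counterDiag_congr (r : R) {u u' : ℝ} (e : u = u') {hu : 0 ≤ u}
    {h : A.start + (u : Circ) = B.finish} {hv : A.len + B.len ≤ u + 2 * Real.pi} {hu' : 0 ≤ u'}
    {h' : A.start + (u' : Circ) = B.finish} {hv' : A.len + B.len ≤ u' + 2 * Real.pi} :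
    counterDiag t r u hu h hv = counterDiag t r u' hu' h' hv' := by
  subst e; rfl

theorem diag_add (r s : R) {u : ℝ} (hu : 0 ≤ u) (h : A.start + (u : Circ) = B.start)
    (hv : A.len ≤ u + B.len) :
    diag t (r + s) u hu h hv = diag t r u hu h hv + diag t s u hu h hv := by
  apply FPi.hom_ext; apply hom_ext' <;> simp [add_smul]

theorem counterDiag_add (r s : R) {u : ℝ} (hu : 0 ≤ u) (h : A.start + (u : Circ) = B.finish)
    (hv : A.len + B.len ≤ u + 2 * Real.pi) :
    counterDiag t (r + s) u hu h hv = counterDiag t r u hu h hv + counterDiag t s u hu h hv := by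
  apply FPi.hom_ext; apply hom_ext' <;> simp [add_smul]

theorem diag_one_zero (hu : (0 : ℝ) ≤ 0) (h : A.start + ((0 : ℝ) : Circ) = A.start)
    (hv : A.len ≤ 0 + A.len) : diag t 1 0 hu h hv = 𝟙 (E t A) := by
  apply FPi.hom_ext; apply hom_ext'
  · rw [i₀_diag, star_zero rfl]; simp
  · rw [i₁_diag, star_zero (by ring)]; simp

/-- The computation common to the four composition formulas below: on each generator scalars
multiply and angles add. -/
theorem smul_star_comp_smul_star (r s : R) {x y z : Circ} {α β γ : ℝ} {hα : 0 ≤ α} {hβ : 0 ≤ β}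
    {hγ : 0 ≤ γ} {hxy : x + (α : Circ) = y} {hyz : y + (β : Circ) = z} {hxz : x + (γ : Circ) = z}
    (e : α + β = γ) {V W : PS1 t} {i : P t y ⟶ V} {j : P t z ⟶ W} {k : V ⟶ W}
    (hk : i ≫ k = s • star t β hβ hyz ≫ j) :
    (r • star t α hα hxy ≫ i) ≫ k = (r * s) • star t γ hγ hxz ≫ j := by
  subst e
  rw [Linear.smul_comp, Category.assoc, hk, Linear.comp_smul, star_trans_assoc, smul_smul]

theorem diag_comp_diag (r s : R) {u v w : ℝ} {hu : 0 ≤ u} {h : A.start + (u : Circ) = B.start}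
    {hu' : A.len ≤ u + B.len} {hv : 0 ≤ v} {h' : B.start + (v : Circ) = C.start}
    {hv' : B.len ≤ v + C.len} {hw : 0 ≤ w} {h'' : A.start + (w : Circ) = C.start}
    {hw' : A.len ≤ w + C.len} (e : u + v = w) :
    diag t r u hu h hu' ≫ diag t s v hv h' hv' = diag t (r * s) w hw h'' hw' := by
  apply FPi.hom_ext; apply hom_ext'
  · rw [comp_f, ← Category.assoc, i₀_diag, i₀_diag]
    exact smul_star_comp_smul_star r s e (i₀_diag _ _ _ _)
  · rw [comp_f, ← Category.assoc, i₁_diag, i₁_diag]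
    exact smul_star_comp_smul_star r s (by rw [← e]; ring) (i₁_diag _ _ _ _)

theorem diag_comp_counterDiag (r s : R) {u v w : ℝ} {hu : 0 ≤ u}
    {h : A.start + (u : Circ) = B.start} {hu' : A.len ≤ u + B.len} {hv : 0 ≤ v}
    {h' : B.start + (v : Circ) = C.finish} {hv' : B.len + C.len ≤ v + 2 * Real.pi} {hw : 0 ≤ w}
    {h'' : A.start + (w : Circ) = C.finish} {hw' : A.len + C.len ≤ w + 2 * Real.pi}
    (e : u + v = w) :
    diag t r u hu h hu' ≫ counterDiag t s v hv h' hv' = counterDiag t (r * s) w hw h'' hw' := by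
  apply FPi.hom_ext; apply hom_ext'
  · rw [comp_f, ← Category.assoc, i₀_diag, i₀_counterDiag]
    exact smul_star_comp_smul_star r s e (i₀_counterDiag _ _ _ _)
  · rw [comp_f, ← Category.assoc, i₁_diag, i₁_counterDiag]
    exact smul_star_comp_smul_star r s (by rw [← e]; ring) (i₁_counterDiag _ _ _ _)

/-- The first map sends `e_{x₀}` into the second summand, where the diagonal map turns by `v + C.len
- B.len` and not by `v`; this explains the form of `e`. -/
theorem counterDiag_comp_diag (r s : R) {u v w : ℝ} {hu : 0 ≤ u}
    {h : A.start + (u : Circ) = B.finish} {hu' : A.len + B.len ≤ u + 2 * Real.pi} {hv : 0 ≤ v}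
    {h' : B.start + (v : Circ) = C.start} {hv' : B.len ≤ v + C.len} {hw : 0 ≤ w}
    {h'' : A.start + (w : Circ) = C.finish} {hw' : A.len + C.len ≤ w + 2 * Real.pi}
    (e : u + (v + C.len - B.len) = w) :
    counterDiag t r u hu h hu' ≫ diag t s v hv h' hv' = counterDiag t (r * s) w hw h'' hw' := by
  apply FPi.hom_ext; apply hom_ext'
  · rw [comp_f, ← Category.assoc, i₀_counterDiag, i₀_counterDiag]
    exact smul_star_comp_smul_star r s e (i₁_diag _ _ _ _)
  · rw [comp_f, ← Category.assoc, i₁_counterDiag, i₁_counterDiag]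
    exact smul_star_comp_smul_star r s (by rw [← e]; ring) (i₀_diag _ _ _ _)

theorem counterDiag_comp_counterDiag (r s : R) {u v w : ℝ} {hu : 0 ≤ u}
    {h : A.start + (u : Circ) = B.finish} {hu' : A.len + B.len ≤ u + 2 * Real.pi} {hv : 0 ≤ v}
    {h' : B.start + (v : Circ) = C.finish} {hv' : B.len + C.len ≤ v + 2 * Real.pi} {hw : 0 ≤ w}
    {h'' : A.start + (w : Circ) = C.start} {hw' : A.len ≤ w + C.len}
    (e : u + (v - C.len + 2 * Real.pi - B.len) = w) :
    counterDiag t r u hu h hu' ≫ counterDiag t s v hv h' hv' = diag t (r * s) w hw h'' hw' := by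
  apply FPi.hom_ext; apply hom_ext'
  · rw [comp_f, ← Category.assoc, i₀_counterDiag, i₀_diag]
    exact smul_star_comp_smul_star r s e (i₁_counterDiag _ _ _ _)
  · rw [comp_f, ← Category.assoc, i₁_counterDiag, i₁_diag]
    exact smul_star_comp_smul_star r s (by rw [← e]; ring) (i₀_counterDiag _ _ _ _)

end Components

end FPi

/-! ### Which multiples of diagonal maps are null-homotopic -/

namespace FPi

open PS1 E

section Homotopy

variable {R : Type u} [CommRing R] {t : R} {A B : Arc}

/-- This is the case `x₁ ≤ y₀`: the homotopy sends `e_{x₁}` to `r e_{y₀}^(y₀-x₁)` and `e_{x₀}` to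
`0`. -/
theorem Null.diag_of_len_le (r : R) {u : ℝ} (hu : 0 ≤ u) (h : A.start + (u : Circ) = B.start)
    (hv : A.len ≤ u + B.len) (hA : A.len ≤ u) : Null (diag t r u hu h hv) := by
  have h' : A.finish + ((u - A.len : ℝ) : Circ) = B.start := by
    rw [Arc.finish, ← h, AddCircle.coe_sub]; abel
  refine ⟨p₁ t A ≫ (r • star t (u - A.len) (by linarith) h') ≫ i₀ t B, ?_⟩
  apply hom_ext'
  · simp only [i₀_diag, Preadditive.comp_add, Category.assoc, i₀_p₁_assoc, zero_add]
    rw [assoc_of i₀_d, Category.assoc, i₁_p₁_assoc, Linear.smul_comp, Linear.comp_smul,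
      star_trans_assoc]
    exact congrArg (r • · ≫ i₀ t B) (star_congr (by ring))
  · simp only [i₁_diag, Preadditive.comp_add, Category.assoc, i₁_p₁_assoc, Linear.smul_comp, i₀_d]
    rw [assoc_of i₁_d, Category.assoc, i₀_p₁_assoc, comp_zero, star_trans_assoc]
    refine Eq.trans ?_ (add_zero _).symm
    exact congrArg (r • · ≫ i₁ t B) (star_congr (by ring))

/-- This is the case `x₀ + 2π ≤ y₁`: the homotopy sends `e_{x₀}` to `r e_{y₁}^(y₁-x₀-2π)` and
`e_{x₁}` to `0`. -/
theorem Null.diag_of_le_add_len (r : R) {u : ℝ} (hu : 0 ≤ u) (h : A.start + (u : Circ) = B.start)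
    (hv : A.len ≤ u + B.len) (hB : 2 * Real.pi ≤ u + B.len) : Null (diag t r u hu h hv) := by
  have h' : A.start + ((u + B.len - 2 * Real.pi : ℝ) : Circ) = B.finish := by
    rw [Arc.finish, ← h, AddCircle.coe_sub, AddCircle.coe_add, AddCircle.coe_period]; abel
  refine ⟨p₀ t A ≫ (r • star t (u + B.len - 2 * Real.pi) (by linarith) h') ≫ i₁ t B, ?_⟩
  apply hom_ext'
  · simp only [i₀_diag, Preadditive.comp_add, Category.assoc, i₀_p₀_assoc, Linear.smul_comp, i₁_d]
    rw [assoc_of i₀_d, Category.assoc, i₁_p₀_assoc, comp_zero, add_zero, star_trans_assoc]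
    exact congrArg (r • · ≫ i₀ t B) (star_congr (by ring))
  · simp only [i₁_diag, Preadditive.comp_add, Category.assoc, i₁_p₀_assoc, zero_add]
    rw [assoc_of i₁_d, Category.assoc, i₀_p₀_assoc, Linear.smul_comp, Linear.comp_smul,
      star_trans_assoc]
    exact congrArg (r • · ≫ i₁ t B) (star_congr (by ring))

theorem star_add_two_pi {x y : Circ} {α : ℝ} (hα : 0 ≤ α) (h : x + (α : Circ) = y)
    (hα' : 0 ≤ α + 2 * Real.pi) (h' : x + ((α + 2 * Real.pi : ℝ) : Circ) = y) :
    star t (α + 2 * Real.pi) hα' h' = t • star t α hα h := by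
  have hy : y + ((2 * Real.pi : ℝ) : Circ) = y := by simp
  rw [← star_comp t hα Real.two_pi_pos.le h hy, star_two_pi t _ hy rfl, Linear.comp_smul,
    Category.comp_id]

/-- A factor `t` is the same as an additional full turn, and a full turn brings the map into the
case `x₁ ≤ y₀`. -/
theorem Null.diag_mul (r : R) {u : ℝ} (hu : 0 ≤ u) (h : A.start + (u : Circ) = B.start)
    (hv : A.len ≤ u + B.len) : Null (diag t (r * t) u hu h hv) := by
  have hp := Real.two_pi_pos
  have h' : A.start + ((u + 2 * Real.pi : ℝ) : Circ) = B.start := by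
    rw [AddCircle.coe_add, AddCircle.coe_period, add_zero, h]
  have e : diag t (r * t) u hu h hv =
      diag t r (u + 2 * Real.pi) (by linarith) h' (by linarith) := by
    apply FPi.hom_ext; apply hom_ext'
    · rw [i₀_diag, i₀_diag, star_add_two_pi hu h, Linear.smul_comp, smul_smul]
    · rw [i₁_diag, i₁_diag, star_congr (show u + 2 * Real.pi + B.len - A.len =
        u + B.len - A.len + 2 * Real.pi by ring) (hβ := by linarith)
        (h' := by rw [AddCircle.coe_add, AddCircle.coe_period, add_zero, diag_finish h]),
        star_add_two_pi (by linarith) (diag_finish h), Linear.smul_comp, smul_smul]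
  rw [e]
  exact Null.diag_of_len_le _ _ _ _ (by linarith [A.le])

/-- Compare the components `P_[x₀] ⟶ P_[y₀]`. Since `d` exchanges the summands, only the
off-diagonal components of the homotopy enter. By `hA` and `hB` their shortest angles are `u + 2π -
A.len` and `u + B.len`, and after composition with `d` both become `u + 2π`. So each contributes a
multiple of `t` times the rotation by `u`. -/
theorem dvd_of_null_diag [IsDomain R] (ht : t ≠ 0) {r : R} {u : ℝ} {hu : 0 ≤ u}
    {h : A.start + (u : Circ) = B.start} {hv : A.len ≤ u + B.len} (hA : u < A.len)
    (hB : u + B.len < 2 * Real.pi) (hn : Null (diag t r u hu h hv)) : t ∣ r := by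
  obtain ⟨s, hs⟩ := hn
  have hA' := A.le
  have hB' := B.nonneg
  have h1 : A.start + ((u + B.len : ℝ) : Circ) = B.finish := by
    rw [Arc.finish, ← h, AddCircle.coe_add]; abel
  have h2 : A.finish + ((u + 2 * Real.pi - A.len : ℝ) : Circ) = B.start := by
    rw [Arc.finish, ← h]
    simp only [AddCircle.coe_sub, AddCircle.coe_add, AddCircle.coe_period]; abel
  have h3 : A.start + ((u + 2 * Real.pi : ℝ) : Circ) = B.start := by
    rw [AddCircle.coe_add, AddCircle.coe_period, add_zero, h]
  obtain ⟨k, hk⟩ := exists_eq_smul_star (i₀ t A ≫ s ≫ p₁ t B) (by linarith) hB h1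
  obtain ⟨l, hl⟩ := exists_eq_smul_star (i₁ t A ≫ s ≫ p₀ t B) (by linarith) (by linarith) h2
  have e := congrArg (fun k => i₀ t A ≫ k ≫ p₀ t B) hs
  simp only [Preadditive.comp_add, Preadditive.add_comp, Category.assoc, d_p₀] at e
  rw [assoc_of (i₀_diag r hu h hv), Linear.smul_comp, Category.assoc, i₀_p₀, Category.comp_id,
    assoc_of i₀_d, Category.assoc, hl, ← Category.assoc s, ← Category.assoc, hk,
    Linear.smul_comp, Linear.comp_smul, star_trans, star_trans,
    star_congr (show u + B.len + (2 * Real.pi - B.len) = u + 2 * Real.pi by ring)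
      (hβ := by linarith) (h' := h3),
    star_congr (show A.len + (u + 2 * Real.pi - A.len) = u + 2 * Real.pi by ring)
      (hβ := by linarith) (h' := h3), star_add_two_pi hu h, ← add_smul, smul_smul] at e
  exact ⟨k + l, (smul_star_inj ht e).trans (mul_comm _ _)⟩

/-- With respect to the shortest rotations, the scalars of `k` and `k'` may differ by a power of
`t`. The remedy is to keep the shortest rotation on the side whose composite is longer and to give
the other side the complementary angle; cancellation then forces the same scalar. -/
theorem exists_common_star [IsDomain R] (ht : t ≠ 0) {x x' y y' : Circ} {a b : ℝ} {ha : 0 ≤ a}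
    {hb : 0 ≤ b} {hx : x + (a : Circ) = x'} {hy : y + (b : Circ) = y'} {k : P t x ⟶ P t y}
    {k' : P t x' ⟶ P t y'} (e : star t a ha hx ≫ k' = k ≫ star t b hb hy) :
    ∃ (r : R) (u v : ℝ) (hu : 0 ≤ u) (hv : 0 ≤ v) (h : x + (u : Circ) = y)
      (h' : x' + (v : Circ) = y'), a + v = u + b ∧ (u < 2 * Real.pi ∨ v < 2 * Real.pi) ∧
      k = r • star t u hu h ∧ k' = r • star t v hv h' := by
  have d1 : x + (dep y x : Circ) = y := by rw [coe_dep]; abel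
  have d2 : x' + (dep y' x' : Circ) = y' := by rw [coe_dep]; abel
  have n1 := dep_nonneg y x
  have n2 := dep_nonneg y' x'
  obtain ⟨r, hr⟩ := exists_eq_smul_star k n1 (dep_lt y x) d1
  obtain ⟨r', hr'⟩ := exists_eq_smul_star k' n2 (dep_lt y' x') d2
  rcases le_total (dep y x + b) (a + dep y' x') with hle | hle
  · have h : x + ((a + dep y' x' - b : ℝ) : Circ) = y := by
      rw [AddCircle.coe_sub, AddCircle.coe_add, ← add_sub_assoc, ← add_assoc, hx, d2, ← hy]; abel
    refine ⟨r', a + dep y' x' - b, dep y' x', by linarith, n2, h, d2, by ring,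
      Or.inr (dep_lt _ _), ?_, hr'⟩
    apply star_cancel_right ht
    rw [← e, hr', Linear.comp_smul, Linear.smul_comp, star_trans, star_trans]
    exact congrArg (r' • ·) (star_congr (by ring))
  · have h : x' + ((dep y x + b - a : ℝ) : Circ) = y' := by
      rw [AddCircle.coe_sub, AddCircle.coe_add, ← hx, ← hy, ← d1]
      simp only [coe_dep]
      abel
    refine ⟨r, dep y x, dep y x + b - a, n1, by linarith, d1, h, by ring,
      Or.inl (dep_lt _ _), hr, ?_⟩
    apply star_cancel_left ht
    rw [e, hr, Linear.comp_smul, Linear.smul_comp, star_trans, star_trans]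
    exact congrArg (r • ·) (star_congr (by ring))

/-- Every morphism `E(A) ⟶ E(B)` is the sum of multiples of a diagonal and of a counter-diagonal
morphism, neither of which involves a superfluous full turn. -/
theorem exists_eq_diag_add_counterDiag [IsDomain R] (ht : t ≠ 0) (f : E t A ⟶ E t B) :
    ∃ (r : R) (u : ℝ) (hu : 0 ≤ u) (h : A.start + (u : Circ) = B.start) (hv : A.len ≤ u + B.len)
      (r' : R) (u' : ℝ) (hu' : 0 ≤ u') (h' : A.start + (u' : Circ) = B.finish)
      (hv' : A.len + B.len ≤ u' + 2 * Real.pi),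
      (u < 2 * Real.pi ∨ u + B.len - A.len < 2 * Real.pi) ∧
      (u' < 2 * Real.pi ∨ u' - B.len + 2 * Real.pi - A.len < 2 * Real.pi) ∧
      f = diag t r u hu h hv + counterDiag t r' u' hu' h' hv' := by
  -- Commutation with `d` couples the four components of `f` in two pairs: `c1` the two diagonal
  -- ones and `c2` the two counter-diagonal ones.
  have c1 := congrArg (fun k => i₀ t A ≫ k ≫ p₁ t B) f.comm
  have c2 := congrArg (fun k => i₀ t A ≫ k ≫ p₀ t B) f.comm
  simp only [Category.assoc, d_p₁, d_p₀] at c1 c2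
  rw [assoc_of i₀_d, Category.assoc, ← Category.assoc f.f, ← Category.assoc (i₀ t A)] at c1 c2
  obtain ⟨r, u, v, hu, hv, h, k, e, hb, h0, h1⟩ := exists_common_star ht c1
  obtain ⟨r', u', v', hu', hv', h', k', e', hb', h0', h1'⟩ := exists_common_star ht c2
  obtain rfl : v = u + B.len - A.len := by linarith
  obtain rfl : v' = u' - B.len + 2 * Real.pi - A.len := by linarith
  refine ⟨r, u, hu, h, by linarith, r', u', hu', h', by linarith, hb, hb', ?_⟩
  have hf : f.f = (f.f ≫ p₀ t B) ≫ i₀ t B + (f.f ≫ p₁ t B) ≫ i₁ t B := by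
    rw [Category.assoc, Category.assoc, ← Preadditive.comp_add, E.total, Category.comp_id]
  apply FPi.hom_ext; apply hom_ext'
  · rw [hf, Preadditive.comp_add, assoc_of h0, assoc_of h0']
    simp
  · rw [hf, Preadditive.comp_add, assoc_of h1, assoc_of h1']
    rw [add_f, Preadditive.comp_add, i₁_diag, i₁_counterDiag, Linear.smul_comp, Linear.smul_comp]
    exact add_comm _ _

end Homotopy

end FPi

/-! ### Linked pairs in terms of arcs and angles -/

namespace IndC

variable {K : Type*} {X Y : IndC K}

theorem arc_len_pos (X : IndC K) : 0 < X.arc.len :=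
  lt_of_le_of_ne X.arc.nonneg fun e => X.ne (by
    have := X.arc_finish
    rw [Arc.finish, ← e, AddCircle.coe_zero, add_zero] at this
    exact this)

theorem swap_arc_len (X : IndC K) : X.swap.arc.len = 2 * Real.pi - X.arc.len := by
  linarith [X.arc_len_add]

theorem arc_len_lt (X : IndC K) : X.arc.len < 2 * Real.pi := by
  linarith [X.swap.arc_len_pos, X.swap_arc_len]

theorem swap_arc_start (X : IndC K) : X.swap.arc.start = X.arc.finish := X.arc_finish.symm

theorem swap_arc_finish (X : IndC K) : X.swap.arc.finish = X.arc.start := X.swap.arc_finish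

theorem start_add_dep (X Y : IndC K) :
    X.arc.start + (dep Y.fst X.fst : Circ) = Y.arc.start := by
  rw [coe_dep]; simp [arc]

theorem start_add_dep' (X Y : IndC K) :
    X.arc.start + (dep Y.snd X.fst : Circ) = Y.arc.finish := by
  rw [coe_dep, arc_finish]; simp [arc]

theorem Linked.dep_bounds (h : Linked X Y) :
    dep Y.fst X.fst < X.arc.len ∧ dep Y.fst X.fst + Y.arc.len < 2 * Real.pi := by
  obtain ⟨x₀, x₁, y₀, y₁, a, b, c, d, h1, h2, h3, h4⟩ := h
  have e1 : X.arc.len = x₁ - x₀ :=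
    dep_eq (by linarith) (by linarith) (by rw [AddCircle.coe_sub, a, b])
  have e2 : Y.arc.len = y₁ - y₀ :=
    dep_eq (by linarith) (by linarith) (by rw [AddCircle.coe_sub, c, d])
  have e3 : dep Y.fst X.fst = y₀ - x₀ :=
    dep_eq (by linarith) (by linarith) (by rw [AddCircle.coe_sub, c, a])
  exact ⟨by linarith, by linarith⟩

theorem CounterLinked.dep_bounds (h : CounterLinked X Y) :
    dep Y.snd X.fst < X.arc.len ∧ dep Y.snd X.fst < Y.arc.len := by
  have := (counterLinked_iff.1 h).dep_bounds
  rw [swap_arc_len] at this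
  exact ⟨this.1, by have := this.2; change dep Y.snd X.fst + _ < _ at this; linarith⟩

/-- `hX` and `hY` exclude exactly the two cases in which a diagonal map was shown to be
null-homotopic. -/
theorem linked_of_lt {u : ℝ} (hu : 0 ≤ u) (h : X.arc.start + (u : Circ) = Y.arc.start)
    (hv : X.arc.len ≤ u + Y.arc.len) (hX : u < X.arc.len) (hY : u + Y.arc.len < 2 * Real.pi) :
    Linked X Y := by
  obtain ⟨x, hx⟩ : ∃ x : ℝ, (x : Circ) = X.fst := ⟨_, AddCircle.coe_equivIco (a := 0)⟩
  refine ⟨x, x + X.arc.len, x + u, x + u + Y.arc.len, hx, ?_, ?_, ?_, by linarith, by linarith,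
    by linarith, by linarith⟩
  · rw [AddCircle.coe_add, hx, ← X.arc_finish]; rfl
  · rw [AddCircle.coe_add, hx]; exact h
  · rw [AddCircle.coe_add, AddCircle.coe_add, hx, ← Y.arc_finish, Arc.finish, ← h]; rfl

end IndC

/-! ### Basic morphisms up to homotopy -/

namespace FPi

open PS1 E IndC

section Basic

variable {R : Type u} [CommRing R] {t : R} {K : Type*} {X Y Z : IndC K}

theorem Null.diag_of_not_linked (hl : ¬ Linked X Y) (r : R) {u : ℝ} (hu : 0 ≤ u)
    (h : X.arc.start + (u : Circ) = Y.arc.start) (hv : X.arc.len ≤ u + Y.arc.len) :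
    Null (diag t r u hu h hv) := by
  by_cases hX : X.arc.len ≤ u
  · exact Null.diag_of_len_le r hu h hv hX
  by_cases hY : 2 * Real.pi ≤ u + Y.arc.len
  · exact Null.diag_of_le_add_len r hu h hv hY
  exact absurd (linked_of_lt hu h hv (not_le.1 hX) (not_le.1 hY)) hl

/-- Exchanging the two summands identifies `E(y₁, y₀ + 2π)` with `E(y₀, y₁)` and turns diagonal maps
into counter-diagonal ones. Statements about null-homotopy need therefore be proved for diagonal
maps only. -/
theorem counterDiag_eq (r : R) {u : ℝ} (hu : 0 ≤ u) (h : X.arc.start + (u : Circ) = Y.arc.finish)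
    (hv : X.arc.len + Y.arc.len ≤ u + 2 * Real.pi) :
    counterDiag t r u hu h hv =
      diag t r u hu (h.trans Y.swap_arc_start.symm) (by rw [swap_arc_len]; linarith) ≫
        counterDiag t 1 0 le_rfl (by rw [Y.swap_arc_start, AddCircle.coe_zero, add_zero])
          (by rw [swap_arc_len]; linarith) := by
  rw [diag_comp_counterDiag (w := u) r 1 (add_zero u) (hw := hu) (h'' := h) (hw' := hv), mul_one]

theorem diag_swap_eq (r : R) {u : ℝ} (hu : 0 ≤ u) (h : X.arc.start + (u : Circ) = Y.arc.finish)
    (hv : X.arc.len + Y.arc.len ≤ u + 2 * Real.pi) :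
    diag t r u hu (h.trans Y.swap_arc_start.symm) (by rw [swap_arc_len]; linarith) =
      counterDiag t r u hu h hv ≫
        counterDiag t 1 0 le_rfl (by rw [Y.swap_arc_finish, AddCircle.coe_zero, add_zero])
          (by rw [swap_arc_len]; linarith) := by
  rw [counterDiag_comp_counterDiag (w := u) r 1 (by rw [swap_arc_len]; ring) (hw := hu)
    (h'' := h.trans Y.swap_arc_start.symm) (hw' := by rw [swap_arc_len]; linarith), mul_one]

theorem Null.counterDiag_of_not_linked (hl : ¬ CounterLinked X Y) (r : R) {u : ℝ} (hu : 0 ≤ u)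
    (h : X.arc.start + (u : Circ) = Y.arc.finish)
    (hv : X.arc.len + Y.arc.len ≤ u + 2 * Real.pi) : Null (counterDiag t r u hu h hv) := by
  rw [counterDiag_eq]
  exact (Null.diag_of_not_linked (fun k => hl (counterLinked_iff.2 k)) _ _ _ _).comp_right _

/-- The angle is determined modulo `2π` by its end points, and `hb` excludes a superfluous turn. The
second alternative of `hb` is admitted because `exists_common_star` may bound only the angle on the
second summand. -/
theorem basic_of_linked (hl : Linked X Y) (r : R) {u : ℝ} (hu : 0 ≤ u)
    (h : X.arc.start + (u : Circ) = Y.arc.start) (hv : X.arc.len ≤ u + Y.arc.len)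
    (hb : u < 2 * Real.pi ∨ u + Y.arc.len - X.arc.len < 2 * Real.pi) :
    basic t r X Y = diag t r u hu h hv := by
  rw [basic, dif_pos hl]
  apply diag_congr
  refine Circ.eq_of_close (add_left_cancel (a := X.arc.start) ?_) ?_ ?_
  · rw [start_add_dep, h]
  · linarith [dep_lt Y.fst X.fst]
  · have h1 := dep_nonneg Y.fst X.fst
    have h2 := hl.arc_len_le
    rcases hb with hb | hb <;> linarith

theorem basic_of_counterLinked (hl : CounterLinked X Y) (r : R) {u : ℝ} (hu : 0 ≤ u)
    (h : X.arc.start + (u : Circ) = Y.arc.finish) (hv : X.arc.len + Y.arc.len ≤ u + 2 * Real.pi)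
    (hb : u < 2 * Real.pi ∨ u - Y.arc.len + 2 * Real.pi - X.arc.len < 2 * Real.pi) :
    basic t r X Y = counterDiag t r u hu h hv := by
  rw [basic, dif_neg fun k => not_linked_and_counter k (counterLinked_iff.1 hl), dif_pos hl]
  apply counterDiag_congr
  refine Circ.eq_of_close (add_left_cancel (a := X.arc.start) ?_) ?_ ?_
  · rw [start_add_dep', h]
  · linarith [dep_lt Y.snd X.fst]
  · have h1 := dep_nonneg Y.snd X.fst
    have h2 := hl.arc_len_le
    rcases hb with hb | hb <;> linarith

theorem basic_of_not_linked (hl : ¬ Linked X Y) (hl' : ¬ CounterLinked X Y) (r : R) :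
    basic t r X Y = 0 := by
  rw [basic, dif_neg hl, dif_neg hl']

theorem basic_add (r s : R) : basic t (r + s) X Y = basic t r X Y + basic t s X Y := by
  unfold basic
  split_ifs
  · exact diag_add _ _ _ _ _
  · exact counterDiag_add _ _ _ _ _
  · simp

theorem basic_zero : basic t 0 X Y = 0 := by
  have := basic_add (t := t) (X := X) (Y := Y) 0 0
  simpa using this

theorem basic_sub (r s : R) : basic t (r - s) X Y = basic t r X Y - basic t s X Y := by
  rw [eq_sub_iff_add_eq, ← basic_add, sub_add_cancel]

theorem basic_one : basic t 1 X X = 𝟙 (E t X.arc) := by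
  rw [basic_of_linked (Linked.refl X) 1 le_rfl (by simp) (by simp) (Or.inl Real.two_pi_pos)]
  exact diag_one_zero _ _ _

theorem _root_.IndC.sgn_of_linked (h : Linked X Y) : sgn X Y = 1 := by simp [sgn, h]

theorem _root_.IndC.sgn_of_counterLinked (h : CounterLinked X Y) : sgn X Y = -1 := by
  have : ¬ Linked X Y := fun k => not_linked_and_counter k (counterLinked_iff.1 h)
  simp [sgn, h, this]

theorem _root_.IndC.sgn_eq_one_iff : sgn X Y = 1 ↔ Linked X Y :=
  sgn_eq_iff (s := 1) (by decide)

theorem _root_.IndC.sgn_eq_neg_one_iff : sgn X Y = -1 ↔ CounterLinked X Y := by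
  rw [counterLinked_iff, sgn_eq_iff (s := -1) (by decide)]
  simp [orient]

theorem _root_.IndC.sgn_eq_zero (hl : ¬ Linked X Y) (hl' : ¬ CounterLinked X Y) : sgn X Y = 0 := by
  simp [sgn, hl, hl']

theorem Null.basic_mul (r : R) : Null (basic t (r * t) X Y) := by
  unfold basic
  split_ifs
  · exact Null.diag_mul _ _ _ _
  · rw [counterDiag_eq]
    exact (Null.diag_mul _ _ _ _).comp_right _
  · exact Null.zero _ _

/-- The faithfulness of the comparison with `C_π`: only scalars with residue class zero are lost in
the stable category. -/
theorem dvd_of_null_basic [IsDomain R] (ht : t ≠ 0) {r : R} (h : sgn X Y ≠ 0)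
    (hn : Null (basic t r X Y)) : t ∣ r := by
  by_cases h1 : Linked X Y
  · rw [basic, dif_pos h1] at hn
    exact dvd_of_null_diag ht h1.dep_bounds.1 h1.dep_bounds.2 hn
  by_cases h2 : CounterLinked X Y
  · rw [basic, dif_neg h1, dif_pos h2] at hn
    have hn' := hn.comp_right (counterDiag t 1 0 le_rfl
      (by rw [Y.swap_arc_finish, AddCircle.coe_zero, add_zero]) (by rw [swap_arc_len]; linarith) :
        E t Y.arc ⟶ E t Y.swap.arc)
    rw [← diag_swap_eq] at hn'
    refine dvd_of_null_diag ht h2.dep_bounds.1 ?_ hn'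
    rw [swap_arc_len]
    linarith [h2.dep_bounds.2]
  exact absurd (sgn_eq_zero h1 h2) h

/-- The fullness of the comparison: a pair cannot be linked and counter-linked at once, so at most
one of the diagonal and counter-diagonal parts survives. -/
theorem exists_null_sub_basic [IsDomain R] (ht : t ≠ 0) (f : E t X.arc ⟶ E t Y.arc) :
    ∃ r : R, Null (f - basic t r X Y) := by
  obtain ⟨r, u, hu, h, hv, r', u', hu', h', hv', hb, hb', rfl⟩ :=
    exists_eq_diag_add_counterDiag ht f
  by_cases h1 : Linked X Y
  · have h2 : ¬ CounterLinked X Y := fun k => not_linked_and_counter h1 (counterLinked_iff.1 k)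
    refine ⟨r, ?_⟩
    rw [basic_of_linked h1 r hu h hv hb, add_sub_cancel_left]
    exact Null.counterDiag_of_not_linked h2 _ _ _ _
  by_cases h2 : CounterLinked X Y
  · refine ⟨r', ?_⟩
    rw [basic_of_counterLinked h2 r' hu' h' hv' hb', add_sub_cancel_right]
    exact Null.diag_of_not_linked h1 _ _ _ _
  refine ⟨0, ?_⟩
  rw [basic_zero, sub_zero]
  exact (Null.diag_of_not_linked h1 _ _ _ _).add (Null.counterDiag_of_not_linked h2 _ _ _ _)

/-- A composite of basic maps may be a diagonal map between objects that are no longer linked. It is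
then null-homotopic, which matches the value `0` in the composition rule of `C_π`. -/
theorem null_diag_sub_basic (r : R) {u : ℝ} (hu : 0 ≤ u)
    (h : X.arc.start + (u : Circ) = Y.arc.start) (hv : X.arc.len ≤ u + Y.arc.len)
    (hb : u < 2 * Real.pi) :
    Null (diag t r u hu h hv - basic t (if sgn X Y = 1 then r else 0) X Y) := by
  split_ifs with hl
  · rw [sgn_eq_one_iff] at hl
    rw [basic_of_linked hl r hu h hv (Or.inl hb), sub_self]
    exact Null.zero _ _
  · rw [sgn_eq_one_iff] at hl
    rw [basic_zero, sub_zero]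
    exact Null.diag_of_not_linked hl _ _ _ _

theorem null_counterDiag_sub_basic (r : R) {u : ℝ} (hu : 0 ≤ u)
    (h : X.arc.start + (u : Circ) = Y.arc.finish) (hv : X.arc.len + Y.arc.len ≤ u + 2 * Real.pi)
    (hb : u < 2 * Real.pi) :
    Null (counterDiag t r u hu h hv - basic t (if sgn X Y = -1 then r else 0) X Y) := by
  split_ifs with hl
  · rw [sgn_eq_neg_one_iff] at hl
    rw [basic_of_counterLinked hl r hu h hv (Or.inl hb), sub_self]
    exact Null.zero _ _
  · rw [sgn_eq_neg_one_iff] at hl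
    rw [basic_zero, sub_zero]
    exact Null.counterDiag_of_not_linked hl _ _ _ _

/-- Verifies that composition in `F_π` reproduces the rule of `C_π` up to homotopy, with the same
case distinction as in `IndC.comp`. -/
theorem null_basic_comp_sub (r s : R) :
    Null (basic t r X Y ≫ basic t s Y Z -
      basic t (if sgn X Y * sgn Y Z = sgn X Z then r * s else 0) X Z) := by
  by_cases h0 : sgn X Y * sgn Y Z = 0
  · have e : basic t r X Y ≫ basic t s Y Z = 0 := by
      rcases mul_eq_zero.1 h0 with h | h
      · rw [basic_of_not_linked (r := r), zero_comp] <;> intro k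
        · simp [sgn_of_linked k] at h
        · simp [sgn_of_counterLinked k] at h
      · rw [basic_of_not_linked (r := s), comp_zero] <;> intro k
        · simp [sgn_of_linked k] at h
        · simp [sgn_of_counterLinked k] at h
    -- The condition may hold here with both sides `0`, but then `basic` vanishes for every scalar.
    have e' : basic t (if sgn X Y * sgn Y Z = sgn X Z then r * s else 0) X Z = 0 := by
      split_ifs with k
      · apply basic_of_not_linked <;> intro l
        · rw [h0, sgn_of_linked l] at k; exact absurd k (by decide)
        · rw [h0, sgn_of_counterLinked l] at k; exact absurd k (by decide)
      · exact basic_zero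
    rw [e, e', sub_zero]
    exact Null.zero _ _
  have hY := Y.arc_len_pos
  have hX := X.arc_len_pos
  have hZ := Z.arc_len_pos
  have hY' := Y.arc_len_lt
  have sgn_cases {U V : IndC K} (h : sgn U V ≠ 0) : Linked U V ∨ CounterLinked U V := by
    by_contra! k
    exact h (sgn_eq_zero k.1 k.2)
  rcases sgn_cases (left_ne_zero_of_mul h0) with h1 | h1 <;>
    rcases sgn_cases (right_ne_zero_of_mul h0) with h2 | h2
  -- In all four cases `dep_bounds` keeps the angle of the composite on the first summand below
  -- `2π`, so no factor `t` arises.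
  · rw [sgn_of_linked h1, sgn_of_linked h2, one_mul]
    have := h1.dep_bounds; have := h2.dep_bounds; have := h1.arc_len_le; have := h2.arc_len_le
    have := dep_nonneg Y.fst X.fst; have := dep_nonneg Z.fst Y.fst
    rw [basic, dif_pos h1, basic, dif_pos h2,
      diag_comp_diag r s (w := dep Y.fst X.fst + dep Z.fst Y.fst) rfl (hw := by linarith)
        (h'' := by rw [AddCircle.coe_add, ← add_assoc, start_add_dep, start_add_dep])
        (hw' := by linarith)]
    simp only [eq_comm (a := (1 : SignType))]
    exact null_diag_sub_basic _ _ _ _ (by linarith)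
  · rw [sgn_of_linked h1, sgn_of_counterLinked h2, one_mul]
    have := h1.dep_bounds; have := h2.dep_bounds; have := h1.arc_len_le; have := h2.arc_len_le
    have := dep_nonneg Y.fst X.fst; have := dep_nonneg Z.snd Y.fst
    rw [basic, dif_pos h1, basic_of_counterLinked h2 s (dep_nonneg _ _) (start_add_dep' _ _)
      h2.arc_len_le (Or.inl (dep_lt _ _)),
      diag_comp_counterDiag r s (w := dep Y.fst X.fst + dep Z.snd Y.fst) rfl (hw := by linarith)
        (h'' := by rw [AddCircle.coe_add, ← add_assoc, start_add_dep, start_add_dep'])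
        (hw' := by linarith)]
    simp only [eq_comm (a := (-1 : SignType))]
    exact null_counterDiag_sub_basic _ _ _ _ (by linarith)
  · rw [sgn_of_counterLinked h1, sgn_of_linked h2, mul_one]
    have := h1.dep_bounds; have := h2.dep_bounds; have := h1.arc_len_le; have := h2.arc_len_le
    have := dep_nonneg Y.snd X.fst; have := dep_nonneg Z.fst Y.fst
    rw [basic_of_counterLinked h1 r (dep_nonneg _ _) (start_add_dep' _ _)
      h1.arc_len_le (Or.inl (dep_lt _ _)), basic, dif_pos h2,
      counterDiag_comp_diag r s
        (w := dep Y.snd X.fst + (dep Z.fst Y.fst + Z.arc.len - Y.arc.len)) rfl (hw := by linarith)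
        (h'' := by
          rw [AddCircle.coe_add, ← add_assoc, start_add_dep', diag_finish (start_add_dep _ _)])
        (hw' := by linarith)]
    simp only [eq_comm (a := (-1 : SignType))]
    exact null_counterDiag_sub_basic _ _ _ _ (by linarith)
  · rw [sgn_of_counterLinked h1, sgn_of_counterLinked h2]
    have := h1.dep_bounds; have := h2.dep_bounds; have := h1.arc_len_le; have := h2.arc_len_le
    have := dep_nonneg Y.snd X.fst; have := dep_nonneg Z.snd Y.fst
    rw [basic_of_counterLinked h1 r (dep_nonneg _ _) (start_add_dep' _ _)
      h1.arc_len_le (Or.inl (dep_lt _ _)), basic_of_counterLinked h2 s (dep_nonneg _ _)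
      (start_add_dep' _ _) h2.arc_len_le (Or.inl (dep_lt _ _)),
      counterDiag_comp_counterDiag r s
        (w := dep Y.snd X.fst + (dep Z.snd Y.fst - Z.arc.len + 2 * Real.pi - Y.arc.len)) rfl
        (hw := by linarith)
        (h'' := by
          rw [AddCircle.coe_add, ← add_assoc, start_add_dep',
            counterDiag_finish (start_add_dep' _ _)])
        (hw' := by linarith)]
    simp only [eq_comm (a := (-1 * -1 : SignType))]
    exact null_diag_sub_basic _ _ _ _ (by linarith)

end Basic

end FPi

/-! ### The comparison of `C_π` with the stable category -/

namespace FPi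

open PS1 E IndC

theorem ι_matrix_π {R : Type u} [CommRing R] {t : R} {J J' : Type} [Fintype J] [Fintype J']
    {F : J → FPi t} {G : J' → FPi t}
    (m : ∀ i j, F i ⟶ G j) (i : J) (j : J') :
    biproduct.ι F i ≫ biproduct.matrix m ≫ biproduct.π G j = m i j := by
  simp

section Represents

variable {R : Type u} [CommRing R] [IsDomain R] [IsDiscreteValuationRing R] {t : R}

theorem residue_eq_zero_iff (ht : Irreducible t) {r : R} :
    IsLocalRing.residue R r = 0 ↔ t ∣ r := by
  rw [IsLocalRing.residue_eq_zero_iff, ht.maximalIdeal_eq, Ideal.mem_span_singleton]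

section Entry

variable {X Y Z : IndC (IsLocalRing.ResidueField R)}

/-- A morphism `f` of `F_π` between indecomposables lifts the morphism `k` of `C_π`. -/
def Lifts (f : E t X.arc ⟶ E t Y.arc) (k : X ⟶ Y) : Prop :=
  ∃ r : R, IsLocalRing.residue R r = k.coeff ∧ Null (f - basic t r X Y)

theorem Lifts.basic {r : R} {k : X ⟶ Y} (h : IsLocalRing.residue R r = k.coeff) :
    Lifts (basic t r X Y) k := ⟨r, h, by rw [sub_self]; exact Null.zero _ _⟩

theorem Lifts.zero : Lifts (0 : E t X.arc ⟶ E t Y.arc) 0 :=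
  ⟨0, map_zero _, by rw [basic_zero, sub_zero]; exact Null.zero _ _⟩

theorem Lifts.add {f g : E t X.arc ⟶ E t Y.arc} {k l : X ⟶ Y} :
    Lifts f k → Lifts g l → Lifts (f + g) (k + l) := by
  rintro ⟨r, h, hn⟩ ⟨s, h', hn'⟩
  refine ⟨r + s, by rw [map_add, h, h']; rfl, ?_⟩
  rw [basic_add, add_sub_add_comm]
  exact hn.add hn'

theorem Lifts.sum {ι : Type*} (s : Finset ι) {f : ι → (E t X.arc ⟶ E t Y.arc)} {k : ι → (X ⟶ Y)}
    (h : ∀ i, Lifts (f i) (k i)) : Lifts (∑ i ∈ s, f i) (∑ i ∈ s, k i) := by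
  classical
  induction s using Finset.induction_on with
  | empty => exact Lifts.zero
  | insert i s hi ih =>
    rw [Finset.sum_insert hi, Finset.sum_insert hi]
    exact (h i).add ih

theorem Lifts.id : Lifts (𝟙 (E t X.arc)) (𝟙 X) := by
  rw [← basic_one]
  exact Lifts.basic (map_one _)

theorem Lifts.comp {f : E t X.arc ⟶ E t Y.arc} {g : E t Y.arc ⟶ E t Z.arc} {k : X ⟶ Y}
    {l : Y ⟶ Z} : Lifts f k → Lifts g l → Lifts (f ≫ g) (k ≫ l) := by
  rintro ⟨r, h, hn⟩ ⟨s, h', hn'⟩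
  refine ⟨if sgn X Y * sgn Y Z = sgn X Z then r * s else 0, ?_, ?_⟩
  · change _ = if sgn X Y * sgn Y Z = sgn X Z then k.coeff * l.coeff else 0
    rw [← h, ← h']
    split_ifs <;> simp
  · have e : f ≫ g = (f - FPi.basic t r X Y) ≫ g +
        FPi.basic t r X Y ≫ (g - FPi.basic t s Y Z) +
        FPi.basic t r X Y ≫ FPi.basic t s Y Z := by
      rw [Preadditive.sub_comp, Preadditive.comp_sub]; abel
    rw [e, add_sub_assoc]
    exact ((hn.comp_right _).add (hn'.comp_left _)).add (null_basic_comp_sub r s)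

/-- The scalars of two liftings of the same entry differ by a multiple of `t`, and such multiples of
basic maps are null-homotopic. -/
theorem Lifts.null_sub (ht : Irreducible t) {f g : E t X.arc ⟶ E t Y.arc} {k : X ⟶ Y} :
    Lifts f k → Lifts g k → Null (f - g) := by
  rintro ⟨r, h, hn⟩ ⟨s, h', hn'⟩
  obtain ⟨c, hc⟩ := (residue_eq_zero_iff ht).1
    (show IsLocalRing.residue R (r - s) = 0 by rw [map_sub, h, h', sub_self])
  have e : f - g = (f - FPi.basic t r X Y) - (g - FPi.basic t s X Y) +
      FPi.basic t (c * t) X Y := by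
    rw [mul_comm, ← hc, basic_sub]; abel
  rw [e]
  exact (hn.sub hn').add (Null.basic_mul c)

theorem Lifts.unique (ht : Irreducible t) {f g : E t X.arc ⟶ E t Y.arc} {k l : X ⟶ Y}
    (hfg : Null (f - g)) : Lifts f k → Lifts g l → k = l := by
  rintro ⟨r, h, hn⟩ ⟨s, h', hn'⟩
  apply IndC.hom_ext
  by_cases hs : sgn X Y = 0
  · rw [k.zero hs, l.zero hs]
  · rw [← h, ← h', ← sub_eq_zero, ← map_sub, residue_eq_zero_iff ht]
    refine dvd_of_null_basic ht.ne_zero hs ?_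
    have e : FPi.basic t (r - s) X Y = (f - g) - (f - FPi.basic t r X Y) +
        (g - FPi.basic t s X Y) := by
      rw [basic_sub]; abel
    rw [e]
    exact (hfg.sub hn).add hn'

theorem exists_lifts (ht : Irreducible t) (f : E t X.arc ⟶ E t Y.arc) :
    ∃ k : X ⟶ Y, Lifts f k := by
  obtain ⟨r, hr⟩ := exists_null_sub_basic ht.ne_zero f
  by_cases hs : sgn X Y = 0
  -- Without a basic morphism `r` carries no information: `basic` is zero for all scalars, so `0`
  -- may replace it.
  · refine ⟨0, 0, map_zero _, ?_⟩
    have e (s : R) : FPi.basic t s X Y = 0 := by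
      apply basic_of_not_linked <;> intro k
      · simp [sgn_of_linked k] at hs
      · simp [sgn_of_counterLinked k] at hs
    rwa [e] at hr ⊢
  · exact ⟨⟨IsLocalRing.residue R r, fun h => absurd h hs⟩, r, rfl, hr⟩

end Entry

section Matrices

variable {X Y Z : CPi (IsLocalRing.ResidueField R)}

/-- The inclusion of a summand. -/
noncomputable def inj (t : R) (X : CPi (IsLocalRing.ResidueField R)) (i : X.ι) : E t (X.X i).arc ⟶ ofCPi t X :=
  biproduct.ι (fun i => E t (X.X i).arc) i

/-- The projection to a summand. -/
noncomputable def proj (t : R) (X : CPi (IsLocalRing.ResidueField R)) (i : X.ι) : ofCPi t X ⟶ E t (X.X i).arc :=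
  biproduct.π (fun i => E t (X.X i).arc) i

theorem inj_proj_self (i : X.ι) : inj t X i ≫ proj t X i = 𝟙 _ := biproduct.ι_π_self _ i

theorem inj_proj_of_ne {i j : X.ι} (h : i ≠ j) : inj t X i ≫ proj t X j = 0 :=
  biproduct.ι_π_ne _ h

theorem sum_proj_inj (X : CPi (IsLocalRing.ResidueField R)) : ∑ i, proj t X i ≫ inj t X i = 𝟙 (ofCPi t X) :=
  biproduct.total

theorem represents_iff {f' : ofCPi t X ⟶ ofCPi t Y} {f : X ⟶ Y} :
    Represents t f' f ↔ ∀ i j, Lifts (inj t X i ≫ f' ≫ proj t Y j) (f i j) := by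
  unfold Represents Lifts
  simp only [stab_map_eq_iff]
  exact Iff.rfl

theorem Represents.comp {f' : ofCPi t X ⟶ ofCPi t Y} {f : X ⟶ Y} {g' : ofCPi t Y ⟶ ofCPi t Z}
    {g : Y ⟶ Z} (hf : Represents t f' f) (hg : Represents t g' g) :
    Represents t (f' ≫ g') (f ≫ g) := by
  rw [represents_iff] at *
  intro i k
  have e : inj t X i ≫ (f' ≫ g') ≫ proj t Z k =
      ∑ j, (inj t X i ≫ f' ≫ proj t Y j) ≫ (inj t Y j ≫ g' ≫ proj t Z k) := by
    conv_lhs => rw [← Category.comp_id f', ← sum_proj_inj Y]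
    simp only [Preadditive.comp_sum, Preadditive.sum_comp, Category.assoc]
  rw [e, Mat_.comp_apply]
  exact Lifts.sum _ fun j => (hf i j).comp (hg j k)

theorem Represents.id (X : CPi (IsLocalRing.ResidueField R)) : Represents t (𝟙 (ofCPi t X)) (𝟙 X) := by
  rw [represents_iff]
  intro i j
  rw [Category.id_comp]
  by_cases h : i = j
  · subst h
    rw [inj_proj_self, Mat_.id_apply_self]
    exact Lifts.id
  · rw [inj_proj_of_ne h, Mat_.id_apply_of_ne _ _ _ h]
    exact Lifts.zero

theorem Represents.null_sub (ht : Irreducible t) {f' f'' : ofCPi t X ⟶ ofCPi t Y} {f : X ⟶ Y}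
    (h : Represents t f' f) (h' : Represents t f'' f) : Null (f' - f'') := by
  rw [represents_iff] at *
  have e (k : ofCPi t X ⟶ ofCPi t Y) :
      k = ∑ i, ∑ j, proj t X i ≫ (inj t X i ≫ k ≫ proj t Y j) ≫ inj t Y j := by
    conv_lhs => rw [← Category.comp_id k, ← Category.id_comp k, ← sum_proj_inj X, ← sum_proj_inj Y]
    simp only [Preadditive.comp_sum, Preadditive.sum_comp, Category.assoc]
    exact Finset.sum_comm
  rw [e (f' - f'')]
  refine Null.sum _ fun i _ => Null.sum _ fun j _ => ?_
  refine Null.comp_left _ (Null.comp_right ?_ _)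
  rw [Preadditive.sub_comp, Preadditive.comp_sub]
  exact (h i j).null_sub ht (h' i j)

theorem Represents.stab_eq (ht : Irreducible t) {f' f'' : ofCPi t X ⟶ ofCPi t Y} {f : X ⟶ Y}
    (h : Represents t f' f) (h' : Represents t f'' f) : (stab t).map f' = (stab t).map f'' :=
  stab_map_eq_iff.2 (h.null_sub ht h')

/-- Together with `exists_represents` and `exists_representative` this makes `ofCPi` fully faithful
into the stable category. -/
theorem Represents.unique (ht : Irreducible t) {f' g' : ofCPi t X ⟶ ofCPi t Y} {f g : X ⟶ Y}
    (hf : Represents t f' f) (hg : Represents t g' g)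
    (h : (stab t).map f' = (stab t).map g') : f = g := by
  rw [represents_iff] at *
  rw [stab_map_eq_iff] at h
  funext i j
  refine Lifts.unique ht ?_ (hf i j) (hg i j)
  rw [← Preadditive.comp_sub, ← Preadditive.sub_comp]
  exact (h.comp_right _).comp_left _

theorem exists_represents (ht : Irreducible t) (f' : ofCPi t X ⟶ ofCPi t Y) :
    ∃ f : X ⟶ Y, Represents t f' f := by
  choose k hk using fun i j => exists_lifts ht (inj t X i ≫ f' ≫ proj t Y j)
  exact ⟨k, represents_iff.2 hk⟩

/-- The morphism with given components. -/
noncomputable def ofMatrix (k : ∀ (i : X.ι) (j : Y.ι), E t (X.X i).arc ⟶ E t (Y.X j).arc) :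
    ofCPi t X ⟶ ofCPi t Y := biproduct.matrix k

theorem inj_ofMatrix_proj (k : ∀ (i : X.ι) (j : Y.ι), E t (X.X i).arc ⟶ E t (Y.X j).arc)
    (i : X.ι) (j : Y.ι) : inj t X i ≫ ofMatrix k ≫ proj t Y j = k i j := by
  exact ι_matrix_π k i j

theorem exists_representative (f : X ⟶ Y) :
    ∃ f' : ofCPi t X ⟶ ofCPi t Y, Represents t f' f := by
  choose r hr using fun i j => IsLocalRing.residue_surjective (f i j).coeff
  refine ⟨ofMatrix fun i j => basic t (r i j) (X.X i) (Y.X j), represents_iff.2 fun i j => ?_⟩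
  rw [inj_ofMatrix_proj]
  exact Lifts.basic (hr i j)

end Matrices

end Represents

end FPi

/-! ### Independence of the distinguished triangles from the choices -/

/-- Changing one of the two given morphisms of a pushout square by a multiple of the other. -/
theorem CategoryTheory.IsPushout.shear {C : Type*} [Category C] [Preadditive C] {X Q Y P : C}
    {i : X ⟶ Q} {f : X ⟶ Y} {u : Q ⟶ P} {m : Y ⟶ P} (h : IsPushout i f u m) {f' : X ⟶ Y}
    {k : Q ⟶ Y} (hk : f - f' = i ≫ k) : IsPushout i f' (u - k ≫ m) m := by
  have hf : f = f' + i ≫ k := by rw [← hk]; abel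
  have w : i ≫ (u - k ≫ m) = f' ≫ m := by
    rw [Preadditive.comp_sub, h.w, hf, Preadditive.add_comp, Category.assoc, add_sub_cancel_right]
  have w' (s : PushoutCocone i f') : i ≫ (s.inl + k ≫ s.inr) = f ≫ s.inr := by
    rw [hf, Preadditive.comp_add, s.condition, Preadditive.add_comp, Category.assoc]
  refine ⟨⟨w⟩, ⟨PushoutCocone.IsColimit.mk w (fun s => h.desc _ _ (w' s)) (fun s => ?_)
    (fun s => h.inr_desc _ _ _) (fun s l h1 h2 => ?_)⟩⟩
  · rw [Preadditive.sub_comp, Category.assoc, h.inl_desc, h.inr_desc, add_sub_cancel_right]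
  · apply h.hom_ext
    · rw [h.inl_desc, ← h1, ← h2, Preadditive.sub_comp, Category.assoc, sub_add_cancel]
    · rw [h.inr_desc, h2]

namespace FPi

open PS1 E IndC

section Extension

variable {R : Type u} [CommRing R] {t : R}

/-- A homotopy is a morphism without compatibility with `d`, so it extends along the retraction `ρ`.
The boundary of the extended homotopy commutes with `d` and restricts to `f`. -/
theorem Null.exists_extension {A B Y : FPi t} {i : A ⟶ B} {ρ : B.V ⟶ A.V} (hρ : i.f ≫ ρ = 𝟙 _)
    {f : A ⟶ Y} (hf : Null f) : ∃ k : B ⟶ Y, f = i ≫ k := by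
  obtain ⟨s, hs⟩ := hf
  refine ⟨⟨(ρ ≫ s) ≫ Y.d + B.d ≫ ρ ≫ s, ?_⟩, hom_ext ?_⟩
  · rw [Preadditive.comp_add, Preadditive.add_comp, Category.assoc _ Y.d Y.d, Y.sq,
      ← Category.assoc B.d B.d, B.sq]
    simp [add_comm]
  · rw [hs, comp_f, Preadditive.comp_add, ← Category.assoc i.f B.d, ← i.comm]
    simp only [Category.assoc, assoc_of hρ, Category.id_comp]

namespace hull

variable (t) {K : Type*} (X : IndC K)

/-- The inclusion of `E(y, y)`. -/
noncomputable def inl : E t X.finishArc ⟶ hull t X :=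
  (biprod.inl : E t X.finishArc ⟶ E t X.finishArc ⊞ E t X.fullArc)
/-- The inclusion of `E(x, x + 2π)`. -/
noncomputable def inr : E t X.fullArc ⟶ hull t X :=
  (biprod.inr : E t X.fullArc ⟶ E t X.finishArc ⊞ E t X.fullArc)
/-- The projection to `E(y, y)`. -/
noncomputable def fst : hull t X ⟶ E t X.finishArc :=
  (biprod.fst : E t X.finishArc ⊞ E t X.fullArc ⟶ E t X.finishArc)
/-- The projection to `E(x, x + 2π)`. -/
noncomputable def snd : hull t X ⟶ E t X.fullArc :=
  (biprod.snd : E t X.finishArc ⊞ E t X.fullArc ⟶ E t X.fullArc)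

theorem inl_fst : inl t X ≫ fst t X = 𝟙 _ := biprod.inl_fst
theorem inl_snd : inl t X ≫ snd t X = 0 := biprod.inl_snd
theorem inr_fst : inr t X ≫ fst t X = 0 := biprod.inr_fst
theorem inr_snd : inr t X ≫ snd t X = 𝟙 _ := biprod.inr_snd
theorem total : fst t X ≫ inl t X + snd t X ≫ inr t X = 𝟙 _ :=
  biprod.total (X := E t X.finishArc) (Y := E t X.fullArc)

variable {t X}

theorem hullIn_fst {hu : 0 ≤ X.arc.len} {h : X.arc.start + (X.arc.len : Circ) = X.finishArc.start}
    {hv : X.arc.len ≤ X.arc.len + X.finishArc.len} :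
    hullIn t X ≫ fst t X = diag t 1 X.arc.len hu h hv :=
  biprod.lift_fst _ _

theorem hullIn_snd {hu : (0 : ℝ) ≤ 0} {h : X.arc.start + ((0 : ℝ) : Circ) = X.fullArc.start}
    {hv : X.arc.len ≤ 0 + X.fullArc.len} :
    hullIn t X ≫ snd t X = diag t (-1) 0 hu h hv :=
  biprod.lift_snd _ _

theorem inl_hullOut {hu : (0 : ℝ) ≤ 0}
    {h : X.finishArc.start + ((0 : ℝ) : Circ) = X.swap.arc.start}
    {hv : X.finishArc.len ≤ 0 + X.swap.arc.len} :
    inl t X ≫ hullOut t X = diag t 1 0 hu h hv :=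
  biprod.inl_desc _ _

theorem inr_hullOut {hu : 0 ≤ X.arc.len}
    {h : X.fullArc.start + (X.arc.len : Circ) = X.swap.arc.start}
    {hv : X.fullArc.len ≤ X.arc.len + X.swap.arc.len} :
    inr t X ≫ hullOut t X = diag t 1 X.arc.len hu h hv :=
  biprod.inr_desc _ _

end hull

/-- For `X = (x, y)`, the generator `e_x` has component `-1` at the first generator of `E(x, x +
2π)`, and `e_y` has component `1` at the second generator of `E(y, y)`, both with angle `0`.
Projecting to these two generators, with the signs corrected, inverts the map. -/
theorem exists_retraction_hullIn {K : Type*} (X : IndC K) :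
    ∃ ρ : (hull t X).V ⟶ (E t X.arc).V, (hullIn t X).f ≫ ρ = 𝟙 _ := by
  have h0 : X.fullArc.start + ((0 : ℝ) : Circ) = X.arc.start := by simp [IndC.arc, IndC.fullArc]
  have h1 : X.finishArc.finish + ((0 : ℝ) : Circ) = X.arc.finish := by
    rw [X.arc_finish]; simp [Arc.finish, IndC.finishArc]
  have h2 : X.arc.start + ((0 : ℝ) : Circ) = X.fullArc.start := by
    simp [IndC.arc, IndC.fullArc]
  have h3 : X.arc.start + (X.arc.len : Circ) = X.finishArc.start := X.arc_finish
  have h4 : X.arc.len ≤ 0 + X.fullArc.len := by simpa [IndC.fullArc] using X.arc.le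
  have h5 : X.arc.len ≤ X.arc.len + X.finishArc.len := by simp [IndC.finishArc]
  have e0 := congrArg Hom.f (hull.hullIn_snd (t := t) (hu := le_rfl) (h := h2) (hv := h4))
  have e1 := congrArg Hom.f (hull.hullIn_fst (t := t) (hu := X.arc.nonneg) (h := h3) (hv := h5))
  refine ⟨-((hull.snd t X).f ≫ p₀ t X.fullArc ≫ star t 0 le_rfl h0 ≫ i₀ t X.arc) +
    (hull.fst t X).f ≫ p₁ t X.finishArc ≫ star t 0 le_rfl h1 ≫ i₁ t X.arc, ?_⟩
  rw [comp_f] at e0 e1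
  rw [Preadditive.comp_add, Preadditive.comp_neg, assoc_of e0, assoc_of e1]
  apply hom_ext'
  · rw [Preadditive.comp_add, Preadditive.comp_neg, assoc_of (i₀_diag _ _ _ _),
      assoc_of (i₀_diag _ _ _ _)]
    simp only [Linear.smul_comp, Category.assoc, i₀_p₀_assoc, i₀_p₁_assoc, star_trans_assoc]
    rw [PS1.star_zero (by ring)]
    simp
  · rw [Preadditive.comp_add, Preadditive.comp_neg, assoc_of (i₁_diag _ _ _ _),
      assoc_of (i₁_diag _ _ _ _)]
    simp only [Linear.smul_comp, Category.assoc, i₁_p₀_assoc, i₁_p₁_assoc, star_trans_assoc]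
    rw [PS1.star_zero (by simp [IndC.finishArc])]
    simp

end Extension

section Standard

variable {R : Type u} [CommRing R] [IsDomain R] [IsDiscreteValuationRing R] {t : R}
  {X Y Z Z₀ : CPi (IsLocalRing.ResidueField R)}

theorem exists_retraction_sumHullIn (t : R) (X : CPi (IsLocalRing.ResidueField R)) :
    ∃ ρ : (sumHull t X).V ⟶ (ofCPi t X).V, (sumHullIn t X).f ≫ ρ = 𝟙 _ := by
  choose ρ hρ using fun i => exists_retraction_hullIn (t := t) (X.X i)
  have e (i : X.ι) : (sumHullIn t X).f ≫ (biproduct.π (fun i => hull t (X.X i)) i).f =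
      (proj t X i).f ≫ (hullIn t (X.X i)).f :=
    congrArg Hom.f (biproduct.map_π (fun i => hullIn t (X.X i)) i)
  refine ⟨∑ i, (biproduct.π (fun i => hull t (X.X i)) i).f ≫ ρ i ≫ (inj t X i).f, ?_⟩
  rw [Preadditive.comp_sum]
  have e' (i : X.ι) : (sumHullIn t X).f ≫ (biproduct.π (fun i => hull t (X.X i)) i).f ≫ ρ i ≫
      (inj t X i).f = (proj t X i ≫ inj t X i).f := by
    rw [assoc_of (e i), Category.assoc, assoc_of (hρ i), Category.id_comp, comp_f]
  rw [Finset.sum_congr rfl fun i _ => e' i, ← sum_f, sum_proj_inj, id_f]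

/-- An isomorphism in the stable category comes from an isomorphism of `C_π`. -/
theorem exists_iso_represents (ht : Irreducible t)
    (φ : (stab t).obj (ofCPi t Y) ≅ (stab t).obj (ofCPi t Z)) :
    ∃ (α : Y ≅ Z) (a : ofCPi t Y ⟶ ofCPi t Z), Represents t a α.hom ∧
      (stab t).map a = φ.hom := by
  obtain ⟨a, ha⟩ := (stab t).map_surjective φ.hom
  obtain ⟨b, hb⟩ := (stab t).map_surjective φ.inv
  obtain ⟨α, hα⟩ := exists_represents ht a
  obtain ⟨β, hβ⟩ := exists_represents ht b
  refine ⟨⟨α, β, ?_, ?_⟩, a, hα, ha⟩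
  · refine (hα.comp hβ).unique ht (Represents.id _) ?_
    rw [Functor.map_comp, ha, hb, φ.hom_inv_id, CategoryTheory.Functor.map_id]
  · refine (hβ.comp hα).unique ht (Represents.id _) ?_
    rw [Functor.map_comp, ha, hb, φ.inv_hom_id, CategoryTheory.Functor.map_id]

/-- Conversely, an isomorphism of `C_π` gives one of the stable category. -/
theorem exists_stable_iso (ht : Irreducible t) (α : Y ≅ Z) :
    ∃ (φ : (stab t).obj (ofCPi t Y) ≅ (stab t).obj (ofCPi t Z)) (a : ofCPi t Y ⟶ ofCPi t Z),
      Represents t a α.hom ∧ (stab t).map a = φ.hom := by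
  obtain ⟨a, ha⟩ := exists_representative (t := t) α.hom
  obtain ⟨b, hb⟩ := exists_representative (t := t) α.inv
  refine ⟨⟨(stab t).map a, (stab t).map b, ?_, ?_⟩, a, ha, rfl⟩
  · rw [← Functor.map_comp, ← CategoryTheory.Functor.map_id]
    refine (ha.comp hb).stab_eq ht ?_
    rw [α.hom_inv_id]; exact Represents.id _
  · rw [← Functor.map_comp, ← CategoryTheory.Functor.map_id]
    refine (hb.comp ha).stab_eq ht ?_
    rw [α.inv_hom_id]; exact Represents.id _

/-- Any two distinguished triangles starting with `f` are isomorphic over `f`, once one of them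
is realized by a pushout which is itself a direct sum of objects `E(x, y)`. -/
theorem isDistinguished_iff (ht : Irreducible t) {f : X ⟶ Y} {g₀ : Y ⟶ Z₀} {h₀ : Z₀ ⟶ X.shift}
    {f₀ : ofCPi t X ⟶ ofCPi t Y} {m₀ : ofCPi t Y ⟶ ofCPi t Z₀} {u₀ : sumHull t X ⟶ ofCPi t Z₀}
    {q₀ : ofCPi t Z₀ ⟶ ofCPi t X.shift} (hf₀ : Represents t f₀ f) (hm₀ : Represents t m₀ g₀)
    (hq₀ : Represents t q₀ h₀) (hP : IsPushout (sumHullIn t X) f₀ u₀ m₀)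
    (huq : u₀ ≫ q₀ = sumHullOut t X) (hmq : m₀ ≫ q₀ = 0) {g : Y ⟶ Z} {h : Z ⟶ X.shift} :
    IsDistinguished t f g h ↔ ∃ α : Z ≅ Z₀, g ≫ α.hom = g₀ ∧ α.hom ≫ h₀ = h := by
  constructor
  · rintro ⟨f', g', h', hf', hg', hh', C, m, u, q, φ, hC, huq', hmq', hφ, hφ'⟩
    obtain ⟨ρ, hρ⟩ := exists_retraction_sumHullIn t X
    -- The liftings `f'` and `f₀` differ by a map that extends over the hull. Shearing by `k` makes
    -- `C` a pushout along `f₀` with the same `m`.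
    obtain ⟨k, hk⟩ := (hf'.null_sub ht hf₀).exists_extension hρ
    have hC' := hC.shear hk
    let e : ofCPi t Z₀ ≅ C := hP.isoIsPushout _ _ hC'
    have he1 : u₀ ≫ e.hom = u - k ≫ m := hP.inl_isoIsPushout_hom _ _ _
    have he2 : m₀ ≫ e.hom = m := hP.inr_isoIsPushout_hom _ _ _
    -- The shear changes `u` only by a multiple of `m`, which `q` annihilates; so `q` still
    -- corresponds to `q₀`.
    have heq : e.hom ≫ q = q₀ := by
      apply hP.hom_ext
      · rw [assoc_of he1, Preadditive.sub_comp, Category.assoc, hmq', huq', comp_zero, sub_zero, huq]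
      · rw [assoc_of he2, hmq', hmq]
    obtain ⟨α, a, ha, haφ⟩ := exists_iso_represents ht (φ ≪≫ (stab t).mapIso e.symm)
    refine ⟨α, (hg'.comp ha).unique ht hm₀ ?_, (ha.comp hq₀).unique ht hh' ?_⟩
    · rw [Functor.map_comp, haφ, Iso.trans_hom, ← Category.assoc, hφ, ← he2]
      simp
    · rw [Functor.map_comp, haφ, Iso.trans_hom, ← hφ', ← heq]
      simp
  · rintro ⟨α, rfl, rfl⟩
    obtain ⟨φ, a, ha, haφ⟩ := exists_stable_iso ht α
    obtain ⟨g', hg'⟩ := exists_representative (t := t) g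
    obtain ⟨h', hh'⟩ := exists_representative (t := t) (α.hom ≫ h₀)
    refine ⟨f₀, g', h', hf₀, hg', hh', ofCPi t Z₀, m₀, u₀, q₀, φ, hP, huq, hmq, ?_, ?_⟩
    · rw [← haφ, ← Functor.map_comp]
      exact (hg'.comp ha).stab_eq ht hm₀
    · rw [← haφ, ← Functor.map_comp]
      exact (ha.comp hq₀).stab_eq ht hh'

end Standard

end FPi

/-! ### Computing the pushout by elimination of generators -/

namespace FPi

open PS1 E IndC

section Generators

variable {R : Type u} [CommRing R] (t : R)

/-- The morphism `P_[x] ⟶ P_[y]` sending `e_x` to `e_y^(y-x)`, where `x ≤ y`. -/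
noncomputable def up {x y : ℝ} (h : x ≤ y) : P t (x : Circ) ⟶ P t (y : Circ) :=
  star t (y - x) (sub_nonneg.2 h) (by rw [← AddCircle.coe_add, add_sub_cancel])

variable {t}

theorem up_up {x y z : ℝ} (h : x ≤ y) (h' : y ≤ z) {W : PS1 t} (k : P t (z : Circ) ⟶ W) :
    up t h ≫ up t h' ≫ k = up t (h.trans h') ≫ k := by
  unfold up
  rw [star_trans_assoc]
  exact congrArg (· ≫ k) (star_congr (by ring))

/-- The relation from `ξ₀` expresses `μ₀` by `κ₀`, `η₀`, `θ₀`, and the one from `ξ₁` expresses `κ₁`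
by `μ₁`, `η₁`, `θ₁`. Six generators of `Q ⊕ Y` remain, at the six positions of the free generators
of `Z`; the invertibility of the `rᵢ` makes the change of basis possible. The hypotheses `hX`, `hQ`,
`hY`, `hZ` say that the given maps generate, and `hZ'` that those of `Z` may be prescribed freely.
Only underlying morphisms are prescribed; compatibility with `d` follows afterwards. -/
theorem isPushout_of_generators {a b c x y z w : ℝ} (hab : a ≤ b) (hbc : b ≤ c) (hcx : c ≤ x)
    (hxy : x ≤ y) (hyz : y ≤ z) (hzw : z ≤ w) {X Q Y Z : FPi t} {i : X ⟶ Q} {f : X ⟶ Y} {u : Q ⟶ Z}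
    {m : Y ⟶ Z}
    (ξ₀ : P t (a : Circ) ⟶ X.V) (ξ₁ : P t (x : Circ) ⟶ X.V)
    (hX : ∀ {W : PS1 t} {k l : X.V ⟶ W}, ξ₀ ≫ k = ξ₀ ≫ l → ξ₁ ≫ k = ξ₁ ≫ l → k = l)
    (κ₀ κ₁ : P t (x : Circ) ⟶ Q.V) (μ₀ : P t (a : Circ) ⟶ Q.V) (μ₁ : P t (w : Circ) ⟶ Q.V)
    (hQ : ∀ {W : PS1 t} {k l : Q.V ⟶ W}, κ₀ ≫ k = κ₀ ≫ l → κ₁ ≫ k = κ₁ ≫ l →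
      μ₀ ≫ k = μ₀ ≫ l → μ₁ ≫ k = μ₁ ≫ l → k = l)
    (η₀ : P t (b : Circ) ⟶ Y.V) (η₁ : P t (z : Circ) ⟶ Y.V)
    (θ₀ : P t (c : Circ) ⟶ Y.V) (θ₁ : P t (y : Circ) ⟶ Y.V)
    (hY : ∀ {W : PS1 t} {k l : Y.V ⟶ W}, η₀ ≫ k = η₀ ≫ l → η₁ ≫ k = η₁ ≫ l →
      θ₀ ≫ k = θ₀ ≫ l → θ₁ ≫ k = θ₁ ≫ l → k = l)
    (ζ₀ : P t (b : Circ) ⟶ Z.V) (ζ₁ : P t (w : Circ) ⟶ Z.V)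
    (σ₀ : P t (c : Circ) ⟶ Z.V) (σ₁ : P t (z : Circ) ⟶ Z.V)
    (τ₀ : P t (x : Circ) ⟶ Z.V) (τ₁ : P t (y : Circ) ⟶ Z.V)
    (hZ : ∀ {W : PS1 t} {k l : Z.V ⟶ W}, ζ₀ ≫ k = ζ₀ ≫ l → ζ₁ ≫ k = ζ₁ ≫ l →
      σ₀ ≫ k = σ₀ ≫ l → σ₁ ≫ k = σ₁ ≫ l → τ₀ ≫ k = τ₀ ≫ l → τ₁ ≫ k = τ₁ ≫ l → k = l)
    (hZ' : ∀ {W : PS1 t} (v₀ : P t (b : Circ) ⟶ W) (v₁ : P t (w : Circ) ⟶ W)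
      (v₂ : P t (c : Circ) ⟶ W) (v₃ : P t (z : Circ) ⟶ W) (v₄ : P t (x : Circ) ⟶ W)
      (v₅ : P t (y : Circ) ⟶ W), ∃ k : Z.V ⟶ W, ζ₀ ≫ k = v₀ ∧ ζ₁ ≫ k = v₁ ∧ σ₀ ≫ k = v₂ ∧
        σ₁ ≫ k = v₃ ∧ τ₀ ≫ k = v₄ ∧ τ₁ ≫ k = v₅)
    {r₁ r₂ s₁ s₂ : R} (h₁ : r₁ * s₁ = 1) (h₂ : r₂ * s₂ = 1)
    (i₀ : ξ₀ ≫ i.f = up t (hab.trans (hbc.trans hcx)) ≫ κ₀ - μ₀)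
    (i₁ : ξ₁ ≫ i.f = κ₁ - up t (hxy.trans (hyz.trans hzw)) ≫ μ₁)
    (f₀ : ξ₀ ≫ f.f = r₁ • up t hab ≫ η₀ + r₂ • up t (hab.trans hbc) ≫ θ₀)
    (f₁ : ξ₁ ≫ f.f = r₁ • up t (hxy.trans hyz) ≫ η₁ + r₂ • up t hxy ≫ θ₁)
    (u₀ : κ₀ ≫ u.f = τ₀) (u₁ : κ₁ ≫ u.f = up t hxy ≫ τ₁)
    (u₂ : μ₀ ≫ u.f = up t hab ≫ ζ₀) (u₃ : μ₁ ≫ u.f = ζ₁)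
    (m₀ : η₀ ≫ m.f = -s₁ • ζ₀ + s₁ • up t hbc ≫ σ₀)
    (m₁ : η₁ ≫ m.f = -s₁ • up t hzw ≫ ζ₁ + s₁ • σ₁)
    (m₂ : θ₀ ≫ m.f = -s₂ • σ₀ + s₂ • up t hcx ≫ τ₀)
    (m₃ : θ₁ ≫ m.f = -s₂ • up t hyz ≫ σ₁ + s₂ • τ₁) : IsPushout i f u m := by
  have e₁ : r₁ * -s₁ = -1 := by rw [mul_neg, h₁]
  have e₂ : r₂ * -s₂ = -1 := by rw [mul_neg, h₂]
  have e₃ : s₁ * r₁ = 1 := by rw [mul_comm, h₁]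
  have e₄ : s₂ * r₂ = 1 := by rw [mul_comm, h₂]
  have w₀ : i ≫ u = f ≫ m := by
    apply FPi.hom_ext
    apply hX
    · rw [comp_f, comp_f, assoc_of i₀, assoc_of f₀]
      simp only [Preadditive.sub_comp, Preadditive.add_comp, Linear.smul_comp, Category.assoc,
        u₀, u₂, m₀, m₂, Preadditive.comp_add, Linear.comp_smul, up_up, smul_add, smul_smul,
        h₁, h₂, e₁, e₂]
      module
    · rw [comp_f, comp_f, assoc_of i₁, assoc_of f₁]
      simp only [Preadditive.sub_comp, Preadditive.add_comp, Linear.smul_comp, Category.assoc,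
        u₁, u₃, m₁, m₃, Preadditive.comp_add, Linear.comp_smul, up_up, smul_add, smul_smul,
        h₁, h₂, e₁, e₂]
      module
  -- The values at `τ₀` and `ζ₁` are read off from `u`. The equations for `m` then give `σ₀`, `ζ₀`
  -- and `σ₁`, `τ₁` in turn, since the `sᵢ` are cancellable.
  have ext {W : PS1 t} {k l : Z.V ⟶ W} (hu : u.f ≫ k = u.f ≫ l) (hm : m.f ≫ k = m.f ≫ l) :
      k = l := by
    have k0 : τ₀ ≫ k = τ₀ ≫ l := by rw [← u₀, Category.assoc, Category.assoc, hu]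
    have k1 : ζ₁ ≫ k = ζ₁ ≫ l := by rw [← u₃, Category.assoc, Category.assoc, hu]
    have n₀ : η₀ ≫ m.f ≫ k = η₀ ≫ m.f ≫ l := by rw [hm]
    have n₁ : η₁ ≫ m.f ≫ k = η₁ ≫ m.f ≫ l := by rw [hm]
    have n₂ : θ₀ ≫ m.f ≫ k = θ₀ ≫ m.f ≫ l := by rw [hm]
    have n₃ : θ₁ ≫ m.f ≫ k = θ₁ ≫ m.f ≫ l := by rw [hm]
    have canc {V : PS1 t} {r s : R} (e : r * s = 1) {p q : V ⟶ W} (h : s • p = s • q) : p = q := by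
      rw [← one_smul R p, ← one_smul R q, ← e, mul_smul, mul_smul, h]
    rw [assoc_of m₂, assoc_of m₂] at n₂
    simp only [Preadditive.add_comp, Preadditive.neg_comp, Linear.smul_comp,
      Category.assoc, k0, add_left_inj, neg_smul,
      neg_inj] at n₂
    have k2 := canc h₂ n₂
    rw [assoc_of m₀, assoc_of m₀] at n₀
    simp only [Preadditive.add_comp, Preadditive.neg_comp, Linear.smul_comp,
      Category.assoc, k2, add_left_inj, neg_smul,
      neg_inj] at n₀
    have k3 := canc h₁ n₀
    rw [assoc_of m₁, assoc_of m₁] at n₁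
    simp only [Preadditive.add_comp, Preadditive.neg_comp, Linear.smul_comp,
      Category.assoc, k1, add_right_inj, neg_smul] at n₁
    have k4 := canc h₁ n₁
    rw [assoc_of m₃, assoc_of m₃] at n₃
    simp only [Preadditive.add_comp, Preadditive.neg_comp, Linear.smul_comp,
      Category.assoc, k4, add_right_inj, neg_smul] at n₃
    exact hZ k3 k1 k2 k4 k0 (canc h₂ n₃)
  have exi {W : PS1 t} (p : Q.V ⟶ W) (q : Y.V ⟶ W) (h : i.f ≫ p = f.f ≫ q) :
      ∃ k : Z.V ⟶ W, u.f ≫ k = p ∧ m.f ≫ k = q := by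
    have R₀ : ξ₀ ≫ i.f ≫ p = ξ₀ ≫ f.f ≫ q := by rw [h]
    have R₁ : ξ₁ ≫ i.f ≫ p = ξ₁ ≫ f.f ≫ q := by rw [h]
    rw [assoc_of i₀, assoc_of f₀] at R₀
    rw [assoc_of i₁, assoc_of f₁] at R₁
    simp only [Preadditive.add_comp, Preadditive.sub_comp, Linear.smul_comp,
      Category.assoc] at R₀ R₁
    -- These values solve the triangular system given by `u₀`, `u₃` and `m₀` to `m₃`. The remaining
    -- conditions, at `κ₁` and `μ₀`, are exactly the relations `R₁` and `R₀`.
    obtain ⟨k, k0, k1, k2, k3, k4, k5⟩ := hZ'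
      (-(r₁ • η₀ ≫ q) - r₂ • up t hbc ≫ θ₀ ≫ q + up t (hbc.trans hcx) ≫ κ₀ ≫ p) (μ₁ ≫ p)
      (-(r₂ • θ₀ ≫ q) + up t hcx ≫ κ₀ ≫ p) (up t hzw ≫ μ₁ ≫ p + r₁ • η₁ ≫ q) (κ₀ ≫ p)
      (up t (hyz.trans hzw) ≫ μ₁ ≫ p + r₁ • up t hyz ≫ η₁ ≫ q + r₂ • θ₁ ≫ q)
    refine ⟨k, ?_, ?_⟩
    · apply hQ
      · rw [assoc_of u₀, k4]
      · rw [assoc_of u₁, Category.assoc, k5]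
        simp only [Preadditive.comp_add, Linear.comp_smul, up_up]
        rw [add_assoc, ← R₁]
        abel
      · rw [assoc_of u₂, Category.assoc, k0]
        simp only [Preadditive.comp_add, Preadditive.comp_sub, Preadditive.comp_neg,
          Linear.comp_smul, up_up]
        rw [sub_eq_iff_eq_add] at R₀
        rw [R₀]
        abel
      · rw [assoc_of u₃, k1]
    · apply hY
      · rw [assoc_of m₀]
        simp only [neg_smul, Preadditive.add_comp, Preadditive.neg_comp, Linear.smul_comp,
          Category.assoc, k0, k2, Preadditive.comp_add, Preadditive.comp_neg, Linear.comp_smul, up_up,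
          smul_add, smul_sub, smul_neg, smul_smul, e₃]
        module
      · rw [assoc_of m₁]
        simp only [neg_smul, Preadditive.add_comp, Preadditive.neg_comp, Linear.smul_comp,
          Category.assoc, k1, k3, smul_add, smul_smul, e₃]
        module
      · rw [assoc_of m₂]
        simp only [neg_smul, Preadditive.add_comp, Preadditive.neg_comp, Linear.smul_comp,
          Category.assoc, k2, k4, smul_add, smul_neg, smul_smul, e₄]
        module
      · rw [assoc_of m₃]
        simp only [neg_smul, Preadditive.add_comp, Preadditive.neg_comp, Linear.smul_comp,
          Category.assoc, k3, k5, Preadditive.comp_add, Linear.comp_smul, up_up, smul_add, smul_smul,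
          e₄]
        module
  have exi' (s : PushoutCocone i f) : ∃ k : Z ⟶ s.pt, u ≫ k = s.inl ∧ m ≫ k = s.inr := by
    obtain ⟨k, hk, hk'⟩ := exi s.inl.f s.inr.f (congrArg Hom.f s.condition)
    -- Compatibility of `k` with `d` is tested after `u` and `m`, where it reduces to that of the
    -- two legs of the cocone.
    refine ⟨⟨k, ext ?_ ?_⟩, FPi.hom_ext hk, FPi.hom_ext hk'⟩
    · rw [← Category.assoc, ← u.comm, Category.assoc, hk, s.inl.comm, assoc_of hk]
    · rw [← Category.assoc, ← m.comm, Category.assoc, hk', s.inr.comm, assoc_of hk']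
  choose D hD hD' using exi'
  refine ⟨⟨w₀⟩, ⟨PushoutCocone.IsColimit.mk w₀ D hD hD' fun s l hl hl' => FPi.hom_ext (ext ?_ ?_)⟩⟩
  · exact congrArg Hom.f (hl.trans (hD s).symm)
  · exact congrArg Hom.f (hl'.trans (hD' s).symm)

end Generators

end FPi

/-! ### Generators of `E(x, y)` at real coordinates -/

namespace FPi

open PS1 E IndC

section Generators

variable {R : Type u} [CommRing R] (t : R)

/-- The generator `e_x` of `E(x, y)`. -/
noncomputable def gen₀ (A : Arc) {x : ℝ} (h : (x : Circ) = A.start) :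
    P t (x : Circ) ⟶ (E t A).V :=
  star t 0 le_rfl (by rw [AddCircle.coe_zero, add_zero, h]) ≫ i₀ t A

/-- The generator `e_y` of `E(x, y)`. -/
noncomputable def gen₁ (A : Arc) {y : ℝ} (h : (y : Circ) = A.finish) :
    P t (y : Circ) ⟶ (E t A).V :=
  star t 0 le_rfl (by rw [AddCircle.coe_zero, add_zero, h]) ≫ i₁ t A

variable {t} {A B : Arc}

theorem up_self {x : ℝ} (h : x ≤ x) : up t h = 𝟙 _ := PS1.star_zero (sub_self x) _ _

theorem gen_ext {x y : ℝ} (hx : (x : Circ) = A.start) (hy : (y : Circ) = A.finish) {W : PS1 t}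
    {k l : (E t A).V ⟶ W} (h₀ : gen₀ t A hx ≫ k = gen₀ t A hx ≫ l)
    (h₁ : gen₁ t A hy ≫ k = gen₁ t A hy ≫ l) : k = l := by
  -- The rotation by `0` only transports along an equality of points that need not hold
  -- definitionally; after substitution it is the identity.
  have key {p q : Circ} (h : p = q) {m n : P t q ⟶ W}
      (e : star t 0 le_rfl (show p + ((0 : ℝ) : Circ) = q by simp [h]) ≫ m =
        star t 0 le_rfl (show p + ((0 : ℝ) : Circ) = q by simp [h]) ≫ n) : m = n := by
    subst h
    rwa [PS1.star_zero rfl, Category.id_comp, Category.id_comp] at e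
  apply hom_ext'
  · exact key hx (by simpa only [gen₀, Category.assoc] using h₀)
  · exact key hy (by simpa only [gen₁, Category.assoc] using h₁)

theorem exists_gen_desc {x y : ℝ} (hx : (x : Circ) = A.start) (hy : (y : Circ) = A.finish)
    {W : PS1 t} (v₀ : P t (x : Circ) ⟶ W) (v₁ : P t (y : Circ) ⟶ W) :
    ∃ k : (E t A).V ⟶ W, gen₀ t A hx ≫ k = v₀ ∧ gen₁ t A hy ≫ k = v₁ := by
  refine ⟨p₀ t A ≫ star t 0 le_rfl (by rw [AddCircle.coe_zero, add_zero, hx]) ≫ v₀ +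
    p₁ t A ≫ star t 0 le_rfl (by rw [AddCircle.coe_zero, add_zero, hy]) ≫ v₁, ?_, ?_⟩
  · rw [gen₀, Category.assoc, Preadditive.comp_add, i₀_p₀_assoc, i₀_p₁_assoc, add_zero,
      star_trans_assoc, PS1.star_zero (add_zero 0), Category.id_comp]
  · rw [gen₁, Category.assoc, Preadditive.comp_add, i₁_p₀_assoc, i₁_p₁_assoc, zero_add,
      star_trans_assoc, PS1.star_zero (add_zero 0), Category.id_comp]

theorem gen₀_diag (r : R) {u : ℝ} {hu : 0 ≤ u} {h : A.start + (u : Circ) = B.start}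
    {hv : A.len ≤ u + B.len} {x x' : ℝ} {hx : (x : Circ) = A.start} {hx' : (x' : Circ) = B.start}
    (hxx : x ≤ x') (e : u = x' - x) :
    gen₀ t A hx ≫ (diag t r u hu h hv).f = r • up t hxx ≫ gen₀ t B hx' := by
  subst e
  rw [gen₀, gen₀, up, Category.assoc, i₀_diag, Linear.comp_smul, star_trans_assoc,
    star_trans_assoc]
  exact congrArg (r • · ≫ i₀ t B) (star_congr (by ring))

theorem gen₁_diag (r : R) {u : ℝ} {hu : 0 ≤ u} {h : A.start + (u : Circ) = B.start}
    {hv : A.len ≤ u + B.len} {y y' : ℝ} {hy : (y : Circ) = A.finish} {hy' : (y' : Circ) = B.finish}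
    (hyy : y ≤ y') (e : u + B.len - A.len = y' - y) :
    gen₁ t A hy ≫ (diag t r u hu h hv).f = r • up t hyy ≫ gen₁ t B hy' := by
  rw [gen₁, gen₁, up, Category.assoc, i₁_diag, Linear.comp_smul, star_trans_assoc,
    star_trans_assoc]
  exact congrArg (r • · ≫ i₁ t B) (star_congr (by rw [e]; ring))

end Generators

end FPi

/-- The real numbers `x₀ < x₁ < x₀ + 2π` are coordinates of `X`. -/
structure IndC.IsLift {K : Type*} (X : IndC K) (x₀ x₁ : ℝ) : Prop where
  fst : (x₀ : Circ) = X.arc.start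
  snd : (x₁ : Circ) = X.arc.finish
  lt : x₀ < x₁
  lt' : x₁ < x₀ + 2 * Real.pi

namespace IndC

variable {K : Type*} {X Y : IndC K} {x₀ x₁ y₀ y₁ : ℝ}

theorem isLift_mk' (h : x₀ < x₁) (h' : x₁ < x₀ + 2 * Real.pi) :
    (mk' x₀ x₁ h h' : IndC K).IsLift x₀ x₁ :=
  ⟨rfl, (arc_finish (mk' x₀ x₁ h h' : IndC K)).symm, h, h'⟩

theorem IsLift.snd' (h : X.IsLift x₀ x₁) : (x₁ : Circ) = X.snd := h.snd.trans X.arc_finish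

theorem IsLift.len (h : X.IsLift x₀ x₁) : X.arc.len = x₁ - x₀ :=
  dep_eq (by linarith [h.lt]) (by linarith [h.lt'])
    (by rw [AddCircle.coe_sub, h.snd', h.fst]; rfl)

theorem IsLift.swap (h : X.IsLift x₀ x₁) : X.swap.IsLift x₁ (x₀ + 2 * Real.pi) :=
  ⟨h.snd', by rw [Circ.coe_add_two_pi, X.swap_arc_finish]; exact h.fst, h.lt',
    by linarith [h.lt]⟩

theorem IsLift.linked (hX : X.IsLift x₀ x₁) (hY : Y.IsLift y₀ y₁) (h1 : x₀ ≤ y₀) (h2 : y₀ < x₁)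
    (h3 : x₁ ≤ y₁) (h4 : y₁ < x₀ + 2 * Real.pi) : Linked X Y :=
  ⟨x₀, x₁, y₀, y₁, hX.fst, hX.snd', hY.fst, hY.snd', h1, h2, h3, h4⟩

end IndC

namespace FPi

open PS1 E IndC

section Generators

variable {R : Type u} [CommRing R] {t : R} {K : Type*} {X Y : IndC K} {x₀ x₁ y₀ y₁ : ℝ}

theorem basic_of_isLift (hX : X.IsLift x₀ x₁) (hY : Y.IsLift y₀ y₁) (h1 : x₀ ≤ y₀) (h2 : y₀ < x₁)
    (h3 : x₁ ≤ y₁) (h4 : y₁ < x₀ + 2 * Real.pi) (r : R) :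
    basic t r X Y = diag t r (y₀ - x₀) (by linarith)
      (by rw [← hX.fst, ← hY.fst, AddCircle.coe_sub]; abel)
      (by rw [hX.len, hY.len]; linarith) :=
  basic_of_linked (hX.linked hY h1 h2 h3 h4) r _ _ _ (Or.inl (by linarith))

theorem gen₀_basic (hX : X.IsLift x₀ x₁) (hY : Y.IsLift y₀ y₁) (h1 : x₀ ≤ y₀) (h2 : y₀ < x₁)
    (h3 : x₁ ≤ y₁) (h4 : y₁ < x₀ + 2 * Real.pi) (r : R) :
    gen₀ t X.arc hX.fst ≫ (basic t r X Y).f = r • up t h1 ≫ gen₀ t Y.arc hY.fst := by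
  rw [basic_of_isLift hX hY h1 h2 h3 h4]
  exact gen₀_diag r h1 rfl

theorem gen₁_basic (hX : X.IsLift x₀ x₁) (hY : Y.IsLift y₀ y₁) (h1 : x₀ ≤ y₀) (h2 : y₀ < x₁)
    (h3 : x₁ ≤ y₁) (h4 : y₁ < x₀ + 2 * Real.pi) (r : R) :
    gen₁ t X.arc hX.snd ≫ (basic t r X Y).f = r • up t h3 ≫ gen₁ t Y.arc hY.snd := by
  rw [basic_of_isLift hX hY h1 h2 h3 h4]
  exact gen₁_diag r h3 (by rw [hX.len, hY.len]; ring)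

end Generators

section Sums

variable {R : Type u} [CommRing R] [IsDomain R] [IsDiscreteValuationRing R] {t : R}
  {X Y Z : CPi (IsLocalRing.ResidueField R)}

theorem inj_ofMatrix (k : ∀ (i : X.ι) (j : Y.ι), E t (X.X i).arc ⟶ E t (Y.X j).arc) (i : X.ι) :
    inj t X i ≫ ofMatrix k = ∑ j, k i j ≫ inj t Y j := by
  rw [← Category.comp_id (ofMatrix k), ← sum_proj_inj Y]
  simp only [Preadditive.comp_sum]
  refine Finset.sum_congr rfl fun j _ => ?_
  rw [← inj_ofMatrix_proj k i j, Category.assoc, Category.assoc]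

theorem ofCPi_ext {W : PS1 t} {k l : (ofCPi t X).V ⟶ W}
    (h : ∀ i, (inj t X i).f ≫ k = (inj t X i).f ≫ l) : k = l := by
  rw [← Category.id_comp k, ← Category.id_comp l, ← id_f, ← sum_proj_inj X, sum_f,
    Preadditive.sum_comp, Preadditive.sum_comp]
  simp only [comp_f, Category.assoc, h]

/-- The morphism whose components are given multiples of the basic morphisms. -/
noncomputable def ofBasic (t : R) (ρ : X.ι → Y.ι → R) : ofCPi t X ⟶ ofCPi t Y :=
  ofMatrix fun i j => basic t (ρ i j) (X.X i) (Y.X j)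

theorem represents_ofBasic {ρ : X.ι → Y.ι → R} {f : X ⟶ Y}
    (h : ∀ i j, IsLocalRing.residue R (ρ i j) = (f i j).coeff) :
    Represents t (ofBasic t ρ) f := by
  rw [represents_iff]
  intro i j
  rw [ofBasic, inj_ofMatrix_proj]
  exact Lifts.basic (h i j)

theorem comp_inj_ofBasic (ρ : X.ι → Y.ι → R) (i : X.ι) {W : PS1 t}
    (k : W ⟶ (E t (X.X i).arc).V) : (k ≫ (inj t X i).f) ≫ (ofBasic t ρ).f =
      ∑ j, (k ≫ (basic t (ρ i j) (X.X i) (Y.X j)).f) ≫ (inj t Y j).f := by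
  rw [Category.assoc, ← comp_f, ofBasic, inj_ofMatrix, sum_f, Preadditive.comp_sum]
  simp only [comp_f, Category.assoc]

end Sums

end FPi

/-! ### Generators of the hull and of the chosen exact sequence -/

namespace FPi

open PS1 E IndC

namespace hull

variable {R : Type u} [CommRing R] {t : R} {K : Type*} {X : IndC K} {a x : ℝ}

theorem start_finishArc (h : X.IsLift a x) : (x : Circ) = X.finishArc.start := h.snd'

theorem finish_finishArc (h : X.IsLift a x) : (x : Circ) = X.finishArc.finish := by
  rw [Arc.finish, ← start_finishArc h]
  simp [finishArc]

theorem start_fullArc (h : X.IsLift a x) : (a : Circ) = X.fullArc.start := h.fst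

theorem finish_fullArc (h : X.IsLift a x) :
    ((a + 2 * Real.pi : ℝ) : Circ) = X.fullArc.finish := by
  rw [Arc.finish, ← start_fullArc h]
  rfl

/-- The generators of `E(y, y) ⊕ E(x, x + 2π)`. -/
noncomputable def gen₀₀ (t : R) (h : X.IsLift a x) : P t (x : Circ) ⟶ (hull t X).V :=
  gen₀ t X.finishArc (start_finishArc h) ≫ (inl t X).f
/-- The generators of `E(y, y) ⊕ E(x, x + 2π)`. -/
noncomputable def gen₀₁ (t : R) (h : X.IsLift a x) : P t (x : Circ) ⟶ (hull t X).V :=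
  gen₁ t X.finishArc (finish_finishArc h) ≫ (inl t X).f
/-- The generators of `E(y, y) ⊕ E(x, x + 2π)`. -/
noncomputable def gen₁₀ (t : R) (h : X.IsLift a x) : P t (a : Circ) ⟶ (hull t X).V :=
  gen₀ t X.fullArc (start_fullArc h) ≫ (inr t X).f
/-- The generators of `E(y, y) ⊕ E(x, x + 2π)`. -/
noncomputable def gen₁₁ (t : R) (h : X.IsLift a x) :
    P t ((a + 2 * Real.pi : ℝ) : Circ) ⟶ (hull t X).V :=
  gen₁ t X.fullArc (finish_fullArc h) ≫ (inr t X).f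

theorem gen_ext (h : X.IsLift a x) {W : PS1 t} {k l : (hull t X).V ⟶ W}
    (h₀ : gen₀₀ t h ≫ k = gen₀₀ t h ≫ l) (h₁ : gen₀₁ t h ≫ k = gen₀₁ t h ≫ l)
    (h₂ : gen₁₀ t h ≫ k = gen₁₀ t h ≫ l) (h₃ : gen₁₁ t h ≫ k = gen₁₁ t h ≫ l) : k = l := by
  have e : (inl t X).f ≫ k = (inl t X).f ≫ l :=
    FPi.gen_ext (start_finishArc h) (finish_finishArc h)
      (by simpa only [gen₀₀, Category.assoc] using h₀)
      (by simpa only [gen₀₁, Category.assoc] using h₁)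
  have e' : (inr t X).f ≫ k = (inr t X).f ≫ l :=
    FPi.gen_ext (start_fullArc h) (finish_fullArc h)
      (by simpa only [gen₁₀, Category.assoc] using h₂)
      (by simpa only [gen₁₁, Category.assoc] using h₃)
  rw [← Category.id_comp k, ← Category.id_comp l, ← id_f, ← total, add_f, comp_f, comp_f,
    Preadditive.add_comp, Preadditive.add_comp]
  simp only [Category.assoc, e, e']

theorem hullIn_eq : hullIn t X = hullIn t X ≫ fst t X ≫ inl t X + hullIn t X ≫ snd t X ≫ inr t X := by
  rw [← Preadditive.comp_add, total, Category.comp_id]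

theorem start_add_len (h : X.IsLift a x) : X.arc.start + (X.arc.len : Circ) = X.finishArc.start := by
  rw [Arc.start_add, ← h.snd, start_finishArc h]

theorem start_add_zero (X : IndC K) : X.arc.start + ((0 : ℝ) : Circ) = X.fullArc.start :=
  (congrArg _ (AddCircle.coe_zero _)).trans (add_zero _)

theorem finishArc_start_add_zero (X : IndC K) :
    X.finishArc.start + ((0 : ℝ) : Circ) = X.swap.arc.start :=
  (congrArg _ (AddCircle.coe_zero _)).trans (add_zero _)

theorem fullArc_start_add_len (X : IndC K) :
    X.fullArc.start + (X.arc.len : Circ) = X.swap.arc.start :=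
  X.arc_finish

theorem gen₀_hullIn (h : X.IsLift a x) : gen₀ t X.arc h.fst ≫ (hullIn t X).f =
    up t h.lt.le ≫ gen₀₀ t h - gen₁₀ t h := by
  rw [hullIn_eq, ← Category.assoc, ← Category.assoc,
    hullIn_fst (hu := X.arc.nonneg) (h := start_add_len h) (hv := by simp [finishArc]),
    hullIn_snd (hu := le_rfl) (h := start_add_zero X)
      (hv := by simpa [fullArc] using X.arc.le), add_f, comp_f, comp_f,
    Preadditive.comp_add, assoc_of (gen₀_diag 1 (hx' := start_finishArc h) h.lt.le h.len),
    assoc_of (gen₀_diag (-1) (hx' := start_fullArc h) le_rfl (sub_self _).symm), up_self]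
  simp only [one_smul, neg_smul, Category.assoc, Preadditive.neg_comp, Category.id_comp, gen₀₀, gen₁₀,
    sub_eq_add_neg]

theorem gen₁_hullIn (h : X.IsLift a x) : gen₁ t X.arc h.snd ≫ (hullIn t X).f =
    gen₀₁ t h - up t h.lt'.le ≫ gen₁₁ t h := by
  rw [hullIn_eq, ← Category.assoc, ← Category.assoc,
    hullIn_fst (hu := X.arc.nonneg) (h := start_add_len h) (hv := by simp [finishArc]),
    hullIn_snd (hu := le_rfl) (h := start_add_zero X)
      (hv := by simpa [fullArc] using X.arc.le), add_f, comp_f, comp_f,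
    Preadditive.comp_add, assoc_of (gen₁_diag 1 (hy' := finish_finishArc h) le_rfl
      (by simp [finishArc])),
    assoc_of (gen₁_diag (-1) (hy' := finish_fullArc h) h.lt'.le
      (by rw [h.len]; simp only [fullArc]; ring)), up_self]
  simp only [one_smul, neg_smul, Category.assoc, Preadditive.neg_comp, Category.id_comp, gen₀₁, gen₁₁,
    sub_eq_add_neg]

theorem gen₀₀_hullOut (h : X.IsLift a x) :
    gen₀₀ t h ≫ (hullOut t X).f = gen₀ t X.swap.arc h.swap.fst := by
  rw [gen₀₀, Category.assoc, ← comp_f, inl_hullOut (hu := le_rfl)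
    (h := finishArc_start_add_zero X) (hv := by simpa [finishArc] using X.swap.arc.nonneg),
    gen₀_diag 1 (hx' := h.swap.fst) le_rfl (sub_self _).symm, up_self, one_smul, Category.id_comp]

theorem gen₀₁_hullOut (h : X.IsLift a x) :
    gen₀₁ t h ≫ (hullOut t X).f = up t h.lt'.le ≫ gen₁ t X.swap.arc h.swap.snd := by
  rw [gen₀₁, Category.assoc, ← comp_f, inl_hullOut (hu := le_rfl)
    (h := finishArc_start_add_zero X) (hv := by simpa [finishArc] using X.swap.arc.nonneg),
    gen₁_diag 1 (hy' := h.swap.snd) h.lt'.le (by rw [h.swap.len]; simp [finishArc]), one_smul]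

theorem gen₁₀_hullOut (h : X.IsLift a x) :
    gen₁₀ t h ≫ (hullOut t X).f = up t h.lt.le ≫ gen₀ t X.swap.arc h.swap.fst := by
  rw [gen₁₀, Category.assoc, ← comp_f, inr_hullOut (hu := X.arc.nonneg)
    (h := fullArc_start_add_len X) (hv := by simpa [fullArc] using X.arc_len_add.ge),
    gen₀_diag 1 (hx' := h.swap.fst) h.lt.le h.len, one_smul]

theorem gen₁₁_hullOut (h : X.IsLift a x) :
    gen₁₁ t h ≫ (hullOut t X).f = gen₁ t X.swap.arc h.swap.snd := by
  rw [gen₁₁, Category.assoc, ← comp_f, inr_hullOut (hu := X.arc.nonneg)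
    (h := fullArc_start_add_len X) (hv := by simpa [fullArc] using X.arc_len_add.ge),
    gen₁_diag 1 (hy' := h.swap.snd) le_rfl (by rw [h.swap.len, h.len]; simp only [fullArc]; ring),
    up_self, one_smul, Category.id_comp]

/-- Basic diagonal morphisms `E(x, x) ⟶ E(x, y)` and `E(a, a + 2π) ⟶ E(b, a + 2π)` give a
morphism from the hull of `(a, x)`. -/
theorem exists_desc (h : X.IsLift a x) {U V : IndC K} {b y : ℝ}
    (hU : U.IsLift x y) (hV : V.IsLift b (a + 2 * Real.pi)) (hab : a ≤ b) {W : FPi t}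
    (k : E t U.arc ⟶ W) (l : E t V.arc ⟶ W) : ∃ u : hull t X ⟶ W,
      gen₀₀ t h ≫ u.f = gen₀ t U.arc hU.fst ≫ k.f ∧
      gen₀₁ t h ≫ u.f = up t hU.lt.le ≫ gen₁ t U.arc hU.snd ≫ k.f ∧
      gen₁₀ t h ≫ u.f = up t hab ≫ gen₀ t V.arc hV.fst ≫ l.f ∧
      gen₁₁ t h ≫ u.f = gen₁ t V.arc hV.snd ≫ l.f := by
  have c₁ : X.finishArc.start + ((0 : ℝ) : Circ) = U.arc.start := by
    rw [← start_finishArc h, hU.fst]; simp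
  have c₂ : X.fullArc.start + ((b - a : ℝ) : Circ) = V.arc.start := by
    rw [← start_fullArc h, ← hV.fst, ← AddCircle.coe_add, add_sub_cancel]
  refine ⟨fst t X ≫ diag t 1 0 le_rfl c₁ (by simpa [finishArc] using U.arc.nonneg) ≫ k +
    snd t X ≫ diag t 1 (b - a) (by linarith) c₂ (by rw [hV.len]; simp only [fullArc]; linarith) ≫ l,
    ?_, ?_, ?_, ?_⟩
  · rw [gen₀₀, Category.assoc, ← comp_f, Preadditive.comp_add, assoc_of (inl_fst t X),
      assoc_of (inl_snd t X), zero_comp, add_zero, Category.id_comp, comp_f,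
      assoc_of (gen₀_diag 1 (hx' := hU.fst) le_rfl (sub_self _).symm), up_self, one_smul, Category.id_comp]
  · rw [gen₀₁, Category.assoc, ← comp_f, Preadditive.comp_add, assoc_of (inl_fst t X),
      assoc_of (inl_snd t X), zero_comp, add_zero, Category.id_comp, comp_f,
      assoc_of (gen₁_diag 1 (hy' := hU.snd) hU.lt.le (by rw [hU.len]; simp [finishArc])), one_smul,
      Category.assoc]
  · rw [gen₁₀, Category.assoc, ← comp_f, Preadditive.comp_add, assoc_of (inr_fst t X),
      assoc_of (inr_snd t X), zero_comp, zero_add, Category.id_comp, comp_f,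
      assoc_of (gen₀_diag 1 (hx' := hV.fst) hab rfl), one_smul, Category.assoc]
  · rw [gen₁₁, Category.assoc, ← comp_f, Preadditive.comp_add, assoc_of (inr_fst t X),
      assoc_of (inr_snd t X), zero_comp, zero_add, Category.id_comp, comp_f,
      assoc_of (gen₁_diag 1 (hy' := hV.snd) le_rfl (by rw [hV.len]; simp only [fullArc]; ring)),
      up_self, one_smul, Category.id_comp]

end hull

section Sums

variable {R : Type u} [CommRing R] [IsDomain R] [IsDiscreteValuationRing R] {t : R}
  {X Y Z : CPi (IsLocalRing.ResidueField R)}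

/-- The inclusion of a summand of `sumHull`. -/
noncomputable def hullInj (t : R) (X : CPi (IsLocalRing.ResidueField R)) (i : X.ι) :
    hull t (X.X i) ⟶ sumHull t X :=
  biproduct.ι (fun i => hull t (X.X i)) i

/-- The projection to a summand of `sumHull`. -/
noncomputable def hullProj (t : R) (X : CPi (IsLocalRing.ResidueField R)) (i : X.ι) :
    sumHull t X ⟶ hull t (X.X i) :=
  biproduct.π (fun i => hull t (X.X i)) i

theorem inj_sumHullIn (i : X.ι) :
    inj t X i ≫ sumHullIn t X = hullIn t (X.X i) ≫ hullInj t X i :=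
  biproduct.ι_map (fun i => hullIn t (X.X i)) i

theorem hullInj_sumHullOut (i : X.ι) :
    hullInj t X i ≫ sumHullOut t X = hullOut t (X.X i) ≫ inj t X.shift i :=
  biproduct.ι_map (fun i => hullOut t (X.X i)) i

theorem sumHull_ext {W : PS1 t} {k l : (sumHull t X).V ⟶ W}
    (h : ∀ i, (hullInj t X i).f ≫ k = (hullInj t X i).f ≫ l) : k = l := by
  have e : ∑ i, hullProj t X i ≫ hullInj t X i = 𝟙 (sumHull t X) :=
    biproduct.total
  rw [← Category.id_comp k, ← Category.id_comp l, ← id_f, ← e, sum_f,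
    Preadditive.sum_comp, Preadditive.sum_comp]
  simp only [comp_f, Category.assoc, h]

theorem exists_sumHull_desc {W : FPi t} (k : ∀ i, hull t (X.X i) ⟶ W) :
    ∃ l : sumHull t X ⟶ W, ∀ i, hullInj t X i ≫ l = k i :=
  ⟨biproduct.desc k, fun _ => biproduct.ι_desc _ _⟩

end Sums

end FPi

/-! ### The standard pushout -/

theorem Fintype.sum_eq_add_of_forall {ι M : Type*} [Fintype ι] [AddCommMonoid M] {i j : ι}
    (hij : i ≠ j) (h : ∀ k, k = i ∨ k = j) (f : ι → M) : ∑ k, f k = f i + f j := by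
  classical
  rw [← Finset.sum_pair hij]
  exact (Finset.sum_subset (Finset.subset_univ _) fun k _ hk => absurd (h k) (by simpa using hk)).symm

theorem Fintype.sum_eq_add_add_of_forall {ι M : Type*} [Fintype ι] [AddCommMonoid M] {i j k : ι}
    (hij : i ≠ j) (hik : i ≠ k) (hjk : j ≠ k) (h : ∀ l, l = i ∨ l = j ∨ l = k) (f : ι → M) :
    ∑ l, f l = f i + f j + f k := by
  classical
  rw [add_assoc, ← Finset.sum_pair hjk, ← Finset.sum_insert (by simp [hij, hik])]
  exact (Finset.sum_subset (Finset.subset_univ _) fun l _ hl => absurd (h l) (by simpa using hl)).symm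

namespace FPi

open PS1 E IndC

variable {R : Type u} [CommRing R] [IsDomain R] [IsDiscreteValuationRing R] {t : R}
  {X Y Z : CPi (IsLocalRing.ResidueField R)}

theorem exists_ofCPi_desc_of_three {i₀ i₁ i₂ : X.ι} (h : i₀ ≠ i₁) (h' : i₀ ≠ i₂) (h'' : i₁ ≠ i₂)
    {W : PS1 t} (k₀ : (E t (X.X i₀).arc).V ⟶ W) (k₁ : (E t (X.X i₁).arc).V ⟶ W)
    (k₂ : (E t (X.X i₂).arc).V ⟶ W) : ∃ k : (ofCPi t X).V ⟶ W,
      (inj t X i₀).f ≫ k = k₀ ∧ (inj t X i₁).f ≫ k = k₁ ∧ (inj t X i₂).f ≫ k = k₂ := by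
  have e {i j : X.ι} (h : i ≠ j) (k : (E t (X.X j).arc).V ⟶ W) :
      (inj t X i).f ≫ (proj t X j).f ≫ k = 0 := by
    rw [← Category.assoc, ← comp_f, inj_proj_of_ne h, zero_f, zero_comp]
  have e' (i : X.ι) (k : (E t (X.X i).arc).V ⟶ W) :
      (inj t X i).f ≫ (proj t X i).f ≫ k = k := by
    rw [← Category.assoc, ← comp_f, inj_proj_self, id_f, Category.id_comp]
  refine ⟨(proj t X i₀).f ≫ k₀ + (proj t X i₁).f ≫ k₁ + (proj t X i₂).f ≫ k₂, ?_, ?_, ?_⟩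
  · rw [Preadditive.comp_add, Preadditive.comp_add, e', e h, e h', add_zero, add_zero]
  · rw [Preadditive.comp_add, Preadditive.comp_add, e', e h.symm, e h'', zero_add, add_zero]
  · rw [Preadditive.comp_add, Preadditive.comp_add, e', e h'.symm, e h''.symm, zero_add, zero_add]

set_option maxHeartbeats 800000 in
/-- The pushout of the chosen exact sequence of `X = (a, x)` along a morphism to
`Y = (b, z) ⊕ (c, y)` with invertible components is `Z = (b, a + 2π) ⊕ (c, z) ⊕ (x, y)`. -/
theorem exists_standard_pushout {a b c x y z : ℝ}
    (hab : a < b) (hbc : b < c) (hcx : c < x) (hxy : x < y) (hyz : y < z)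
    (hza : z < a + 2 * Real.pi)
    {x0 : X.ι} (hX : ∀ i, i = x0) (lX : (X.X x0).IsLift a x)
    {y0 y1 : Y.ι} (hy : y0 ≠ y1) (hY : ∀ i, i = y0 ∨ i = y1)
    (lY0 : (Y.X y0).IsLift b z) (lY1 : (Y.X y1).IsLift c y)
    {z0 z1 z2 : Z.ι} (hz : z0 ≠ z1) (hz' : z0 ≠ z2) (hz'' : z1 ≠ z2)
    (hZ : ∀ i, i = z0 ∨ i = z1 ∨ i = z2)
    (lZ0 : (Z.X z0).IsLift b (a + 2 * Real.pi)) (lZ1 : (Z.X z1).IsLift c z)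
    (lZ2 : (Z.X z2).IsLift x y)
    {r₁ r₂ s₁ s₂ : R} (h₁ : r₁ * s₁ = 1) (h₂ : r₂ * s₂ = 1)
    {ρ : X.ι → Y.ι → R} (hρ₁ : ρ x0 y0 = r₁) (hρ₂ : ρ x0 y1 = r₂)
    {μ : Y.ι → Z.ι → R} (hμ00 : μ y0 z0 = -s₁) (hμ01 : μ y0 z1 = s₁) (hμ02 : μ y0 z2 = 0)
    (hμ10 : μ y1 z0 = 0) (hμ11 : μ y1 z1 = -s₂) (hμ12 : μ y1 z2 = s₂) :
    ∃ u : sumHull t X ⟶ ofCPi t Z, IsPushout (sumHullIn t X) (ofBasic t ρ) u (ofBasic t μ) ∧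
      u ≫ ofBasic t (fun _ _ => 1) = sumHullOut t X ∧
      ofBasic t μ ≫ ofBasic t (fun _ _ => 1) = (0 : ofCPi t Y ⟶ ofCPi t X.shift) := by
  have lS : (X.shift.X x0).IsLift x (a + 2 * Real.pi) := lX.swap
  have sX (W : PS1 t) {Z : PS1 t} (f : X.ι → (W ⟶ Z)) : ∑ i, f i = f x0 := by
    have : Subsingleton X.ι := ⟨fun i j => (hX i).trans (hX j).symm⟩
    exact Fintype.sum_subsingleton f x0
  have sY (W : PS1 t) {Z : PS1 t} (f : Y.ι → (W ⟶ Z)) : ∑ i, f i = f y0 + f y1 :=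
    Fintype.sum_eq_add_of_forall hy hY f
  have sZ (W : PS1 t) {V : PS1 t} (f : Z.ι → (W ⟶ V)) : ∑ i, f i = f z0 + f z1 + f z2 :=
    Fintype.sum_eq_add_add_of_forall hz hz' hz'' hZ f
  -- The hull maps to the outer summands of `Z` only: `E(x, x)` to `E(x, y)` and `E(a, a + 2π)` to
  -- `E(b, a + 2π)`.
  obtain ⟨v, v₀, v₁, v₂, v₃⟩ := hull.exists_desc lX lZ2 lZ0 hab.le (inj t Z z2) (inj t Z z0)
  obtain ⟨u, hu⟩ : ∃ u : sumHull t X ⟶ ofCPi t Z, hullInj t X x0 ≫ u = v := by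
    obtain ⟨u, hu⟩ := exists_sumHull_desc (t := t) (X := X) (W := ofCPi t Z)
      -- An index equals `x0` only propositionally, so `v` must be transported to the summand at
      -- `i`.
      fun i => eqToHom (by rw [hX i]) ≫ v
    exact ⟨u, by rw [hu, eqToHom_refl, Category.id_comp]⟩
  have hu' : (hullInj t X x0).f ≫ u.f = v.f := congrArg Hom.f hu
  have q₀ : (gen₀ t _ lZ0.fst ≫ (inj t Z z0).f) ≫
      (ofBasic t (fun _ _ => 1) : ofCPi t Z ⟶ ofCPi t X.shift).f =
      up t (hbc.trans hcx).le ≫ gen₀ t _ lS.fst ≫ (inj t X.shift x0).f := by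
    rw [comp_inj_ofBasic, sX, gen₀_basic lZ0 lS (by linarith) (by linarith) (by linarith)
      (by linarith), one_smul, Category.assoc]
  have q₁ : (gen₁ t _ lZ0.snd ≫ (inj t Z z0).f) ≫
      (ofBasic t (fun _ _ => 1) : ofCPi t Z ⟶ ofCPi t X.shift).f =
      gen₁ t _ lS.snd ≫ (inj t X.shift x0).f := by
    rw [comp_inj_ofBasic, sX, gen₁_basic lZ0 lS (by linarith) (by linarith) (by linarith)
      (by linarith), one_smul, up_self, Category.id_comp]
  have q₂ : (gen₀ t _ lZ1.fst ≫ (inj t Z z1).f) ≫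
      (ofBasic t (fun _ _ => 1) : ofCPi t Z ⟶ ofCPi t X.shift).f =
      up t hcx.le ≫ gen₀ t _ lS.fst ≫ (inj t X.shift x0).f := by
    rw [comp_inj_ofBasic, sX, gen₀_basic lZ1 lS (by linarith) (by linarith) (by linarith)
      (by linarith), one_smul, Category.assoc]
  have q₃ : (gen₁ t _ lZ1.snd ≫ (inj t Z z1).f) ≫
      (ofBasic t (fun _ _ => 1) : ofCPi t Z ⟶ ofCPi t X.shift).f =
      up t hza.le ≫ gen₁ t _ lS.snd ≫ (inj t X.shift x0).f := by
    rw [comp_inj_ofBasic, sX, gen₁_basic lZ1 lS (by linarith) (by linarith) (by linarith)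
      (by linarith), one_smul, Category.assoc]
  have q₄ : (gen₀ t _ lZ2.fst ≫ (inj t Z z2).f) ≫
      (ofBasic t (fun _ _ => 1) : ofCPi t Z ⟶ ofCPi t X.shift).f =
      gen₀ t _ lS.fst ≫ (inj t X.shift x0).f := by
    rw [comp_inj_ofBasic, sX, gen₀_basic lZ2 lS (by linarith) (by linarith) (by linarith)
      (by linarith), one_smul, up_self, Category.id_comp]
  have q₅ : (gen₁ t _ lZ2.snd ≫ (inj t Z z2).f) ≫
      (ofBasic t (fun _ _ => 1) : ofCPi t Z ⟶ ofCPi t X.shift).f =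
      up t (hyz.trans hza).le ≫ gen₁ t _ lS.snd ≫ (inj t X.shift x0).f := by
    rw [comp_inj_ofBasic, sX, gen₁_basic lZ2 lS (by linarith) (by linarith) (by linarith)
      (by linarith), one_smul, Category.assoc]
  have m₀ : (gen₀ t _ lY0.fst ≫ (inj t Y y0).f) ≫ (ofBasic t μ).f =
      -s₁ • gen₀ t _ lZ0.fst ≫ (inj t Z z0).f +
        s₁ • up t hbc.le ≫ gen₀ t _ lZ1.fst ≫ (inj t Z z1).f := by
    rw [comp_inj_ofBasic, sZ, gen₀_basic lY0 lZ0 (by linarith) (by linarith) (by linarith)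
      (by linarith), gen₀_basic lY0 lZ1 (by linarith) (by linarith) (by linarith)
      (by linarith), hμ00, hμ01, hμ02, basic_zero, up_self]
    simp only [zero_f, comp_zero, zero_comp, add_zero, Linear.smul_comp, Category.assoc,
      Category.id_comp]
  have m₁ : (gen₁ t _ lY0.snd ≫ (inj t Y y0).f) ≫ (ofBasic t μ).f =
      -s₁ • up t hza.le ≫ gen₁ t _ lZ0.snd ≫ (inj t Z z0).f +
        s₁ • gen₁ t _ lZ1.snd ≫ (inj t Z z1).f := by
    rw [comp_inj_ofBasic, sZ, gen₁_basic lY0 lZ0 (by linarith) (by linarith) (by linarith)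
      (by linarith), gen₁_basic lY0 lZ1 (by linarith) (by linarith) (by linarith)
      (by linarith), hμ00, hμ01, hμ02, basic_zero, up_self]
    simp only [zero_f, comp_zero, zero_comp, add_zero, Linear.smul_comp, Category.assoc,
      Category.id_comp]
  have m₂ : (gen₀ t _ lY1.fst ≫ (inj t Y y1).f) ≫ (ofBasic t μ).f =
      -s₂ • gen₀ t _ lZ1.fst ≫ (inj t Z z1).f +
        s₂ • up t hcx.le ≫ gen₀ t _ lZ2.fst ≫ (inj t Z z2).f := by
    rw [comp_inj_ofBasic, sZ, gen₀_basic lY1 lZ1 (by linarith) (by linarith) (by linarith)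
      (by linarith), gen₀_basic lY1 lZ2 (by linarith) (by linarith) (by linarith)
      (by linarith), hμ10, hμ11, hμ12, basic_zero, up_self]
    simp only [zero_f, comp_zero, zero_comp, zero_add, Linear.smul_comp, Category.assoc,
      Category.id_comp]
  have m₃ : (gen₁ t _ lY1.snd ≫ (inj t Y y1).f) ≫ (ofBasic t μ).f =
      -s₂ • up t hyz.le ≫ gen₁ t _ lZ1.snd ≫ (inj t Z z1).f +
        s₂ • gen₁ t _ lZ2.snd ≫ (inj t Z z2).f := by
    rw [comp_inj_ofBasic, sZ, gen₁_basic lY1 lZ1 (by linarith) (by linarith) (by linarith)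
      (by linarith), gen₁_basic lY1 lZ2 (by linarith) (by linarith) (by linarith)
      (by linarith), hμ10, hμ11, hμ12, basic_zero, up_self]
    simp only [zero_f, comp_zero, zero_comp, zero_add, Linear.smul_comp, Category.assoc,
      Category.id_comp]
  have f₀ : (gen₀ t _ lX.fst ≫ (inj t X x0).f) ≫ (ofBasic t ρ).f =
      r₁ • up t hab.le ≫ gen₀ t _ lY0.fst ≫ (inj t Y y0).f +
        r₂ • up t (hab.trans hbc).le ≫ gen₀ t _ lY1.fst ≫ (inj t Y y1).f := by
    rw [comp_inj_ofBasic, sY, gen₀_basic lX lY0 (by linarith) (by linarith) (by linarith)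
      (by linarith), gen₀_basic lX lY1 (by linarith) (by linarith) (by linarith)
      (by linarith), hρ₁, hρ₂]
    simp only [Linear.smul_comp, Category.assoc]
  have f₁ : (gen₁ t _ lX.snd ≫ (inj t X x0).f) ≫ (ofBasic t ρ).f =
      r₁ • up t (hxy.trans hyz).le ≫ gen₁ t _ lY0.snd ≫ (inj t Y y0).f +
        r₂ • up t hxy.le ≫ gen₁ t _ lY1.snd ≫ (inj t Y y1).f := by
    rw [comp_inj_ofBasic, sY, gen₁_basic lX lY0 (by linarith) (by linarith) (by linarith)
      (by linarith), gen₁_basic lX lY1 (by linarith) (by linarith) (by linarith)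
      (by linarith), hρ₁, hρ₂]
    simp only [Linear.smul_comp, Category.assoc]
  have i₀ : (gen₀ t _ lX.fst ≫ (inj t X x0).f) ≫ (sumHullIn t X).f =
      up t lX.lt.le ≫ hull.gen₀₀ t lX ≫ (hullInj t X x0).f -
        hull.gen₁₀ t lX ≫ (hullInj t X x0).f := by
    rw [Category.assoc, ← comp_f, inj_sumHullIn, comp_f, assoc_of (hull.gen₀_hullIn lX),
      Preadditive.sub_comp, Category.assoc]
  have i₁ : (gen₁ t _ lX.snd ≫ (inj t X x0).f) ≫ (sumHullIn t X).f =
      hull.gen₀₁ t lX ≫ (hullInj t X x0).f -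
        up t lX.lt'.le ≫ hull.gen₁₁ t lX ≫ (hullInj t X x0).f := by
    rw [Category.assoc, ← comp_f, inj_sumHullIn, comp_f, assoc_of (hull.gen₁_hullIn lX),
      Preadditive.sub_comp, Category.assoc]
  have eY {W : PS1 t} {k l : (ofCPi t Y).V ⟶ W}
      (e₀ : (gen₀ t _ lY0.fst ≫ (inj t Y y0).f) ≫ k = (gen₀ t _ lY0.fst ≫ (inj t Y y0).f) ≫ l)
      (e₁ : (gen₁ t _ lY0.snd ≫ (inj t Y y0).f) ≫ k = (gen₁ t _ lY0.snd ≫ (inj t Y y0).f) ≫ l)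
      (e₂ : (gen₀ t _ lY1.fst ≫ (inj t Y y1).f) ≫ k = (gen₀ t _ lY1.fst ≫ (inj t Y y1).f) ≫ l)
      (e₃ : (gen₁ t _ lY1.snd ≫ (inj t Y y1).f) ≫ k = (gen₁ t _ lY1.snd ≫ (inj t Y y1).f) ≫ l) :
      k = l := by
    simp only [Category.assoc] at e₀ e₁ e₂ e₃
    refine ofCPi_ext fun i => ?_
    rcases hY i with rfl | rfl
    · exact gen_ext _ _ e₀ e₁
    · exact gen_ext _ _ e₂ e₃
  refine ⟨u, ?_, ?_, ?_⟩
  · refine isPushout_of_generators hab.le hbc.le hcx.le hxy.le hyz.le hza.le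
      (gen₀ t _ lX.fst ≫ (inj t X x0).f) (gen₁ t _ lX.snd ≫ (inj t X x0).f) ?_
      (hull.gen₀₀ t lX ≫ (hullInj t X x0).f) (hull.gen₀₁ t lX ≫ (hullInj t X x0).f)
      (hull.gen₁₀ t lX ≫ (hullInj t X x0).f) (hull.gen₁₁ t lX ≫ (hullInj t X x0).f) ?_
      (gen₀ t _ lY0.fst ≫ (inj t Y y0).f) (gen₁ t _ lY0.snd ≫ (inj t Y y0).f)
      (gen₀ t _ lY1.fst ≫ (inj t Y y1).f) (gen₁ t _ lY1.snd ≫ (inj t Y y1).f) eY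
      (gen₀ t _ lZ0.fst ≫ (inj t Z z0).f) (gen₁ t _ lZ0.snd ≫ (inj t Z z0).f)
      (gen₀ t _ lZ1.fst ≫ (inj t Z z1).f) (gen₁ t _ lZ1.snd ≫ (inj t Z z1).f)
      (gen₀ t _ lZ2.fst ≫ (inj t Z z2).f) (gen₁ t _ lZ2.snd ≫ (inj t Z z2).f) ?_ ?_
      h₁ h₂ i₀ i₁ f₀ f₁ ?_ ?_ ?_ ?_ m₀ m₁ m₂ m₃
    · intro W k l e₀ e₁
      simp only [Category.assoc] at e₀ e₁
      refine ofCPi_ext fun i => ?_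
      obtain rfl := hX i
      exact gen_ext _ _ e₀ e₁
    · intro W k l e₀ e₁ e₂ e₃
      simp only [Category.assoc] at e₀ e₁ e₂ e₃
      refine sumHull_ext fun i => ?_
      obtain rfl := hX i
      exact hull.gen_ext lX e₀ e₁ e₂ e₃
    · intro W k l e₀ e₁ e₂ e₃ e₄ e₅
      simp only [Category.assoc] at e₀ e₁ e₂ e₃ e₄ e₅
      refine ofCPi_ext fun i => ?_
      rcases hZ i with rfl | rfl | rfl
      · exact gen_ext _ _ e₀ e₁
      · exact gen_ext _ _ e₂ e₃
      · exact gen_ext _ _ e₄ e₅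
    · intro W w₀ w₁ w₂ w₃ w₄ w₅
      obtain ⟨k₀, hk₀, hk₀'⟩ := exists_gen_desc lZ0.fst lZ0.snd w₀ w₁
      obtain ⟨k₁, hk₁, hk₁'⟩ := exists_gen_desc lZ1.fst lZ1.snd w₂ w₃
      obtain ⟨k₂, hk₂, hk₂'⟩ := exists_gen_desc lZ2.fst lZ2.snd w₄ w₅
      obtain ⟨k, hk, hk', hk''⟩ := exists_ofCPi_desc_of_three hz hz' hz'' k₀ k₁ k₂
      refine ⟨k, ?_, ?_, ?_, ?_, ?_, ?_⟩
      · rw [Category.assoc, hk, hk₀]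
      · rw [Category.assoc, hk, hk₀']
      · rw [Category.assoc, hk', hk₁]
      · rw [Category.assoc, hk', hk₁']
      · rw [Category.assoc, hk'', hk₂]
      · rw [Category.assoc, hk'', hk₂']
    all_goals rw [Category.assoc, hu']; assumption
  -- Both composites agree on the four generators of the hull, because every entry of `Z ⟶ ΣX` is
  -- `1` and the angles add up.
  · apply FPi.hom_ext
    refine sumHull_ext fun i => ?_
    obtain rfl := hX i
    rw [← comp_f, ← comp_f, hullInj_sumHullOut, ← Category.assoc, hu]
    refine hull.gen_ext lX ?_ ?_ ?_ ?_
    · rw [comp_f, comp_f, assoc_of v₀, assoc_of (hull.gen₀₀_hullOut lX)]; exact q₄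
    · rw [comp_f, comp_f, assoc_of v₁, assoc_of (hull.gen₀₁_hullOut lX), Category.assoc, q₅,
        up_up, Category.assoc]
    · rw [comp_f, comp_f, assoc_of v₂, assoc_of (hull.gen₁₀_hullOut lX), Category.assoc, q₀,
        up_up, Category.assoc]
    · rw [comp_f, comp_f, assoc_of v₃, assoc_of (hull.gen₁₁_hullOut lX)]; exact q₁
  -- Each row of `μ` has sum zero, and the two routes to `ΣX` turn by the same angle, so their
  -- contributions cancel.
  · apply FPi.hom_ext
    rw [comp_f, zero_f]
    apply eY
    · rw [assoc_of m₀, comp_zero, Preadditive.add_comp, Linear.smul_comp, Linear.smul_comp,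
        Category.assoc (up t _), q₀, q₂, up_up, neg_smul, neg_add_cancel]
    · rw [assoc_of m₁, comp_zero, Preadditive.add_comp, Linear.smul_comp, Linear.smul_comp,
        Category.assoc (up t _), q₁, q₃, neg_smul, neg_add_cancel]
    · rw [assoc_of m₂, comp_zero, Preadditive.add_comp, Linear.smul_comp, Linear.smul_comp,
        Category.assoc (up t _), q₂, q₄, neg_smul, neg_add_cancel]
    · rw [assoc_of m₃, comp_zero, Preadditive.add_comp, Linear.smul_comp, Linear.smul_comp,
        Category.assoc (up t _), q₃, q₅, up_up, neg_smul, neg_add_cancel]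

end FPi

/-! ### Nested arcs and diagonal automorphisms -/

namespace IndC

section

variable {K : Type*} {X Y : IndC K} {x₀ x₁ y₀ y₁ : ℝ}

/-- The only candidate for the second coordinate of a lift is `y₁ + 2π` in the linked case and `y₀ +
2π` in the counter-linked case; both lie beyond `x₀ + 2π`. -/
theorem IsLift.sgn_eq_zero_of_nested (hX : X.IsLift x₀ x₁) (hY : Y.IsLift y₀ y₁) (h₀ : x₀ < y₀)
    (h₁ : y₁ < x₁) : sgn X Y = 0 := by
  have := hX.lt'
  have := hY.lt
  apply sgn_eq_zero
  · rw [linked_iff_of_lift hX.fst hX.snd' hY.fst ((Circ.coe_add_two_pi _).trans hY.snd') hX.lt hX.lt'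
      (by linarith) (by linarith) (by linarith) (by linarith)]
    intro h
    linarith [h.2]
  · rw [counterLinked_iff, linked_iff_of_lift hX.fst hX.snd' hY.swap.fst hY.swap.snd' hX.lt hX.lt'
      (by linarith) (by linarith) (by linarith) (by linarith)]
    intro h
    linarith [h.2]

/-- Here the first coordinate fails: the candidates `x₀ + 2π` and `x₁` both lie beyond `y₁`. -/
theorem IsLift.sgn_eq_zero_of_nested' (hX : X.IsLift x₀ x₁) (hY : Y.IsLift y₀ y₁) (h₀ : x₀ < y₀)
    (h₁ : y₁ < x₁) : sgn Y X = 0 := by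
  have := hX.lt'
  have := hY.lt
  apply sgn_eq_zero
  · rw [linked_iff_of_lift hY.fst hY.snd' ((Circ.coe_add_two_pi _).trans hX.fst) hX.snd' hY.lt hY.lt'
      (by linarith) (by linarith) (by linarith) (by linarith)]
    intro h
    linarith [h.1]
  · rw [counterLinked_iff, linked_iff_of_lift hY.fst hY.snd' hX.swap.fst hX.swap.snd' hY.lt hY.lt'
      (by linarith) (by linarith) (by linarith) (by linarith)]
    intro h
    linarith [h.1]

theorem IsLift.sgn_ne_zero (hX : X.IsLift x₀ x₁) (hY : Y.IsLift y₀ y₁) (h1 : x₀ ≤ y₀)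
    (h2 : y₀ < x₁) (h3 : x₁ ≤ y₁) (h4 : y₁ < x₀ + 2 * Real.pi) : sgn X Y ≠ 0 := by
  rw [sgn_of_linked (hX.linked hY h1 h2 h3 h4)]
  decide

end

variable {K : Type*} [Field K] {X Y : IndC K}

theorem coeff_comp_end (f : X ⟶ Y) (g : Y ⟶ Y) : (f ≫ g).coeff = f.coeff * g.coeff := by
  change (if _ then _ else _) = _
  rw [if_pos (by rw [sgn_self, mul_one])]

theorem coeff_end_comp (f : X ⟶ X) (g : X ⟶ Y) : (f ≫ g).coeff = f.coeff * g.coeff := by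
  change (if _ then _ else _) = _
  rw [if_pos (by rw [sgn_self, one_mul])]

theorem hom_eq_zero_of_sgn (h : sgn X Y = 0) (f : X ⟶ Y) : f = 0 := hom_ext (f.zero h)

end IndC

namespace CPi

open IndC

variable {K : Type*} [Field K] {X Y Z : CPi K}

/-- The hypothesis makes `α` diagonal, so it rescales the columns of `g`; the sign of an
endomorphism of a summand is `1`, so no product is lost to the composition rule. -/
theorem coeff_comp_of_sgn (hZ : ∀ i j, i ≠ j → sgn (Z.X i) (Z.X j) = 0) (g : Y ⟶ Z) (α : Z ⟶ Z)
    (i : Y.ι) (j : Z.ι) : ((g ≫ α) i j).coeff = (g i j).coeff * (α j j).coeff := by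
  rw [Mat_.comp_apply, Finset.sum_eq_single j, coeff_comp_end]
  · intro k _ hk
    rw [hom_eq_zero_of_sgn (hZ k j hk) (α k j), comp_zero]
  · simp

theorem coeff_of_sgn_comp (hZ : ∀ i j, i ≠ j → sgn (Z.X i) (Z.X j) = 0) (α : Z ⟶ Z) (h : Z ⟶ Y)
    (i : Z.ι) (j : Y.ι) : ((α ≫ h) i j).coeff = (α i i).coeff * (h i j).coeff := by
  rw [Mat_.comp_apply, Finset.sum_eq_single i, coeff_end_comp]
  · intro k _ hk
    rw [hom_eq_zero_of_sgn (hZ i k hk.symm) (α i k), zero_comp]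
  · simp

theorem coeff_id (i : Z.ι) : ((𝟙 Z : Z ⟶ Z) i i).coeff = 1 := by
  classical
  rw [Mat_.id_apply_self]; rfl

/-- The isomorphisms in question are the invertible diagonal matrices, so an isomorphism of
triangles over `Y` and `X` becomes a rescaling by nonzero scalars `c`. -/
theorem exists_iso_iff_of_sgn (hZ : ∀ i j, i ≠ j → sgn (Z.X i) (Z.X j) = 0) {g g₀ : Y ⟶ Z}
    {h h₀ : Z ⟶ X} : (∃ α : Z ≅ Z, g ≫ α.hom = g₀ ∧ α.hom ≫ h₀ = h) ↔
      ∃ c : Z.ι → K, (∀ i, c i ≠ 0) ∧ (∀ i j, (g i j).coeff * c j = (g₀ i j).coeff) ∧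
        ∀ i j, c i * (h₀ i j).coeff = (h i j).coeff := by
  classical
  constructor
  · rintro ⟨α, rfl, rfl⟩
    refine ⟨fun i => (α.hom i i).coeff, fun i (hi : (α.hom i i).coeff = 0) => ?_, fun i j => ?_, fun i j => ?_⟩
    -- For diagonal matrices the `i`-th diagonal entry of `α ≫ α⁻¹` is the product of the `i`-th
    -- entries, so neither can vanish.
    · have := coeff_of_sgn_comp hZ α.hom α.inv i i
      rw [α.hom_inv_id, coeff_id, hi, zero_mul] at this
      exact one_ne_zero this
    · rw [coeff_comp_of_sgn hZ]
    · rw [coeff_of_sgn_comp hZ]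
  · rintro ⟨c, hc, hg, hh⟩
    let D (c : Z.ι → K) : Z ⟶ Z := fun i j =>
      ⟨if i = j then c i else 0, fun e => if_neg fun e' => by simp [e', sgn_self] at e⟩
    have hD (c : Z.ι → K) (i : Z.ι) : (D c i i).coeff = c i := if_pos rfl
    have inv {c d : Z.ι → K} (h : ∀ i, c i * d i = 1) : D c ≫ D d = 𝟙 Z := by
      refine funext fun i => funext fun j => hom_ext ?_
      rw [coeff_comp_of_sgn hZ, hD]
      by_cases e : i = j
      · subst e
        rw [hD, h, coeff_id]
      · rw [Mat_.id_apply_of_ne _ _ _ e]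
        change (if i = j then c i else 0) * d j = 0
        rw [if_neg e, zero_mul]
    refine ⟨⟨D c, D fun i => (c i)⁻¹, inv fun i => mul_inv_cancel₀ (hc i),
      inv fun i => inv_mul_cancel₀ (hc i)⟩, ?_, ?_⟩
    · refine funext fun i => funext fun j => hom_ext ?_
      rw [coeff_comp_of_sgn hZ, hD, hg]
    · refine funext fun i => funext fun j => hom_ext ?_
      rw [coeff_of_sgn_comp hZ, hD, hh]

end CPi

/-! ### The standard triangle and the scalars of all triangles -/

namespace FPi

open PS1 E IndC

variable {R : Type u} [CommRing R] [IsDomain R] [IsDiscreteValuationRing R] {t : R}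
  {X Y Z : CPi (IsLocalRing.ResidueField R)}

/-- A distinguished triangle starting with `f : (a, x) ⟶ (b, z) ⊕ (c, y)`, to which all the others
are isomorphic. -/
theorem exists_standard_triangle (ht : Irreducible t) {a b c x y z : ℝ}
    (hab : a < b) (hbc : b < c) (hcx : c < x) (hxy : x < y) (hyz : y < z)
    (hza : z < a + 2 * Real.pi)
    {x0 : X.ι} (hX : ∀ i, i = x0) (lX : (X.X x0).IsLift a x)
    {y0 y1 : Y.ι} (hy : y0 ≠ y1) (hY : ∀ i, i = y0 ∨ i = y1)
    (lY0 : (Y.X y0).IsLift b z) (lY1 : (Y.X y1).IsLift c y)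
    {z0 z1 z2 : Z.ι} (hz : z0 ≠ z1) (hz' : z0 ≠ z2) (hz'' : z1 ≠ z2)
    (hZ : ∀ i, i = z0 ∨ i = z1 ∨ i = z2)
    (lZ0 : (Z.X z0).IsLift b (a + 2 * Real.pi)) (lZ1 : (Z.X z1).IsLift c z)
    (lZ2 : (Z.X z2).IsLift x y) (f : X ⟶ Y) (hf₁ : f x0 y0 ≠ 0) (hf₂ : f x0 y1 ≠ 0) :
    ∃ (g₀ : Y ⟶ Z) (h₀ : Z ⟶ X.shift),
      ((g₀ y0 z0).coeff = -(f x0 y0).coeff⁻¹ ∧ (g₀ y0 z1).coeff = (f x0 y0).coeff⁻¹ ∧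
        (g₀ y0 z2).coeff = 0 ∧ (g₀ y1 z0).coeff = 0 ∧
        (g₀ y1 z1).coeff = -(f x0 y1).coeff⁻¹ ∧ (g₀ y1 z2).coeff = (f x0 y1).coeff⁻¹ ∧
        ∀ i j, (h₀ i j).coeff = 1) ∧
      ∀ {Z' : CPi (IsLocalRing.ResidueField R)} {g : Y ⟶ Z'} {h : Z' ⟶ X.shift},
        IsDistinguished t f g h ↔ ∃ α : Z' ≅ Z, g ≫ α.hom = g₀ ∧ α.hom ≫ h₀ = h := by
  classical
  have lS : (X.shift.X x0).IsLift x (a + 2 * Real.pi) := lX.swap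
  choose ρ hρ using fun i j => IsLocalRing.residue_surjective (R := R) (f i j).coeff
  have unit {j : Y.ι} (hj : f x0 j ≠ 0) : ∃ s, ρ x0 j * s = 1 ∧
      IsLocalRing.residue R s = (f x0 j).coeff⁻¹ := by
    have hc : (f x0 j).coeff ≠ 0 := fun e => hj (IndC.hom_ext e)
    -- This is where the nonvanishing of the components of `f` enters: in a local ring a lifting of
    -- a nonzero residue class is a unit.
    have hu : IsUnit (ρ x0 j) := by
      rw [← hρ] at hc
      exact IsLocalRing.residue_ne_zero_iff_isUnit _ |>.1 hc
    obtain ⟨s, hs⟩ := hu.exists_right_inv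
    refine ⟨s, hs, eq_inv_of_mul_eq_one_right ?_⟩
    rw [← hρ, ← map_mul, hs, map_one]
  obtain ⟨s₁, hs₁, es₁⟩ := unit hf₁
  obtain ⟨s₂, hs₂, es₂⟩ := unit hf₂
  -- The two entries set to `0` are those between the nested pairs `(b, z)`, `(x, y)` and `(c, y)`,
  -- `(b, a + 2π)`. The others make the terms at `(c, z)` cancel after composition with `f`.
  let μ (i : Y.ι) (j : Z.ι) : R :=
    if i = y0 then (if j = z0 then -s₁ else if j = z1 then s₁ else 0)
    else (if j = z0 then 0 else if j = z1 then -s₂ else s₂)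
  have μ00 : μ y0 z0 = -s₁ := by simp [μ]
  have μ01 : μ y0 z1 = s₁ := by simp [μ, hz.symm]
  have μ02 : μ y0 z2 = 0 := by simp [μ, hz'.symm, hz''.symm]
  have μ10 : μ y1 z0 = 0 := by simp [μ, hy.symm]
  have μ11 : μ y1 z1 = -s₂ := by simp [μ, hy.symm, hz.symm]
  have μ12 : μ y1 z2 = s₂ := by simp [μ, hy.symm, hz'.symm, hz''.symm]
  obtain ⟨u, hP, huq, hmq⟩ := exists_standard_pushout (t := t) hab hbc hcx hxy hyz hza hX lX hy hY
    lY0 lY1 hz hz' hz'' hZ lZ0 lZ1 lZ2 hs₁ hs₂ (ρ := ρ) rfl rfl μ00 μ01 μ02 μ10 μ11 μ12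
  let g₀ : Y ⟶ Z := fun i j => ⟨IsLocalRing.residue R (μ i j), by
    rcases hY i with rfl | rfl <;> rcases hZ j with rfl | rfl | rfl
    · exact fun e => absurd e (lY0.sgn_ne_zero lZ0 (by linarith) (by linarith) (by linarith)
        (by linarith))
    · exact fun e => absurd e (lY0.sgn_ne_zero lZ1 (by linarith) (by linarith) (by linarith)
        (by linarith))
    · exact fun _ => by rw [μ02, map_zero]
    · exact fun _ => by rw [μ10, map_zero]
    · exact fun e => absurd e (lY1.sgn_ne_zero lZ1 (by linarith) (by linarith) (by linarith)
        (by linarith))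
    · exact fun e => absurd e (lY1.sgn_ne_zero lZ2 (by linarith) (by linarith) (by linarith)
        (by linarith))⟩
  let h₀ : Z ⟶ X.shift := fun i j => ⟨1, by
    obtain rfl := hX j
    rcases hZ i with rfl | rfl | rfl
    · exact fun e => absurd e (lZ0.sgn_ne_zero lS (by linarith) (by linarith) (by linarith)
        (by linarith))
    · exact fun e => absurd e (lZ1.sgn_ne_zero lS (by linarith) (by linarith) (by linarith)
        (by linarith))
    · exact fun e => absurd e (lZ2.sgn_ne_zero lS (by linarith) (by linarith) (by linarith)
        (by linarith))⟩
  have hg₀ (i j) : (g₀ i j).coeff = IsLocalRing.residue R (μ i j) := rfl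
  refine ⟨g₀, h₀, ⟨?_, ?_, ?_, ?_, ?_, ?_, fun _ _ => rfl⟩, ?_⟩
  · rw [hg₀, μ00, map_neg, es₁]
  · rw [hg₀, μ01, es₁]
  · rw [hg₀, μ02, map_zero]
  · rw [hg₀, μ10, map_zero]
  · rw [hg₀, μ11, map_neg, es₂]
  · rw [hg₀, μ12, es₂]
  · exact isDistinguished_iff ht (represents_ofBasic hρ) (represents_ofBasic fun _ _ => rfl)
      (represents_ofBasic fun _ _ => map_one _) hP huq hmq

/-- The distinguished triangles starting with `f : (a, x) ⟶ (b, z) ⊕ (c, y)`, in terms of the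
scalars of their morphisms. -/
theorem isDistinguished_iff_coeff (ht : Irreducible t) {a b c x y z : ℝ}
    (hab : a < b) (hbc : b < c) (hcx : c < x) (hxy : x < y) (hyz : y < z)
    (hza : z < a + 2 * Real.pi)
    {x0 : X.ι} (hX : ∀ i, i = x0) (lX : (X.X x0).IsLift a x)
    {y0 y1 : Y.ι} (hy : y0 ≠ y1) (hY : ∀ i, i = y0 ∨ i = y1)
    (lY0 : (Y.X y0).IsLift b z) (lY1 : (Y.X y1).IsLift c y)
    {z0 z1 z2 : Z.ι} (hz : z0 ≠ z1) (hz' : z0 ≠ z2) (hz'' : z1 ≠ z2)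
    (hZ : ∀ i, i = z0 ∨ i = z1 ∨ i = z2)
    (lZ0 : (Z.X z0).IsLift b (a + 2 * Real.pi)) (lZ1 : (Z.X z1).IsLift c z)
    (lZ2 : (Z.X z2).IsLift x y) (f : X ⟶ Y) (hf₁ : f x0 y0 ≠ 0) (hf₂ : f x0 y1 ≠ 0)
    (g : Y ⟶ Z) (h : Z ⟶ X.shift) : IsDistinguished t f g h ↔
      (h z0 x0).coeff * (g y0 z0).coeff * (f x0 y0).coeff = -1 ∧
      (h z1 x0).coeff * (g y0 z1).coeff * (f x0 y0).coeff = 1 ∧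
      (h z1 x0).coeff * (g y1 z1).coeff * (f x0 y1).coeff = -1 ∧
      (h z2 x0).coeff * (g y1 z2).coeff * (f x0 y1).coeff = 1 ∧
      (g y1 z0).coeff = 0 ∧ (g y0 z2).coeff = 0 := by
  obtain ⟨g₀, h₀, ⟨g00, g01, g02, g10, g11, g12, hh⟩, key⟩ :=
    exists_standard_triangle ht hab hbc hcx hxy hyz hza hX lX hy hY lY0 lY1 hz hz' hz'' hZ lZ0 lZ1
      lZ2 f hf₁ hf₂
  have c₁ : (f x0 y0).coeff ≠ 0 := fun e => hf₁ (IndC.hom_ext e)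
  have c₂ : (f x0 y1).coeff ≠ 0 := fun e => hf₂ (IndC.hom_ext e)
  -- The arcs `(b, a + 2π)`, `(c, z)`, `(x, y)` are strictly nested, each containing the next.
  have sZ (i j : Z.ι) (hij : i ≠ j) : sgn (Z.X i) (Z.X j) = 0 := by
    rcases hZ i with rfl | rfl | rfl <;> rcases hZ j with rfl | rfl | rfl
    · exact absurd rfl hij
    · exact lZ0.sgn_eq_zero_of_nested lZ1 hbc hza
    · exact lZ0.sgn_eq_zero_of_nested lZ2 (by linarith) (by linarith)
    · exact lZ0.sgn_eq_zero_of_nested' lZ1 hbc hza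
    · exact absurd rfl hij
    · exact lZ1.sgn_eq_zero_of_nested lZ2 hcx hyz
    · exact lZ0.sgn_eq_zero_of_nested' lZ2 (by linarith) (by linarith)
    · exact lZ1.sgn_eq_zero_of_nested' lZ2 hcx hyz
    · exact absurd rfl hij
  rw [key, CPi.exists_iso_iff_of_sgn sZ]
  constructor
  · rintro ⟨d, hd, hg, hh'⟩
    -- As all entries of `h₀` are `1`, the rescaling is read off from `h`. Each product `h_j g_{ji}
    -- f_i` then equals that of the standard triangle.
    have e (i : Z.ι) : (h i x0).coeff = d i := by rw [← hh', hh, mul_one]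
    have k02 := (hg y0 z2).trans g02
    have k10 := (hg y1 z0).trans g10
    refine ⟨?_, ?_, ?_, ?_, (mul_eq_zero.1 k10).resolve_right (hd _),
      (mul_eq_zero.1 k02).resolve_right (hd _)⟩
    · rw [e, mul_comm (d _), hg, g00, neg_mul, inv_mul_cancel₀ c₁]
    · rw [e, mul_comm (d _), hg, g01, inv_mul_cancel₀ c₁]
    · rw [e, mul_comm (d _), hg, g11, neg_mul, inv_mul_cancel₀ c₂]
    · rw [e, mul_comm (d _), hg, g12, inv_mul_cancel₀ c₂]
  · rintro ⟨k00, k01, k11, k12, k10, k02⟩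
    -- The only possible rescaling is `h` itself. The nonzero products force its entries to be
    -- nonzero, and dividing by the `f_i` recovers the entries of `g₀`.
    refine ⟨fun i => (h i x0).coeff, fun i => ?_, fun i j => ?_, fun i j => ?_⟩
    · intro e
      rcases hZ i with rfl | rfl | rfl
      · simp [e] at k00
      · simp [e] at k01
      · simp [e] at k12
    · rw [mul_comm]
      rcases hY i with rfl | rfl <;> rcases hZ j with rfl | rfl | rfl
      · rw [g00]
        exact neg_eq_iff_eq_neg.1 (eq_inv_of_mul_eq_one_left (by rw [neg_mul, k00, neg_neg]))
      · rw [g01]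
        exact eq_inv_of_mul_eq_one_left k01
      · rw [g02, k02, mul_zero]
      · rw [g10, k10, mul_zero]
      · rw [g11]
        exact neg_eq_iff_eq_neg.1 (eq_inv_of_mul_eq_one_left (by rw [neg_mul, k11, neg_neg]))
      · rw [g12]
        exact eq_inv_of_mul_eq_one_left k12
    · obtain rfl := hX j
      rw [hh, mul_one]

end FPi

theorem mainTheorem10 {R : Type u} [CommRing R] [IsDomain R] [IsDiscreteValuationRing R]
    (t : R) (ht : Irreducible t) (a b c x y z : ℝ)
    (hab : a < b) (hbc : b < c) (hcx : c < x) (hxy : x < y) (hyz : y < z)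
    (hza : z < a + 2 * Real.pi) :
    let X : CPi (IsLocalRing.ResidueField R) :=
      CPi.sum ![IndC.mk' a x (by linarith) (by linarith)]
    let Y : CPi (IsLocalRing.ResidueField R) :=
      CPi.sum ![IndC.mk' b z (by linarith) (by linarith), IndC.mk' c y (by linarith) (by linarith)]
    let Z₀ : CPi (IsLocalRing.ResidueField R) :=
      CPi.sum ![IndC.mk' b (a + 2 * Real.pi) (by linarith) (by linarith),
        IndC.mk' c z (by linarith) (by linarith), IndC.mk' x y (by linarith) (by linarith)]
    ∀ f : X ⟶ Y, f (0 : Fin 1) (0 : Fin 2) ≠ 0 → f (0 : Fin 1) (1 : Fin 2) ≠ 0 →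
      (∀ Z : CPi (IsLocalRing.ResidueField R),
        (∃ (g : Y ⟶ Z) (h : Z ⟶ X.shift), IsDistinguished t f g h) ↔ Nonempty (Z ≅ Z₀)) ∧
      ∀ (g : Y ⟶ Z₀) (h : Z₀ ⟶ X.shift), IsDistinguished t f g h ↔
        (h (0 : Fin 3) (0 : Fin 1)).coeff * (g (0 : Fin 2) (0 : Fin 3)).coeff *
            (f (0 : Fin 1) (0 : Fin 2)).coeff = -1 ∧
        (h (1 : Fin 3) (0 : Fin 1)).coeff * (g (0 : Fin 2) (1 : Fin 3)).coeff *
            (f (0 : Fin 1) (0 : Fin 2)).coeff = 1 ∧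
        (h (1 : Fin 3) (0 : Fin 1)).coeff * (g (1 : Fin 2) (1 : Fin 3)).coeff *
            (f (0 : Fin 1) (1 : Fin 2)).coeff = -1 ∧
        (h (2 : Fin 3) (0 : Fin 1)).coeff * (g (1 : Fin 2) (2 : Fin 3)).coeff *
            (f (0 : Fin 1) (1 : Fin 2)).coeff = 1 ∧
        (g (1 : Fin 2) (0 : Fin 3)).coeff = 0 ∧
        (g (0 : Fin 2) (2 : Fin 3)).coeff = 0 := by
  intro X Y Z₀ f hf₁ hf₂
  have lX : (X.X (0 : Fin 1)).IsLift a x := IndC.isLift_mk' (by linarith) (by linarith)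
  have lY0 : (Y.X (0 : Fin 2)).IsLift b z := IndC.isLift_mk' (by linarith) (by linarith)
  have lY1 : (Y.X (1 : Fin 2)).IsLift c y := IndC.isLift_mk' (by linarith) (by linarith)
  have lZ0 : (Z₀.X (0 : Fin 3)).IsLift b (a + 2 * Real.pi) :=
    IndC.isLift_mk' (by linarith) (by linarith)
  have lZ1 : (Z₀.X (1 : Fin 3)).IsLift c z := IndC.isLift_mk' (by linarith) (by linarith)
  have lZ2 : (Z₀.X (2 : Fin 3)).IsLift x y := IndC.isLift_mk' (by linarith) (by linarith)
  have eX (i : Fin 1) : i = 0 := Subsingleton.elim i 0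
  have eY (i : Fin 2) : i = 0 ∨ i = 1 := by omega
  have eZ (i : Fin 3) : i = 0 ∨ i = 1 ∨ i = 2 := by omega
  have hy : (0 : Fin 2) ≠ 1 := by decide
  have hz : (0 : Fin 3) ≠ 1 := by decide
  have hz' : (0 : Fin 3) ≠ 2 := by decide
  have hz'' : (1 : Fin 3) ≠ 2 := by decide
  refine ⟨fun Z => ?_, FPi.isDistinguished_iff_coeff ht hab hbc hcx hxy hyz hza eX lX hy eY lY0 lY1
    hz hz' hz'' eZ lZ0 lZ1 lZ2 f hf₁ hf₂⟩
  obtain ⟨g₀, h₀, -, key⟩ := FPi.exists_standard_triangle ht hab hbc hcx hxy hyz hza eX lX hy eY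
    lY0 lY1 hz hz' hz'' eZ lZ0 lZ1 lZ2 f hf₁ hf₂
  constructor
  · rintro ⟨g, h, H⟩
    obtain ⟨α, -⟩ := key.1 H
    exact ⟨α⟩
  · rintro ⟨α⟩
    -- An isomorphism `α` transports the standard triangle to one with third object `Z`.
    exact ⟨g₀ ≫ α.inv, α.hom ≫ h₀, key.2 ⟨α, by simp, rfl⟩⟩
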